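/- All graphs are finite and simple. The stability number $\alpha(G)$ of a graph $G$ is the maximum cardinality of a stable (independent) set of $G$, and $F(G)$ is the number of stable sets of $G$, including the empty one. A tree $T$ is extremal if $F(T)\le F(T')$ for every tree $T'$ with the same number of vertices and the same stability number as $T$. A leaf is a vertex of degree at most $1$. Trees of stars are defined inductively: a single vertex is a tree of stars; and if $T_1,\dots,T_k$ ($k\ge 2$) are disjoint trees of stars and $v_i$ is a leaf of $T_i$ for each $i$, then the tree obtained from $T_1\cup\dots\cup T_k$ by adding a new vertex $w$ adjacent exactly to $v_1,\dots,v_k$ is a tree of stars. A center of a tree of stars is a vertex whose distances to all leaves are odd. A tree of stars is balanced if the degrees of any two of its centers differ by at most $1$. The center-tree of a tree of stars $T$ has the centers of $T$ as vertices, two of them being adjacent if they are at distance $2$ in $T$. For a balanced tree of stars with $n$ vertices and stability number $\alpha$, every center has degree $\left\lceil\frac{n-1}{n-\alpha}\right\rceil$ or $\left\lceil\frac{n-1}{n-\alpha}\right\rceil-1$; it is called light in the second case. Let $h(n,\alpha)=(n-1)\bmod(n-\alpha)$ if this is non-zero and $h(n,\alpha)=n-\alpha$ otherwise, and let $\ell(n,\alpha)=n-\alpha-h(n,\alpha)$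 (the number of light centers). For $n=\alpha=1$ put $\ell(1,1)=0$; the one-vertex tree has no centers, and its empty center-tree counts as a path. Theorem. Let $T$ be a tree with $n$ vertices and stability number $\alpha>n/2$, and assume $\ell(n,\alpha)\le 2$. Then $T$ is extremal if and only if the following three conditions hold: (1) $T$ is a balanced tree of stars; (2) the center-tree of $T$ is isomorphic to a path $P$; (3) each light center of $T$ (if any) is an endpoint of $P$. -/

import Mathlib

namespace SimpleGraph

/-- The Fibonacci number of a graph: its number of stable (independent) sets, the empty set
included. -/
noncomputable def fibonacciNumber {V : Type*} (G : SimpleGraph V) : ℕ :=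
  {s : Finset V | G.IsIndepSet (s : Set V)}.ncard

/-- A tree is extremal if it minimizes the Fibonacci number among all trees with the same number
of vertices and the same stability number. (Trees of the same order may be taken on the same
vertex set, since everything is invariant under isomorphism.) -/
def IsExtremalTree {V : Type*} (G : SimpleGraph V) : Prop :=
  G.IsTree ∧ ∀ H : SimpleGraph V, H.IsTree → H.indepNum = G.indepNum →
    G.fibonacciNumber ≤ H.fibonacciNumber

/-- A leaf is a vertex of degree at most one. -/
def IsLeafVertex {V : Type*} (G : SimpleGraph V) (v : V) : Prop :=
  (G.neighborSet v).ncard ≤ 1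

/-- `G.IsTreeOfStarsOn S`: the subgraph of `G` induced by `S` is a tree of stars. Either it is a
single vertex, or it arises from `k ≥ 2` disjoint trees of stars, with a leaf `v i` chosen in each
of them, by adding a new vertex `w` adjacent exactly to the vertices `v i`. -/
inductive IsTreeOfStarsOn {V : Type*} (G : SimpleGraph V) : Set V → Prop
  | single (x : V) : IsTreeOfStarsOn G {x}
  | join {k : ℕ} (hk : 2 ≤ k) (S : Fin k → Set V) (v : ∀ i, S i) (w : V)
      (tos : ∀ i, IsTreeOfStarsOn G (S i))
      (leaf : ∀ i, (G.induce (S i)).IsLeafVertex (v i))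
      (disj : ∀ i j, i ≠ j → Disjoint (S i) (S j))
      (new : ∀ i, w ∉ S i)
      (adj_new : ∀ i, ∀ x ∈ S i, G.Adj w x ↔ x = v i)
      (not_adj : ∀ i j, i ≠ j → ∀ x ∈ S i, ∀ y ∈ S j, ¬ G.Adj x y) :
      IsTreeOfStarsOn G (insert w (⋃ i, S i))

/-- The graph `G` is a tree of stars. -/
def IsTreeOfStars {V : Type*} (G : SimpleGraph V) : Prop :=
  G.IsTreeOfStarsOn Set.univ

/-- A center is a vertex at odd distance from all leaves. -/
def IsCenter {V : Type*} (G : SimpleGraph V) (v : V) : Prop :=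
  ∀ l, G.IsLeafVertex l → Odd (G.dist v l)

/-- A balanced tree of stars: the degrees of any two centers differ by at most one. -/
def IsBalancedTreeOfStars {V : Type*} (G : SimpleGraph V) : Prop :=
  G.IsTreeOfStars ∧ ∀ u v, G.IsCenter u → G.IsCenter v →
    (G.neighborSet u).ncard ≤ (G.neighborSet v).ncard + 1

/-- The center-tree: its vertices are the centers, and two of them are adjacent if they are at
distance two. -/
def centerTree {V : Type*} (G : SimpleGraph V) : SimpleGraph {v : V // G.IsCenter v} where
  Adj u v := G.dist (u : V) (v : V) = 2
  symm := ⟨fun u v h => by rw [G.dist_comm]; exact h⟩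
  loopless := ⟨fun u h => by simp at h⟩

/-- The degree `⌈(n - 1) / (n - α)⌉` of the heavy centers. -/
def heavyDegree (n α : ℕ) : ℕ :=
  ⌈((n : ℚ) - 1) / ((n : ℚ) - (α : ℚ))⌉₊

/-- A light center: a center of degree `⌈(n - 1) / (n - α)⌉ - 1`, with `n` the order and `α` the
stability number. -/
def IsLightCenter {V : Type*} (G : SimpleGraph V) (v : V) : Prop :=
  G.IsCenter v ∧ (G.neighborSet v).ncard + 1 = heavyDegree (Nat.card V) G.indepNum

/-- The number `h(n, α)` of heavy centers. -/
def numHeavy (n α : ℕ) : ℕ :=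
  if (n - 1) % (n - α) ≠ 0 then (n - 1) % (n - α) else n - α

/-- The number `ℓ(n, α) = n - α - h(n, α)` of light centers. -/
def numLight (n α : ℕ) : ℕ :=
  n - α - numHeavy n α

end SimpleGraph

/-! Put c = n - α. Complements of stable sets are vertex covers, so extremal trees are sought in the
larger class of trees having a cover of at most c vertices (`IsMinimizer`). Its minimizers turn out
to have stability number exactly α, so the relaxation costs nothing and gives more room for
modifications.

The engine is edge exchange. Let P be the probability of lying in a uniformly random stable set of
the forest left after removing an edge uv. Joining its two parts by zy multiplies the number of
stable sets of the forest by 1 - P(z)P(y); in a minimizer the product P(u)P(v) is therefore largest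
among all admissible choices (`IsMinimizer.pr_mul_le`, `IsMinimizer.ratio_le`). The odds P/(1-P)
obey the tree recursion `msg_eq_prod`: a message is the product of 1/(1+r) over the incoming
messages r.

Every minimizer is a `StarTree` (`IsMinimizer.exists_starTree`). A vertex outside the cover with
three neighbours is excluded by two rewirings together with positive correlation
(`IsMinimizer.high_degree_contra`). For an edge inside the cover, the two-step recursion r ↦
(1+r)/(2+r) and its fixed point, the positive root of x² + x = 1, decide: the branch beyond the edge
either contains a better vertex to attach to, or is an even path along which the cover can be
flipped (`AltBranch.evenTail_or_ratio_lt`, `IsMinimizer.not_evenTail`).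

Moving a branch from a center of too large degree to one of minimal degree gives balance
(`IsMinimizer.balanced`). Exchanging a branch with a leaf (`IsMinimizer.ratio_le_of_exchange`) shows
that a branch without light centers is a caterpillar, and that such a branch cannot hang at a center
with three nonleaf neighbours, nor at a light center with two. Either configuration would thus force
three light centers (`IsMinimizer.inner_eq_or_eq`, `IsMinimizer.inner_eq`), so the center-tree is a
path with its light centers at the ends.

Conversely, a set A of centers extends to a stable set by any set of noncenters having no neighbour
in A, and A has (sum of degrees) - (edges of the center-tree inside A) neighbours. Hence the number
of stable sets depends only on the center-tree and the degrees (`StarTree.fibonacciNumber_eq`). At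
most two light centers at the ends of a path can be placed in one way up to reversal, so all trees
satisfying the conditions have the count of a minimizer. -/

namespace SimpleGraph

open scoped Classical

/-! ### Cutting and adding edges; branches of a tree. -/

section Trees

variable {V : Type*} {G : SimpleGraph V}

/-- The graph without the edge `uv`. -/
def cut (G : SimpleGraph V) (u v : V) : SimpleGraph V := G.deleteEdges {s(u, v)}

/-- The graph with the edge `xy` added. -/
def link (G : SimpleGraph V) (x y : V) : SimpleGraph V := G ⊔ edge x y

lemma cut_adj {u v x y : V} :
    (G.cut u v).Adj x y ↔ G.Adj x y ∧ ¬(x = u ∧ y = v) ∧ ¬(x = v ∧ y = u) := by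
  simp only [cut, deleteEdges_adj, Set.mem_singleton_iff, Sym2.eq_iff]
  tauto

lemma cut_comm (u v : V) : G.cut u v = G.cut v u := by
  simp [cut, Sym2.eq_swap]

lemma cut_le (u v : V) : G.cut u v ≤ G := deleteEdges_le _

lemma cut_of_not_adj {u v : V} (h : ¬ G.Adj u v) : G.cut u v = G := by
  ext x y
  rw [cut_adj]
  refine ⟨fun h => h.1, fun hxy => ⟨hxy, ?_, ?_⟩⟩
  · rintro ⟨rfl, rfl⟩; exact h hxy
  · rintro ⟨rfl, rfl⟩; exact h hxy.symm

lemma link_adj {x y a b : V} (hxy : x ≠ y) :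
    (G.link x y).Adj a b ↔ G.Adj a b ∨ (a = x ∧ b = y) ∨ (a = y ∧ b = x) := by
  simp only [link, sup_adj, edge_adj]
  constructor
  · tauto
  · rintro (h | ⟨rfl, rfl⟩ | ⟨rfl, rfl⟩)
    · exact Or.inl h
    · exact Or.inr ⟨by tauto, hxy⟩
    · exact Or.inr ⟨by tauto, hxy.symm⟩

lemma link_cut {u v : V} (h : G.Adj u v) : (G.cut u v).link u v = G := by
  ext x y
  rw [link_adj h.ne, cut_adj]
  constructor
  · rintro (⟨h, -⟩ | ⟨rfl, rfl⟩ | ⟨rfl, rfl⟩)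
    exacts [h, h, h.symm]
  · tauto

lemma le_link (x y : V) : G ≤ G.link x y := le_sup_left

lemma mem_of_reachable {S : Set V} {u x : V} (hu : u ∈ S)
    (hS : ∀ a ∈ S, ∀ b, G.Adj a b → b ∈ S) (h : G.Reachable u x) : x ∈ S := by
  obtain ⟨p⟩ := h
  induction p with
  | nil => exact hu
  | cons h p ih => exact ih (hS _ hu _ h)

/-- The component of `u` in the graph without the edge `uv`. -/
def branch (G : SimpleGraph V) (u v : V) : Set V := {x | (G.cut u v).Reachable u x}

lemma self_mem_branch (u v : V) : u ∈ G.branch u v := Reachable.refl _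

lemma not_mem_branch (hG : G.IsAcyclic) {u v : V} (h : G.Adj u v) : v ∉ G.branch u v :=
  isAcyclic_iff_forall_adj_isBridge.1 hG h

lemma branch_step {u v x y : V} (hx : x ∈ G.branch u v) (hxy : G.Adj x y)
    (h : ¬ (x = u ∧ y = v)) : y ∈ G.branch u v := by
  by_cases h' : x = v ∧ y = u
  · rw [h'.2]; exact self_mem_branch _ _
  · exact Reachable.trans hx (Adj.reachable (cut_adj.2 ⟨hxy, h, h'⟩))

lemma branch_induction {u v : V} {S : Set V} (hu : u ∈ S)
    (hS : ∀ a ∈ S, a ∈ G.branch u v → ∀ b, (G.cut u v).Adj a b → b ∈ S) :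
    G.branch u v ⊆ S := by
  intro x hx
  refine (mem_of_reachable (S := S ∩ G.branch u v) ⟨hu, self_mem_branch _ _⟩ ?_ hx).1
  rintro a ⟨ha, ha'⟩ b hab
  exact ⟨hS a ha ha' b hab, Reachable.trans ha' hab.reachable⟩

lemma branch_subset_of_adj (hG : G.IsAcyclic) {k u v : V} (h : G.Adj k u) (hk : k ≠ v) :
    G.branch k u ⊆ G.branch u v := by
  refine branch_induction (branch_step (self_mem_branch _ _) h.symm (fun h' => hk h'.2)) ?_
  intro a ha ha' b hab
  refine branch_step ha (cut_adj.1 hab).1 ?_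
  rintro ⟨rfl, -⟩
  exact not_mem_branch hG h ha'

/-- Induction along the branches of a finite forest. -/
theorem IsAcyclic.dart_induction [Finite V] (hG : G.IsAcyclic) {P : V → V → Prop}
    (h : ∀ u v, (∀ k, G.Adj k u → k ≠ v → P k u) → P u v) (u v : V) : P u v := by
  -- The induction is on the size of the branch: the branch of `k` at `u` lies inside that of `u` at
  -- `v` and misses `u`.
  suffices H : ∀ n u v, (G.branch u v).ncard = n → P u v from H _ u v rfl
  intro n
  induction n using Nat.strong_induction_on with
  | _ n ih =>
    intro u v hn
    refine h u v fun k hk hkv => ih _ ?_ k u rfl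
    rw [← hn]
    refine Set.ncard_lt_ncard ⟨branch_subset_of_adj hG hk hkv, fun hs => ?_⟩ (Set.toFinite _)
    exact not_mem_branch hG hk (hs (self_mem_branch u v))

lemma branch_disjoint (hG : G.IsAcyclic) {a b i : V} (ha : G.Adj a i) (hb : G.Adj b i)
    (hab : a ≠ b) : Disjoint (G.branch a i) (G.branch b i) := by
  rw [Set.disjoint_left]
  suffices h : G.branch a i ⊆ (G.branch b i)ᶜ from fun x hx => h hx
  have hba : a ∉ G.branch b i := fun h =>
    not_mem_branch hG hb (branch_step h ha (by rintro ⟨rfl, -⟩; exact hab rfl))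
  refine branch_induction hba ?_
  intro x hx hx' y hxy hy
  have hxy' := cut_adj.1 hxy
  refine hx (branch_step hy hxy'.1.symm ?_)
  rintro ⟨-, rfl⟩
  exact not_mem_branch hG ha hx'

lemma Connected.mem_branch_or (hG : G.Connected) (u v x : V) :
    x ∈ G.branch u v ∨ x ∈ G.branch v u := by
  refine mem_of_reachable (S := {x | x ∈ G.branch u v ∨ x ∈ G.branch v u})
    (Or.inl (self_mem_branch u v)) ?_ (hG.preconnected u x)
  rintro a (ha | ha) b hab
  · by_cases h' : a = u ∧ b = v
    · rw [h'.2]; exact Or.inr (self_mem_branch _ _)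
    · exact Or.inl (branch_step ha hab h')
  · by_cases h' : a = v ∧ b = u
    · rw [h'.2]; exact Or.inl (self_mem_branch _ _)
    · exact Or.inr (branch_step ha hab h')

lemma branch_disjoint_symm (hG : G.IsAcyclic) {u v : V} (h : G.Adj u v) :
    Disjoint (G.branch u v) (G.branch v u) := by
  rw [Set.disjoint_left]
  intro x hx hx'
  refine not_mem_branch hG h (Reachable.trans hx (Reachable.symm ?_))
  rw [cut_comm]; exact hx'

/-- In a tree, every vertex other than `i` lies in a branch at `i`. -/
lemma IsTree.exists_adj_mem_branch (hG : G.IsTree) {i j : V} (hij : i ≠ j) :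
    ∃ k, G.Adj k i ∧ j ∈ G.branch k i := by
  have H : j ∈ {x | x ≠ i → ∃ k, G.Adj k i ∧ x ∈ G.branch k i} := by
    refine mem_of_reachable (u := i) (fun h => (h rfl).elim) ?_ (hG.connected.preconnected i j)
    intro a ha b hab hb
    by_cases hai : a = i
    · subst hai; exact ⟨b, hab.symm, self_mem_branch _ _⟩
    · obtain ⟨k, hk, hk'⟩ := ha hai
      exact ⟨k, hk, branch_step hk' hab (fun h' => hb h'.2)⟩
  exact H hij.symm

lemma IsAcyclic.cut (hG : G.IsAcyclic) (u v : V) : (G.cut u v).IsAcyclic :=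
  hG.anti (cut_le u v)

/-- Removing an edge of a tree and reconnecting the two components gives a tree. -/
theorem IsTree.swap (hG : G.IsTree) {u v z y : V} (h : G.Adj u v) (hz : z ∈ G.branch u v)
    (hy : y ∈ G.branch v u) : ((G.cut u v).link z y).IsTree := by
  have hzy : ¬ (G.cut u v).Reachable z y := by
    intro hr
    have h1 : y ∈ G.branch u v := Reachable.trans hz hr
    exact Set.disjoint_left.1 (branch_disjoint_symm hG.isAcyclic h) h1 hy
  have hne : z ≠ y := by rintro rfl; exact hzy (Reachable.refl _)
  have hy' : (G.cut u v).Reachable v y := by rw [cut_comm]; exact hy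
  have hadj : ((G.cut u v).link z y).Adj z y := (link_adj hne).2 (by tauto)
  have huv : ((G.cut u v).link z y).Reachable u v :=
    (Reachable.mono (le_link _ _) hz).trans
      (hadj.reachable.trans (Reachable.mono (le_link _ _) hy').symm)
  refine { connected := ?_, isAcyclic := ?_ }
  · have := hG.connected.nonempty
    refine Connected.mk ?_
    suffices H : ∀ x, ((G.cut u v).link z y).Reachable u x from
      fun a b => (H a).symm.trans (H b)
    intro x
    rcases hG.connected.mem_branch_or u v x with hx | hx
    · exact Reachable.mono (le_link _ _) hx
    · refine huv.trans (Reachable.mono (le_link _ _) ?_)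
      rw [cut_comm]; exact hx
  · exact IsAcyclic.sup_edge_of_not_reachable hzy (hG.isAcyclic.cut u v)

lemma mem_branch_of_leaf (hG : G.IsTree) {j l x : V} (hjl : G.Adj j l)
    (hleaf : ∀ w, G.Adj l w → w = j) (hx : x ≠ l) : x ∈ G.branch j l := by
  refine (hG.connected.mem_branch_or j l x).resolve_right fun h => hx ?_
  have : G.branch l j ⊆ {l} := branch_induction rfl (by
    rintro a rfl - b hab
    rw [cut_adj] at hab
    exact (hab.2.1 ⟨rfl, hleaf b hab.1⟩).elim)
  exact this h

end Trees

/-! ### Random stable sets: independence, odds and correlation. -/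

section StableSets

variable {V : Type*} [Fintype V] {G H : SimpleGraph V}

/-- The finset of all stable sets. -/
noncomputable def stab (G : SimpleGraph V) : Finset (Finset V) :=
  {s | G.IsIndepSet (s : Set V)}

lemma mem_stab {s : Finset V} : s ∈ G.stab ↔ ∀ a ∈ s, ∀ b ∈ s, ¬ G.Adj a b := by
  simp only [stab, Finset.mem_filter, Finset.mem_univ, true_and, isIndepSet_iff, Set.Pairwise,
    Finset.mem_coe]
  refine ⟨fun h a ha b hb hab => h ha hb hab.ne hab, fun h a ha b hb _ => h a ha b hb⟩

/-- The number of stable sets containing `A`. -/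
noncomputable def cnt (G : SimpleGraph V) (A : Finset V) : ℝ :=
  ((G.stab.filter (A ⊆ ·)).card : ℝ)

lemma fibonacciNumber_eq_card_stab : G.fibonacciNumber = G.stab.card := by
  rw [fibonacciNumber, ← Set.ncard_coe_finset]
  congr 1
  ext s
  simp [stab]

lemma cnt_empty : G.cnt ∅ = G.fibonacciNumber := by
  simp [cnt, fibonacciNumber_eq_card_stab]

lemma cnt_empty_pos : 0 < G.cnt ∅ := by
  rw [cnt, Nat.cast_pos, Finset.card_pos]
  exact ⟨∅, by simp [mem_stab]⟩

lemma cnt_singleton_pos (v : V) : 0 < G.cnt {v} := by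
  rw [cnt, Nat.cast_pos, Finset.card_pos]
  exact ⟨{v}, by simp [mem_stab]⟩

lemma cnt_anti {A B : Finset V} (h : A ⊆ B) : G.cnt B ≤ G.cnt A := by
  rw [cnt, cnt, Nat.cast_le]
  exact Finset.card_le_card fun s hs => by
    rw [Finset.mem_filter] at hs ⊢
    exact ⟨hs.1, h.trans hs.2⟩

/-- The stable sets destroyed by a new edge are exactly those containing both of its ends. -/
lemma cnt_link {x y : V} (hxy : x ≠ y) (A : Finset V) :
    (G.link x y).cnt A = G.cnt A - G.cnt (insert x (insert y A)) := by
  have h : (G.stab.filter (A ⊆ ·)) = ((G.link x y).stab.filter (A ⊆ ·)) ∪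
      (G.stab.filter (insert x (insert y A) ⊆ ·)) := by
    ext s
    simp only [Finset.mem_union, Finset.mem_filter, mem_stab, link_adj hxy, Finset.insert_subset_iff]
    constructor
    · rintro ⟨h1, h2⟩
      by_cases h : x ∈ s ∧ y ∈ s
      · exact Or.inr ⟨h1, h.1, h.2, h2⟩
      · refine Or.inl ⟨fun a ha b hb => ?_, h2⟩
        rintro (h' | ⟨rfl, rfl⟩ | ⟨rfl, rfl⟩)
        exacts [h1 a ha b hb h', h ⟨ha, hb⟩, h ⟨hb, ha⟩]
    · rintro (⟨h1, h2⟩ | ⟨h1, h2⟩)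
      · exact ⟨fun a ha b hb hab => h1 a ha b hb (Or.inl hab), h2⟩
      · exact ⟨h1, h2.2.2⟩
  have hd : Disjoint ((G.link x y).stab.filter (A ⊆ ·))
      (G.stab.filter (insert x (insert y A) ⊆ ·)) := by
    rw [Finset.disjoint_left]
    intro s hs hs'
    simp only [Finset.mem_filter, mem_stab, link_adj hxy, Finset.insert_subset_iff] at hs hs'
    exact hs.1 x hs'.2.1 y hs'.2.2.1 (by tauto)
  rw [cnt, cnt, cnt, h, Finset.card_union_of_disjoint hd]
  push_cast
  ring

lemma exchange_mem_stab {S : Set V} (hG : ∀ a ∈ S, ∀ b, G.Adj a b → b ∈ S)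
    (hGH : ∀ a ∈ S, ∀ b ∈ S, G.Adj a b → H.Adj a b) {s t : Finset V} (hs : s ∈ G.stab)
    (ht : t ∈ H.stab) :
    t.filter (· ∈ S) ∪ s.filter (· ∉ S) ∈ G.stab := by
  rw [mem_stab] at *
  intro a ha b hb hab
  simp only [Finset.mem_union, Finset.mem_filter] at ha hb
  rcases ha with ha | ha <;> rcases hb with hb | hb
  · exact ht a ha.1 b hb.1 (hGH a ha.2 b hb.2 hab)
  · exact hb.2 (hG a ha.2 b hab)
  · exact ha.2 (hG b hb.2 a hab.symm)
  · exact hs a ha.1 b hb.1 hab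

/-- Two graphs that agree on a union of components can exchange the traces of their stable sets on
this union. -/
lemma cnt_exchange {S : Set V} (hG : ∀ a ∈ S, ∀ b, G.Adj a b → b ∈ S)
    (hH : ∀ a ∈ S, ∀ b, H.Adj a b → b ∈ S) (hGH : ∀ a ∈ S, ∀ b, G.Adj a b ↔ H.Adj a b)
    {A A' B B' : Finset V} (hA : ∀ a ∈ A, a ∈ S) (hA' : ∀ a ∈ A', a ∈ S) (hB : ∀ b ∈ B, b ∉ S)
    (hB' : ∀ b ∈ B', b ∉ S) :
    G.cnt (A ∪ B) * H.cnt (A' ∪ B') = G.cnt (A' ∪ B) * H.cnt (A ∪ B') := by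
  have key : ∀ {G H : SimpleGraph V} {A A' B B' : Finset V} (_ : ∀ a ∈ S, ∀ b, G.Adj a b → b ∈ S)
      (_ : ∀ a ∈ S, ∀ b, H.Adj a b → b ∈ S) (_ : ∀ a ∈ S, ∀ b, G.Adj a b ↔ H.Adj a b)
      (_ : ∀ a ∈ A, a ∈ S) (_ : ∀ a ∈ A', a ∈ S) (_ : ∀ b ∈ B, b ∉ S) (_ : ∀ b ∈ B', b ∉ S),
      ∀ p ∈ (G.stab.filter (A ∪ B ⊆ ·)) ×ˢ (H.stab.filter (A' ∪ B' ⊆ ·)),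
        (p.2.filter (· ∈ S) ∪ p.1.filter (· ∉ S), p.1.filter (· ∈ S) ∪ p.2.filter (· ∉ S)) ∈
          (G.stab.filter (A' ∪ B ⊆ ·)) ×ˢ (H.stab.filter (A ∪ B' ⊆ ·)) := by
    intro G H A A' B B' hG hH hGH hA hA' hB hB' p hp
    simp only [Finset.mem_product, Finset.mem_filter] at hp ⊢
    obtain ⟨⟨h1, h2⟩, h3, h4⟩ := hp
    refine ⟨⟨exchange_mem_stab hG (fun a ha b _ => (hGH a ha b).1) h1 h3, ?_⟩,
      exchange_mem_stab hH (fun a ha b _ => (hGH a ha b).2) h3 h1, ?_⟩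
    · intro a ha
      simp only [Finset.mem_union, Finset.mem_filter] at ha ⊢
      rcases ha with ha | ha
      · exact Or.inl ⟨h4 (Finset.mem_union_left _ ha), hA' a ha⟩
      · exact Or.inr ⟨h2 (Finset.mem_union_right _ ha), hB a ha⟩
    · intro a ha
      simp only [Finset.mem_union, Finset.mem_filter] at ha ⊢
      rcases ha with ha | ha
      · exact Or.inl ⟨h2 (Finset.mem_union_left _ ha), hA a ha⟩
      · exact Or.inr ⟨h4 (Finset.mem_union_right _ ha), hB' a ha⟩
  have inv : ∀ s t : Finset V, (s.filter (· ∈ S) ∪ t.filter (· ∉ S)).filter (· ∈ S) ∪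
      (t.filter (· ∈ S) ∪ s.filter (· ∉ S)).filter (· ∉ S) = s := by
    intro s t
    ext a
    simp only [Finset.mem_union, Finset.mem_filter]
    tauto
  simp only [cnt, ← Nat.cast_mul, ← Finset.card_product]
  congr 1
  refine Finset.card_bij' (fun p _ => (p.2.filter (· ∈ S) ∪ p.1.filter (· ∉ S),
      p.1.filter (· ∈ S) ∪ p.2.filter (· ∉ S)))
    (fun p _ => (p.2.filter (· ∈ S) ∪ p.1.filter (· ∉ S),
      p.1.filter (· ∈ S) ∪ p.2.filter (· ∉ S))) (key hG hH hGH hA hA' hB hB')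
    (key hG hH hGH hA' hA hB hB') ?_ ?_
  · intro p _
    exact Prod.ext (inv _ _) (inv _ _)
  · intro p _
    exact Prod.ext (inv _ _) (inv _ _)

/-- The probability that a uniformly random stable set contains `A`. -/
noncomputable def pr (G : SimpleGraph V) (A : Finset V) : ℝ := G.cnt A / G.cnt ∅

lemma pr_anti {A B : Finset V} (h : A ⊆ B) : G.pr B ≤ G.pr A :=
  div_le_div_of_nonneg_right (cnt_anti h) cnt_empty_pos.le

lemma pr_singleton_pos (v : V) : 0 < G.pr {v} := div_pos (cnt_singleton_pos v) cnt_empty_pos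

lemma cnt_eq_pr_mul (A : Finset V) : G.cnt A = G.pr A * G.cnt ∅ := by
  rw [pr, div_mul_cancel₀ _ cnt_empty_pos.ne']

/-- Independence of different components: exchange traces on the union of the components meeting `A`
between two copies of the same graph. -/
lemma pr_union {A B : Finset V} (h : ∀ a ∈ A, ∀ b ∈ B, ¬ G.Reachable a b) :
    G.pr (A ∪ B) = G.pr A * G.pr B := by
  have key := cnt_exchange (G := G) (H := G) (S := {x | ∃ a ∈ A, G.Reachable a x})
    (A := A) (A' := ∅) (B := B) (B' := ∅)
    (by rintro a ⟨c, hc, hca⟩ b hab; exact ⟨c, hc, hca.trans hab.reachable⟩)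
    (by rintro a ⟨c, hc, hca⟩ b hab; exact ⟨c, hc, hca.trans hab.reachable⟩)
    (fun a _ b => Iff.rfl) (fun a ha => ⟨a, ha, Reachable.refl _⟩) (by simp)
    (by rintro b hb ⟨a, ha, hab⟩; exact h a ha b hb hab) (by simp)
  have h0 := (cnt_empty_pos (G := G)).ne'
  simp only [Finset.empty_union, Finset.union_empty] at key
  rw [pr, pr, pr]
  field_simp
  linarith

lemma pr_insert {x : V} {B : Finset V} (h : ∀ b ∈ B, ¬ G.Reachable x b) :
    G.pr (insert x B) = G.pr {x} * G.pr B := by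
  rw [Finset.insert_eq]
  exact pr_union (by simpa using h)

lemma pr_congr {A : Finset V} {S : Set V} (hA : ∀ a ∈ A, a ∈ S)
    (hS : ∀ a ∈ S, ∀ b, G.Adj a b → b ∈ S) (hGH : ∀ a ∈ S, ∀ b, G.Adj a b ↔ H.Adj a b) :
    G.pr A = H.pr A := by
  have key := cnt_exchange (G := G) (H := H) (S := S) (A := A) (A' := ∅) (B := ∅) (B' := ∅) hS
    (fun a ha b hab => hS a ha b ((hGH a ha b).2 hab)) hGH hA (by simp) (by simp) (by simp)
  have h0 := (cnt_empty_pos (G := G)).ne'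
  have h1 := (cnt_empty_pos (G := H)).ne'
  simp only [Finset.union_empty] at key
  rw [pr, pr]
  field_simp
  linarith

lemma cnt_out (v : V) :
    G.cnt ∅ - G.cnt {v} = ((G.stab.filter (v ∉ ·)).card : ℝ) := by
  have := Finset.card_filter_add_card_filter_not (s := G.stab) (p := fun s => v ∈ s)
  have h' : ((G.stab.filter (v ∈ ·)).card : ℝ) + (G.stab.filter (v ∉ ·)).card = G.stab.card := by
    exact_mod_cast this
  simp only [cnt, Finset.empty_subset, Finset.filter_true, Finset.singleton_subset_iff]
  linarith

lemma erase_mem_stab {s : Finset V} (hs : s ∈ G.stab) (v : V) : s.erase v ∈ G.stab := by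
  rw [mem_stab] at *
  intro a ha b hb
  exact hs a (Finset.mem_of_mem_erase ha) b (Finset.mem_of_mem_erase hb)

lemma cnt_singleton_le (v : V) : G.cnt {v} ≤ G.cnt ∅ - G.cnt {v} := by
  rw [cnt_out, cnt, Nat.cast_le]
  refine Finset.card_le_card_of_injOn (fun s => s.erase v) ?_ ?_
  · intro s hs
    simp only [Finset.coe_filter, Set.mem_ofPred_eq] at hs ⊢
    exact ⟨erase_mem_stab hs.1 v, by simp⟩
  · intro s hs t ht hst
    simp only [Finset.coe_filter, Set.mem_ofPred_eq, Finset.singleton_subset_iff] at hs ht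
    rw [← Finset.insert_erase hs.2, ← Finset.insert_erase ht.2]
    exact congrArg (insert v) hst

/-- Erasing `v` injects the stable sets containing `v` into those avoiding it. A neighbour `w` makes
this strict, since `{w}` is never reached. -/
lemma cnt_singleton_lt {v w : V} (h : G.Adj v w) : G.cnt {v} < G.cnt ∅ - G.cnt {v} := by
  have hw : ({w} : Finset V) ∈ G.stab.filter (v ∉ ·) := by simp [mem_stab, h.ne]
  rw [cnt_out, cnt, Nat.cast_lt]
  refine lt_of_le_of_lt ?_ (Finset.card_erase_lt_of_mem hw)
  refine Finset.card_le_card_of_injOn (fun s => s.erase v) ?_ ?_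
  · intro s hs
    simp only [Finset.coe_filter, Set.mem_ofPred_eq, Finset.singleton_subset_iff] at hs
    simp only [Finset.coe_erase, Finset.coe_filter, Set.mem_sdiff, Set.mem_ofPred_eq,
      Set.mem_singleton_iff]
    refine ⟨⟨erase_mem_stab hs.1 v, by simp⟩, fun hsw => ?_⟩
    have : w ∈ s.erase v := by rw [hsw]; simp
    exact mem_stab.1 hs.1 v hs.2 w (Finset.mem_of_mem_erase this) h
  · intro s hs t ht hst
    simp only [Finset.coe_filter, Set.mem_ofPred_eq, Finset.singleton_subset_iff] at hs ht
    rw [← Finset.insert_erase hs.2, ← Finset.insert_erase ht.2]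
    exact congrArg (insert v) hst

lemma cnt_singleton_of_isolated {v : V} (h : ∀ w, ¬ G.Adj v w) :
    G.cnt {v} = G.cnt ∅ - G.cnt {v} := by
  refine le_antisymm (cnt_singleton_le v) ?_
  rw [cnt_out, cnt, Nat.cast_le]
  refine Finset.card_le_card_of_injOn (fun s => insert v s) ?_ ?_
  · intro s hs
    simp only [Finset.coe_filter, Set.mem_ofPred_eq, mem_stab] at hs ⊢
    refine ⟨fun a ha b hb hab => ?_, by simp⟩
    rw [Finset.mem_insert] at ha hb
    rcases ha with rfl | ha
    · exact h _ hab
    rcases hb with rfl | hb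
    · exact h _ hab.symm
    exact hs.1 a ha b hb hab
  · intro s hs t ht hst
    simp only [Finset.coe_filter, Set.mem_ofPred_eq] at hs ht
    rw [← Finset.erase_insert hs.2, ← Finset.erase_insert ht.2]
    exact congrArg (Finset.erase · v) hst

/-- The ratio of the probabilities that `v` is in, or not in, a random stable set. -/
noncomputable def ratio (G : SimpleGraph V) (v : V) : ℝ := G.pr {v} / (1 - G.pr {v})

lemma pr_singleton_le_half (v : V) : G.pr {v} ≤ 1 / 2 := by
  rw [pr, div_le_iff₀ cnt_empty_pos]
  linarith [cnt_singleton_le (G := G) v]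

lemma pr_singleton_lt_half {v w : V} (h : G.Adj v w) : G.pr {v} < 1 / 2 := by
  rw [pr, div_lt_iff₀ cnt_empty_pos]
  linarith [cnt_singleton_lt h]

lemma pr_singleton_of_isolated {v : V} (h : ∀ w, ¬ G.Adj v w) : G.pr {v} = 1 / 2 := by
  rw [pr, div_eq_iff cnt_empty_pos.ne']
  linarith [cnt_singleton_of_isolated h]

lemma ratio_pos (v : V) : 0 < G.ratio v :=
  div_pos (pr_singleton_pos v) (by linarith [pr_singleton_le_half (G := G) v])

lemma ratio_le_one (v : V) : G.ratio v ≤ 1 := by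
  have := pr_singleton_le_half (G := G) v
  rw [ratio, div_le_one (by linarith)]
  linarith

lemma ratio_lt_one {v w : V} (h : G.Adj v w) : G.ratio v < 1 := by
  have := pr_singleton_lt_half h
  rw [ratio, div_lt_one (by linarith)]
  linarith

lemma ratio_of_isolated {v : V} (h : ∀ w, ¬ G.Adj v w) : G.ratio v = 1 := by
  rw [ratio, pr_singleton_of_isolated h]; norm_num

lemma one_sub_pr (v : V) : 1 - G.pr {v} = 1 / (1 + G.ratio v) := by
  have := pr_singleton_le_half (G := G) v
  rw [ratio]
  have : 1 - G.pr {v} ≠ 0 := by linarith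
  field_simp
  ring

lemma ratio_le_ratio_iff {u v : V} : G.ratio u ≤ G.ratio v ↔ G.pr {u} ≤ G.pr {v} := by
  have h1 := pr_singleton_le_half (G := G) u
  have h2 := pr_singleton_le_half (G := G) v
  rw [ratio, ratio, div_le_div_iff₀ (by linarith) (by linarith)]
  constructor <;> intro h <;> nlinarith

lemma ratio_congr {v : V} {S : Set V} (hv : v ∈ S)
    (hS : ∀ a ∈ S, ∀ b, G.Adj a b → b ∈ S) (hGH : ∀ a ∈ S, ∀ b, G.Adj a b ↔ H.Adj a b) :
    G.ratio v = H.ratio v := by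
  rw [ratio, ratio, pr_congr (by simpa using hv) hS hGH]

/-- After complementing on the class where `c` fails, stability becomes a system of implications
from one class to the other. Such families are closed under union and intersection, so the FKG
inequality applies to the increasing events of containing `x` and of containing `y`. -/
lemma pr_mul_le_aux {c : V → Prop} (hc : ∀ a b, G.Adj a b → (c a ↔ ¬ c b)) {x y : V}
    (hx : c x) (hy : c y) : G.pr {x} * G.pr {y} ≤ G.pr {x, y} := by
  set N : Finset V := Finset.univ.filter (fun v => ¬ c v) with hN
  have hP : ∀ A : Finset V, symmDiff A N ∈ G.stab ↔ ∀ a b, G.Adj a b → c a → a ∈ A → b ∈ A := by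
    intro A
    simp only [mem_stab, Finset.mem_symmDiff, hN, Finset.mem_filter, Finset.mem_univ, true_and]
    constructor
    · intro h a b hab ha haA
      by_contra hb
      exact h a (by tauto) b (Or.inr ⟨(hc b a hab.symm).not.2 (by tauto), hb⟩) hab
    · intro h a ha b hb hab
      have h1 := h a b hab
      have h2 := h b a hab.symm
      have h3 := hc a b hab
      tauto
  -- Symmetric difference with `N` is a bijection; it turns the weighted sums of the FKG inequality
  -- back into counts of stable sets.
  have hsum : ∀ (p : Finset V → Prop) [DecidablePred p] (A : Finset V), (∀ s, p s ↔ A ⊆ symmDiff s N) →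
      ∑ s, (if symmDiff s N ∈ G.stab then (1 : ℝ) else 0) * (if p s then 1 else 0) = G.cnt A := by
    intro p _ A hp
    have h1 : G.cnt A = ∑ s, if s ∈ G.stab ∧ A ⊆ s then (1 : ℝ) else 0 := by
      rw [cnt, Finset.sum_boole]
      congr 2
      ext s
      simp
    rw [h1, ← Equiv.sum_comp (Function.Involutive.toPerm (fun s => symmDiff s N)
      (fun s => by simp))]
    refine Finset.sum_congr rfl fun s _ => ?_
    change (if symmDiff (symmDiff s N) N ∈ G.stab then (1 : ℝ) else 0) *
      (if p (symmDiff s N) then 1 else 0) = _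
    simp only [hp, symmDiff_symmDiff_cancel_right, ite_and, ite_mul, one_mul, zero_mul]
  have hmem : ∀ z, c z → ∀ s : Finset V, z ∈ s ↔ z ∈ symmDiff s N := by
    intro z hz s
    simp [Finset.mem_symmDiff, hN, hz]
  have key := fkg (α := Finset V) (β := ℝ)
    (μ := fun s => if symmDiff s N ∈ G.stab then 1 else 0)
    (f := fun s => if x ∈ s then 1 else 0) (g := fun s => if y ∈ s then 1 else 0)
    (fun s => by dsimp; split_ifs <;> norm_num) (fun s => by dsimp; split_ifs <;> norm_num)
    (fun s => by dsimp; split_ifs <;> norm_num)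
    (fun s t hst => by
      dsimp; split_ifs with h1 h2 <;> norm_num
      exact h2 (hst h1))
    (fun s t hst => by
      dsimp; split_ifs with h1 h2 <;> norm_num
      exact h2 (hst h1))
    (fun A B => by
      simp only [hP]
      by_cases hA : ∀ a b, G.Adj a b → c a → a ∈ A → b ∈ A
      · by_cases hB : ∀ a b, G.Adj a b → c a → a ∈ B → b ∈ B
        · have h1 : ∀ a b, G.Adj a b → c a → a ∈ A ⊓ B → b ∈ A ⊓ B := by
            intro a b hab ha h
            simp only [Finset.inf_eq_inter, Finset.mem_inter] at h ⊢
            exact ⟨hA a b hab ha h.1, hB a b hab ha h.2⟩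
          have h2 : ∀ a b, G.Adj a b → c a → a ∈ A ⊔ B → b ∈ A ⊔ B := by
            intro a b hab ha h
            simp only [Finset.sup_eq_union, Finset.mem_union] at h ⊢
            exact h.imp (hA a b hab ha) (hB a b hab ha)
          rw [if_pos hA, if_pos hB, if_pos h1, if_pos h2]
        · rw [if_neg hB]
          simp only [mul_zero]
          split_ifs <;> norm_num
      · rw [if_neg hA]
        simp only [zero_mul]
        split_ifs <;> norm_num)
  have h3 : ∀ s : Finset V, (if x ∈ s then (1 : ℝ) else 0) * (if y ∈ s then 1 else 0) =
      if x ∈ s ∧ y ∈ s then 1 else 0 := by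
    intro s
    by_cases h1 : x ∈ s <;> by_cases h2 : y ∈ s <;> simp [h1, h2]
  have h4 := hsum (fun _ => True) ∅ (fun _ => ⟨fun _ => Finset.empty_subset _, fun _ => trivial⟩)
  simp only [if_true, mul_one] at h4
  simp only [h3] at key
  rw [hsum (fun s => x ∈ s) {x} (fun s => by simp [← hmem x hx]),
    hsum (fun s => y ∈ s) {y} (fun s => by simp [← hmem y hy]), h4,
    hsum (fun s => x ∈ s ∧ y ∈ s) {x, y}
      (fun s => by simp [Finset.insert_subset_iff, ← hmem x hx, ← hmem y hy])] at key
  have h0 := cnt_empty_pos (G := G)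
  rw [pr, pr, pr, div_mul_div_comm, div_le_div_iff₀ (by positivity) h0]
  nlinarith

/-- Two vertices in the same colour class of a bipartite graph are positively correlated. -/
lemma pr_mul_le {c : V → Prop} (hc : ∀ a b, G.Adj a b → (c a ↔ ¬ c b)) {x y : V}
    (hxy : c x ↔ c y) : G.pr {x} * G.pr {y} ≤ G.pr {x, y} := by
  by_cases hx : c x
  · exact pr_mul_le_aux hc hx (hxy.1 hx)
  · exact pr_mul_le_aux (c := fun v => ¬ c v) (fun a b hab => by have := hc a b hab; tauto) hx
      (hxy.not.1 hx)

end StableSets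

/-! ### The message recursion for odds in a forest. -/

section Messages

variable {V : Type*} [Fintype V] {G H : SimpleGraph V}

/-- The finset of neighbours of `v`. -/
noncomputable def nb (G : SimpleGraph V) (v : V) : Finset V := {w | G.Adj v w}

@[simp] lemma mem_nb {v w : V} : w ∈ G.nb v ↔ G.Adj v w := by simp [nb]

lemma card_nb (v : V) : (G.nb v).card = (G.neighborSet v).ncard := by
  rw [← Set.ncard_coe_finset]
  congr 1
  ext w
  simp

lemma nb_cut (u v : V) : (G.cut u v).nb u = (G.nb u).erase v := by
  ext w
  simp only [mem_nb, cut_adj, Finset.mem_erase]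
  constructor
  · rintro ⟨h, h1, -⟩
    exact ⟨fun h2 => h1 (by simpa using h2), h⟩
  · rintro ⟨h1, h⟩
    exact ⟨h, fun h2 => h1 h2.2, fun h2 => h.ne h2.2.symm⟩

/-- The ratio at `u` in the component of `u` after removal of the edge `uv`. -/
noncomputable def msg (G : SimpleGraph V) (u v : V) : ℝ := (G.cut u v).ratio u

lemma msg_pos (u v : V) : 0 < G.msg u v := ratio_pos _

lemma msg_le_one (u v : V) : G.msg u v ≤ 1 := ratio_le_one _

lemma msg_lt_one {u v w : V} (h : G.Adj u w) (hw : w ≠ v) : G.msg u v < 1 := by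
  refine ratio_lt_one (w := w) ?_
  rw [← mem_nb, nb_cut]
  simp [h, hw]

lemma msg_of_not_adj {u v : V} (h : ¬ G.Adj u v) : G.msg u v = G.ratio u := by
  rw [msg, cut_of_not_adj h]

lemma ratio_eq (v : V) : G.ratio v = G.cnt {v} / (G.cnt ∅ - G.cnt {v}) := by
  have h0 := cnt_empty_pos (G := G)
  have h1 := cnt_singleton_le (G := G) v
  have h2 := cnt_singleton_pos (G := G) v
  have h3 : G.cnt ∅ - G.cnt {v} ≠ 0 := by linarith
  have h4 : 1 - G.cnt {v} / G.cnt ∅ ≠ 0 := by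
    rw [one_sub_div h0.ne']
    exact div_ne_zero h3 h0.ne'
  rw [ratio, pr]
  field_simp

/-- Restoring the edge `vk` does not affect stable sets avoiding `v`, and keeps those containing `v`
only if they avoid `k`. Before the edge is restored this is an independent event, of probability
1/(1 + `msg k v`). -/
lemma ratio_eq_ratio_cut_mul (hG : G.IsAcyclic) {v k : V} (h : G.Adj v k) :
    G.ratio v = (G.cut v k).ratio v * (1 / (1 + G.msg k v)) := by
  have hr : ¬ (G.cut v k).Reachable v k := isAcyclic_iff_forall_adj_isBridge.1 hG h
  have e1 := cnt_link (G := G.cut v k) h.ne ∅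
  have e2 := cnt_link (G := G.cut v k) h.ne {v}
  rw [link_cut h] at e1 e2
  have e3 : (insert v (insert k ∅) : Finset V) = {v, k} := by ext; simp
  have e4 : (insert v (insert k {v}) : Finset V) = {v, k} := by
    ext a; simp only [Finset.mem_insert, Finset.mem_singleton]; tauto
  rw [e3] at e1
  rw [e4] at e2
  have e5 : (G.cut v k).pr {v, k} = (G.cut v k).pr {v} * (G.cut v k).pr {k} :=
    pr_insert (by simpa using hr)
  have h0 := cnt_empty_pos (G := G.cut v k)
  have hv := pr_singleton_le_half (G := G.cut v k) v
  have hk := one_sub_pr (G := G.cut v k) k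
  rw [ratio_eq, e1, e2, msg, cut_comm k v, ← hk, ratio, cnt_eq_pr_mul {v, k}, cnt_eq_pr_mul {v}, e5]
  have h1 : 1 - (G.cut v k).pr {v} ≠ 0 := by linarith
  have h2 : (G.cut v k).cnt ∅ - (G.cut v k).pr {v} * (G.cut v k).pr {k} * (G.cut v k).cnt ∅ -
    ((G.cut v k).pr {v} * (G.cut v k).cnt ∅ -
      (G.cut v k).pr {v} * (G.cut v k).pr {k} * (G.cut v k).cnt ∅) =
      (1 - (G.cut v k).pr {v}) * (G.cut v k).cnt ∅ := by ring
  rw [h2]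
  field_simp

lemma msg_congr {k v : V} (h : ∀ x ∈ G.branch k v, ∀ y, (G.cut k v).Adj x y ↔ (H.cut k v).Adj x y) :
    G.msg k v = H.msg k v :=
  ratio_congr (S := G.branch k v) (self_mem_branch _ _)
    (fun _ ha _ hab => Reachable.trans ha hab.reachable) h

lemma msg_congr' {k v : V} (h : ∀ x ∈ G.branch k v, ∀ y, G.Adj x y ↔ H.Adj x y) :
    G.msg k v = H.msg k v :=
  msg_congr fun x hx y => by rw [cut_adj, cut_adj, h x hx y]

lemma msg_cut (hG : G.IsAcyclic) {u k k' : V} (hk' : G.Adj k' u) (hkk' : k' ≠ k) :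
    (G.cut u k).msg k' u = G.msg k' u := by
  refine (msg_congr' fun x hx y => ?_).symm
  rw [cut_adj]
  refine ⟨fun hxy => ⟨hxy, ?_, ?_⟩, fun h => h.1⟩
  · rintro ⟨rfl, -⟩
    exact not_mem_branch hG hk' hx
  · rintro ⟨rfl, rfl⟩
    exact not_mem_branch hG hk' (branch_step hx hxy (fun h => hkk' h.1.symm))

/-- The ratio at `u` as a product over the neighbours of `u`. -/
theorem ratio_eq_prod (hG : G.IsAcyclic) (u : V) :
    G.ratio u = ∏ k ∈ G.nb u, 1 / (1 + G.msg k u) := by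
  suffices H : ∀ n, ∀ G : SimpleGraph V, G.IsAcyclic → (G.nb u).card = n →
      G.ratio u = ∏ k ∈ G.nb u, 1 / (1 + G.msg k u) from H _ G hG rfl
  intro n
  induction n with
  | zero =>
    intro G hG hn
    rw [Finset.card_eq_zero] at hn
    rw [hn, Finset.prod_empty]
    refine ratio_of_isolated fun w hw => ?_
    have := mem_nb.2 hw
    rw [hn] at this
    simp at this
  | succ n ih =>
    intro G hG hn
    obtain ⟨k, hk⟩ : (G.nb u).Nonempty := by rw [← Finset.card_pos]; omega
    have hk' := mem_nb.1 hk
    rw [ratio_eq_ratio_cut_mul hG hk', ih (G.cut u k) (hG.cut u k) ?_, nb_cut, mul_comm,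
      ← Finset.mul_prod_erase _ _ hk]
    · congr 1
      refine Finset.prod_congr rfl fun k' hk' => ?_
      rw [Finset.mem_erase, mem_nb] at hk'
      rw [msg_cut hG hk'.2.symm hk'.1]
    · rw [nb_cut, Finset.card_erase_of_mem hk]; omega

/-- The recursion satisfied by the messages. -/
theorem msg_eq_prod (hG : G.IsAcyclic) (u v : V) :
    G.msg u v = ∏ k ∈ (G.nb u).erase v, 1 / (1 + G.msg k u) := by
  rw [msg, ratio_eq_prod (hG.cut u v), nb_cut]
  refine Finset.prod_congr rfl fun k hk => ?_
  rw [Finset.mem_erase, mem_nb] at hk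
  rw [msg_cut hG hk.2.symm hk.1]

lemma msg_of_leaf (hG : G.IsAcyclic) {u v : V} (h : ∀ w, G.Adj u w → w = v) : G.msg u v = 1 := by
  rw [msg_eq_prod hG, Finset.prod_eq_one]
  intro k hk
  rw [Finset.mem_erase, mem_nb] at hk
  exact (hk.1 (h k hk.2)).elim

lemma msg_of_unique (hG : G.IsAcyclic) {u v w : V} (hw : G.Adj u w) (hwv : w ≠ v)
    (h : ∀ k, G.Adj u k → k = v ∨ k = w) : G.msg u v = 1 / (1 + G.msg w u) := by
  rw [msg_eq_prod hG]
  have : (G.nb u).erase v = {w} := by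
    ext k
    rw [Finset.mem_erase, mem_nb, Finset.mem_singleton]
    exact ⟨fun hk => (h k hk.2).resolve_left hk.1, by rintro rfl; exact ⟨hwv, hw⟩⟩
  rw [this, Finset.prod_singleton]

lemma factor_pos (k u : V) : 0 < 1 / (1 + G.msg k u) := by
  have := msg_pos (G := G) k u
  positivity

lemma half_le_factor (k u : V) : 1 / 2 ≤ 1 / (1 + G.msg k u) :=
  one_div_le_one_div_of_le (by linarith [msg_pos (G := G) k u])
    (by linarith [msg_le_one (G := G) k u])

lemma half_lt_factor {k u w : V} (h : G.Adj k w) (hw : w ≠ u) : 1 / 2 < 1 / (1 + G.msg k u) :=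
  one_div_lt_one_div_of_lt (by linarith [msg_pos (G := G) k u]) (by linarith [msg_lt_one h hw])

lemma factor_lt_one (k u : V) : 1 / (1 + G.msg k u) < 1 := by
  have := msg_pos (G := G) k u
  rw [div_lt_one (by linarith)]
  linarith

/-- A message is at most each of its factors. -/
lemma msg_le_factor (hG : G.IsAcyclic) {u v k : V} (hk : G.Adj u k) (hkv : k ≠ v) :
    G.msg u v ≤ 1 / (1 + G.msg k u) := by
  rw [msg_eq_prod hG, ← Finset.mul_prod_erase _ _ (Finset.mem_erase.2 ⟨hkv, mem_nb.2 hk⟩)]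
  exact mul_le_of_le_one_right (factor_pos _ _).le
    (Finset.prod_le_one (fun _ _ => (factor_pos _ _).le) (fun _ _ => (factor_lt_one _ _).le))

end Messages

/-! ### Vertex covers under the exchange of an edge. -/

section Covers

variable {V : Type*} {T : SimpleGraph V}

/-- `C` is a vertex cover of `G`. -/
def Cover (G : SimpleGraph V) (C : Finset V) : Prop := ∀ a b, G.Adj a b → a ∈ C ∨ b ∈ C

lemma Cover.swap {C : Finset V} (hC : T.Cover C) {u v z y : V} (h : z ∈ C ∨ y ∈ C) (hzy : z ≠ y) :
    ((T.cut u v).link z y).Cover C := by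
  intro a b hab
  rcases (link_adj hzy).1 hab with h' | ⟨rfl, rfl⟩ | ⟨rfl, rfl⟩
  · exact hC a b (cut_adj.1 h').1
  · exact h
  · exact h.symm

lemma Cover.mono {C D : Finset V} (hC : T.Cover C) (h : C ⊆ D) : T.Cover D :=
  fun a b hab => (hC a b hab).imp (@h a) (@h b)

lemma ne_of_mem_branches (hT : T.IsAcyclic) {u v z y : V} (huv : T.Adj u v)
    (hz : z ∈ T.branch u v) (hy : y ∈ T.branch v u) : z ≠ y := by
  rintro rfl
  exact Set.disjoint_left.1 (branch_disjoint_symm hT huv) hz hy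

end Covers

/-! ### Minimizers and the basic exchange inequality. -/

section Minimizers

variable {V : Type*} [Fintype V] {T : SimpleGraph V}

/-- `T` has the smallest number of stable sets among the trees with a vertex cover of size at
most `c`. -/
structure IsMinimizer (T : SimpleGraph V) (c : ℕ) : Prop where
  isTree : T.IsTree
  cover : ∃ C, T.Cover C ∧ C.card ≤ c
  le : ∀ T' : SimpleGraph V, T'.IsTree → (∃ C, T'.Cover C ∧ C.card ≤ c) → T.cnt ∅ ≤ T'.cnt ∅

/-- By independence of the two components, the tree obtained by joining them through `z` and `y` has
1 - P(z)P(y) times as many stable sets as the forest. Minimality compares this with the original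
edge. -/
lemma IsMinimizer.pr_mul_le {c : ℕ} (hT : T.IsMinimizer c) {u v z y : V} (huv : T.Adj u v)
    (hz : z ∈ T.branch u v) (hy : y ∈ T.branch v u)
    (hC : ∃ C, ((T.cut u v).link z y).Cover C ∧ C.card ≤ c) :
    (T.cut u v).pr {z} * (T.cut u v).pr {y} ≤ (T.cut u v).pr {u} * (T.cut u v).pr {v} := by
  have hne := ne_of_mem_branches hT.isTree.isAcyclic huv hz hy
  have h1 := hT.le _ (hT.isTree.swap huv hz hy) hC
  have e1 := cnt_link (G := T.cut u v) huv.ne ∅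
  rw [link_cut huv] at e1
  have e2 := cnt_link (G := T.cut u v) hne ∅
  simp only [insert_empty_eq] at e1 e2
  rw [e1, e2, cnt_eq_pr_mul {u, v}, cnt_eq_pr_mul {z, y}] at h1
  have huv' : ¬ (T.cut u v).Reachable u v :=
    isAcyclic_iff_forall_adj_isBridge.1 hT.isTree.isAcyclic huv
  have hzy : ¬ (T.cut u v).Reachable z y := by
    intro h
    have h3 : y ∈ T.branch u v := Reachable.trans hz h
    exact ne_of_mem_branches hT.isTree.isAcyclic huv h3 hy rfl
  rw [pr_insert (x := u) (by simpa using huv'), pr_insert (x := z) (by simpa using hzy)] at h1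
  have h0 := cnt_empty_pos (G := T.cut u v)
  nlinarith

/-- In a minimizer, an edge `uv` whose removal allows to reconnect `v` to `z` makes `u` at least
as probable as `z`. -/
lemma IsMinimizer.ratio_le {c : ℕ} (hT : T.IsMinimizer c) {u v z : V} (huv : T.Adj u v)
    (hz : z ∈ T.branch u v) (hC : ∃ C, ((T.cut u v).link z v).Cover C ∧ C.card ≤ c) :
    (T.cut u v).ratio z ≤ (T.cut u v).ratio u := by
  rw [ratio_le_ratio_iff]
  exact le_of_mul_le_mul_right (hT.pr_mul_le huv hz (self_mem_branch _ _) hC) (pr_singleton_pos v)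

end Minimizers

/-! ### Commuting edge operations; branches without an edge inside the cover. -/

section Commute

variable {V : Type*} {G : SimpleGraph V}

lemma cut_cut_comm (a b u v : V) : (G.cut a b).cut u v = (G.cut u v).cut a b := by
  ext x y
  simp only [cut_adj]
  tauto

lemma link_cut_comm {x y u v : V} (hxy : x ≠ y) (h1 : ¬(x = u ∧ y = v)) (h2 : ¬(x = v ∧ y = u)) :
    (G.link x y).cut u v = (G.cut u v).link x y := by
  ext a b
  simp only [cut_adj, link_adj hxy]
  constructor
  · tauto
  · rintro (h | ⟨rfl, rfl⟩ | ⟨rfl, rfl⟩) <;> tauto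

/-- Induction along the branches of a finite forest, two steps at a time. -/
theorem IsAcyclic.dart_induction₂ [Finite V] (hG : G.IsAcyclic) {P : V → V → Prop}
    (h : ∀ u v, (∀ k, G.Adj k u → k ≠ v → ∀ g, G.Adj g k → g ≠ u → P g k) → P u v) (u v : V) :
    P u v := by
  suffices H : P u v ∧ ∀ k, G.Adj k u → k ≠ v → P k u from H.1
  refine hG.dart_induction (P := fun u v => P u v ∧ ∀ k, G.Adj k u → k ≠ v → P k u) ?_ u v
  intro u v ih
  exact ⟨h u v fun k hk hkv => (ih k hk hkv).2, fun k hk hkv => (ih k hk hkv).1⟩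

/-- No edge of the branch of `u` at `v` has both ends in `C`. -/
inductive CleanBranch (G : SimpleGraph V) (C : Finset V) : V → V → Prop
  | mk {u v : V} (h : ∀ k, G.Adj k u → k ≠ v → ¬(u ∈ C ∧ k ∈ C))
      (ih : ∀ k, G.Adj k u → k ≠ v → CleanBranch G C k u) : CleanBranch G C u v

lemma CleanBranch.not_mem {C : Finset V} {u v k : V} (h : G.CleanBranch C u v) (hu : u ∈ C)
    (hk : G.Adj k u) (hkv : k ≠ v) : k ∉ C := by
  cases h with
  | mk h ih => exact fun hkC => h k hk hkv ⟨hu, hkC⟩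

lemma CleanBranch.sub {C : Finset V} {u v k : V} (h : G.CleanBranch C u v)
    (hk : G.Adj k u) (hkv : k ≠ v) : G.CleanBranch C k u := by
  cases h with
  | mk h ih => exact ih k hk hkv

/-- Walk away from `b`, alternately leaving and re-entering `C`. By `hL` the walk cannot stop inside
`C`, so it ends at a leaf outside. It passes from one vertex of `C` to the next in two steps, so `i`
and `j` agree in every proper 2-colouring. -/
lemma exists_leaf_in_branch [Finite V] (hG : G.IsAcyclic) {C : Finset V} (hC : G.Cover C)
    (hL : ∀ v ∈ C, ∀ k, ∃ w, G.Adj v w ∧ w ≠ k) (i b : V) (hi : i ∈ C) (h : G.CleanBranch C i b) :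
    ∃ j l, j ∈ C ∧ l ∉ C ∧ G.Adj l j ∧ (∀ w, G.Adj l w → w = j) ∧ j ∈ G.branch i b ∧
      l ∈ G.branch i b ∧ ∀ c : V → Prop, (∀ x y, G.Adj x y → (c x ↔ ¬ c y)) → (c i ↔ c j) := by
  revert hi h
  refine hG.dart_induction₂ (P := fun i b => i ∈ C → G.CleanBranch C i b → ∃ j l, j ∈ C ∧ l ∉ C ∧
    G.Adj l j ∧ (∀ w, G.Adj l w → w = j) ∧ j ∈ G.branch i b ∧ l ∈ G.branch i b ∧
    ∀ c : V → Prop, (∀ x y, G.Adj x y → (c x ↔ ¬ c y)) → (c i ↔ c j)) ?_ i b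
  intro i b ih hi h
  obtain ⟨k, hk, hkb⟩ := hL i hi b
  have hkC := h.not_mem hi hk.symm hkb
  have hsub := branch_subset_of_adj hG hk.symm hkb
  by_cases hleaf : ∀ w, G.Adj k w → w = i
  · exact ⟨i, k, hi, hkC, hk.symm, hleaf, self_mem_branch _ _, hsub (self_mem_branch _ _),
      fun c _ => Iff.rfl⟩
  · push Not at hleaf
    obtain ⟨g, hg, hgi⟩ := hleaf
    have hgC := (hC k g hg).resolve_left hkC
    obtain ⟨j, l, h1, h2, h3, h4, h5, h6, h7⟩ :=
      ih k hk.symm hkb g hg.symm hgi hgC ((h.sub hk.symm hkb).sub hg.symm hgi)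
    have hsub' := (branch_subset_of_adj hG hg.symm hgi).trans hsub
    refine ⟨j, l, h1, h2, h3, h4, hsub' h5, hsub' h6, fun c hc => ?_⟩
    have e1 := hc i k hk
    have e2 := hc k g hg
    have e3 := h7 c hc
    tauto

lemma not_reachable_of_isolated {x y : V} (h : ∀ w, ¬ G.Adj x w) (hxy : x ≠ y) :
    ¬ G.Reachable x y := by
  intro hr
  have : y ∈ ({x} : Set V) := mem_of_reachable (S := {x}) rfl
    (by rintro a rfl b hab; exact (h b hab).elim) hr
  exact hxy this.symm

end Commute

/-! ### Vertices outside the cover have at most two neighbours. -/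

section HighDegree

variable {V : Type*} [Fintype V] {T G : SimpleGraph V}

lemma cnt_link_eq {x y : V} (hxy : x ≠ y) {A B : Finset V} (h : insert x (insert y A) = B) :
    (G.link x y).cnt A = G.cnt A - G.cnt B := by
  rw [cnt_link hxy, h]

/-- The numerical core of the high-degree argument. `hA` and `hB` say that neither of two rewirings
is an improvement, `hr` and `har` bound odds, and `h4` is positive correlation; together they are
inconsistent. -/
lemma high_degree_aux {a z w1 wj w r : ℝ} (ha : 0 < a) (hz : 0 < z) (hw1 : 0 < w1)
    (hw1' : w1 ≤ 1 / 2) (hwj : 0 < wj) (hwj' : wj ≤ 1 / 2) (h1 : w ≤ w1)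
    (h4 : w1 * wj ≤ w) (hz' : z ≤ 1 / 2)
    (hr : (w1 - w / 2) ≤ r * (1 - wj / 2 - w1 + w / 2)) (har : a * (1 + r) ≤ 1 - a) (hr0 : 0 < r)
    (hA : 1 - wj ≤ a * (2 - w1 - wj))
    (hB : 1 - a * w1 - a * z - wj / 2 + a * z * w1 + a * w / 2 + a * z * wj / 2 - a * z * w / 2 ≤
      1 - wj / 2 - a * wj + a * wj / 2 - z / 2 + wj * z / 2) : False := by
  -- Joint law of two events with marginals `w1`, `wj` and intersection `w`: first only, second
  -- only, neither.
  obtain ⟨W10, hW10⟩ : ∃ W10, W10 = w1 - w := ⟨_, rfl⟩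
  obtain ⟨W01, hW01⟩ : ∃ W01, W01 = wj - w := ⟨_, rfl⟩
  obtain ⟨W00, hW00⟩ : ∃ W00, W00 = 1 - w1 - wj + w := ⟨_, rfl⟩
  obtain ⟨s, hs⟩ : ∃ s, s = 1 - 2 * a := ⟨_, rfl⟩
  have hw : 0 < w := lt_of_lt_of_le (mul_pos hw1 hwj) h4
  have hs1 : a * r ≤ s := by rw [hs]; linarith
  have hs0 : 0 < s := lt_of_lt_of_le (mul_pos ha hr0) hs1
  have p10 : 0 ≤ W10 := by rw [hW10]; linarith
  have p00 : 0 < W00 := by rw [hW00]; linarith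
  have hA' : s * (W00 + W10) ≤ a * (W01 - W10) := by
    rw [hW00, hW10, hW01, hs]; linarith
  have hB' : s * z * (W00 + W10) ≤ a * (1 - z) * (2 * W10 - W01) := by
    rw [hW00, hW10, hW01, hs]; linarith
  -- `W01` cancels when `1 - z` times the first rewiring inequality is added to the second.
  have key : s * (W00 + W10) ≤ a * (1 - z) * W10 := by
    nlinarith [mul_le_mul_of_nonneg_left hA' (by linarith : 0 ≤ 1 - z)]
  have hcorr : W10 * W01 ≤ W00 * (w : ℝ) := by
    rw [hW00, hW10, hW01]; linarith
  have hr1 : 2 * W10 + w ≤ r * (2 * W00 + W01) := by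
    rw [hW00, hW10, hW01]; linarith
  -- Positive correlation upgrades the averaged odds bound `hr1` to one conditional on the second
  -- event failing.
  have hr2 : W10 ≤ r * W00 := by
    have p01 : 0 ≤ 2 * W00 + W01 := by rw [hW00, hW01]; linarith
    by_contra hlt
    push Not at hlt
    have : (2 * W10 + w) * W00 ≤ r * (2 * W00 + W01) * W00 :=
      mul_le_mul_of_nonneg_right hr1 p00.le
    have p01' : 0 < 2 * W00 + W01 := by
      rw [hW00, hW01]; linarith
    have h5 : r * W00 * (2 * W00 + W01) < W10 * (2 * W00 + W01) := mul_lt_mul_of_pos_right hlt p01'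
    nlinarith
  have h6 : a * W10 ≤ s * W00 := by
    calc a * W10 ≤ a * (r * W00) := mul_le_mul_of_nonneg_left hr2 ha.le
      _ = a * r * W00 := by ring
      _ ≤ s * W00 := mul_le_mul_of_nonneg_right hs1 p00.le
  have h7 : 0 ≤ a * z * W10 := by positivity
  rcases p10.eq_or_lt with h0 | h0
  · rw [← h0] at key
    nlinarith [mul_pos hs0 p00]
  · nlinarith [mul_pos hs0 h0]

/-- In this and the next three lemmas `G` is the tree with the edges `lj`, `i₁b`, `bi₃` removed.
There `l` is isolated, hence has probability 1/2, and among the named vertices only `i₁` and `j` can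
be dependent. Everything is thus a polynomial in single probabilities and `G.pr {i₁, j}`. The
present difference compares `b` with `l` as places to attach `i₃`. -/
lemma link_cnt_fst {b l i₁ j : V} (hGl : ∀ w, ¬ G.Adj l w) (hlj : l ≠ j) (h1b : i₁ ≠ b)
    (nli : ¬ G.Reachable l i₁) (nlj : ¬ G.Reachable l j)
    (nbi : ¬ G.Reachable b i₁) (nbj : ¬ G.Reachable b j) (nbl : ¬ G.Reachable b l) :
    ((G.link l j).link i₁ b).cnt {b} - ((G.link l j).link i₁ b).cnt {l} =
      (G.pr {b} * (2 - G.pr {i₁} - G.pr {j}) - (1 - G.pr {j})) / 2 * G.cnt ∅ := by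
  have h0 := cnt_empty_pos (G := G)
  have hpr : ∀ A, G.cnt A = G.pr A * G.cnt ∅ := fun A => cnt_eq_pr_mul A
  have pl : G.pr {l} = 1 / 2 := pr_singleton_of_isolated hGl
  have q_b1 : G.pr {b, i₁} = G.pr {b} * G.pr {i₁} := pr_insert (by simpa using nbi)
  have q_lj : G.pr {l, j} = 1 / 2 * G.pr {j} := by rw [pr_insert (by simpa using nlj), pl]
  have q_l1j : G.pr {l, i₁, j} = 1 / 2 * G.pr {i₁, j} := by
    rw [pr_insert (by simp [nli, nlj]), pl]
  have q_bl1 : G.pr {b, l, i₁} = G.pr {b} * (1 / 2 * G.pr {i₁}) := by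
    rw [pr_insert (by simp [nbl, nbi]), pr_insert (by simpa using nli), pl]
  have q_blj : G.pr {b, l, j} = G.pr {b} * (1 / 2 * G.pr {j}) := by
    rw [pr_insert (by simp [nbl, nbj]), q_lj]
  have q_bl1j : G.pr {b, l, i₁, j} = G.pr {b} * (1 / 2 * G.pr {i₁, j}) := by
    rw [pr_insert (by simp [nbl, nbi, nbj]), q_l1j]
  have c_l : (G.link l j).cnt {l} = G.cnt {l} - G.cnt {l, j} :=
    cnt_link_eq hlj (by ext; grind)
  have c_b : (G.link l j).cnt {b} = G.cnt {b} - G.cnt {b, l, j} :=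
    cnt_link_eq hlj (by ext; grind)
  have c_b1 : (G.link l j).cnt {b, i₁} = G.cnt {b, i₁} - G.cnt {b, l, i₁, j} :=
    cnt_link_eq hlj (by ext; grind)
  have c_bl1 : (G.link l j).cnt {b, l, i₁} = G.cnt {b, l, i₁} - G.cnt {b, l, i₁, j} :=
    cnt_link_eq hlj (by ext; grind)
  have d_l : ((G.link l j).link i₁ b).cnt {l} = (G.link l j).cnt {l} - (G.link l j).cnt {b, l, i₁} :=
    cnt_link_eq h1b (by ext; grind)
  have d_b : ((G.link l j).link i₁ b).cnt {b} = (G.link l j).cnt {b} - (G.link l j).cnt {b, i₁} :=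
    cnt_link_eq h1b (by ext; grind)
  rw [d_l, d_b, c_l, c_bl1, c_b, c_b1, hpr {l}, hpr {l, j}, hpr {b, l, i₁}, hpr {b, l, i₁, j},
    hpr {b}, hpr {b, l, j}, hpr {b, i₁}, pl, q_lj, q_bl1, q_bl1j, q_blj, q_b1]
  ring

/-- The count for the original tree, all three edges being put back. -/
lemma link_cnt_original {b l i₁ i₃ j : V} (hGl : ∀ w, ¬ G.Adj l w) (hlj : l ≠ j) (h1b : i₁ ≠ b)
    (h3b : b ≠ i₃) (nli : ¬ G.Reachable l i₁) (nlj : ¬ G.Reachable l j)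
    (nbi : ¬ G.Reachable b i₁) (nbj : ¬ G.Reachable b j) (nbl : ¬ G.Reachable b l)
    (nl3 : ¬ G.Reachable l i₃) (nb3 : ¬ G.Reachable b i₃) (n3i : ¬ G.Reachable i₃ i₁)
    (n3j : ¬ G.Reachable i₃ j) :
    (((G.link l j).link i₁ b).link b i₃).cnt ∅ =
      (1 - G.pr {b} * G.pr {i₁} - G.pr {b} * G.pr {i₃} - G.pr {j} / 2 +
        G.pr {b} * G.pr {i₃} * G.pr {i₁} + G.pr {b} * G.pr {i₁, j} / 2 +
        G.pr {b} * G.pr {i₃} * G.pr {j} / 2 - G.pr {b} * G.pr {i₃} * G.pr {i₁, j} / 2) *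
        G.cnt ∅ := by
  have h0 := cnt_empty_pos (G := G)
  have hpr : ∀ A, G.cnt A = G.pr A * G.cnt ∅ := fun A => cnt_eq_pr_mul A
  have pl : G.pr {l} = 1 / 2 := pr_singleton_of_isolated hGl
  have q_b1 : G.pr {b, i₁} = G.pr {b} * G.pr {i₁} := pr_insert (by simpa using nbi)
  have q_b3 : G.pr {b, i₃} = G.pr {b} * G.pr {i₃} := pr_insert (by simpa using nb3)
  have q_lj : G.pr {l, j} = 1 / 2 * G.pr {j} := by rw [pr_insert (by simpa using nlj), pl]
  have q_3j : G.pr {i₃, j} = G.pr {i₃} * G.pr {j} := pr_insert (by simpa using n3j)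
  have q_31 : G.pr {i₃, i₁} = G.pr {i₃} * G.pr {i₁} := pr_insert (by simpa using n3i)
  have q_l3j : G.pr {l, i₃, j} = 1 / 2 * (G.pr {i₃} * G.pr {j}) := by
    rw [pr_insert (by simp [nl3, nlj]), pl, q_3j]
  have q_l1j : G.pr {l, i₁, j} = 1 / 2 * G.pr {i₁, j} := by
    rw [pr_insert (by simp [nli, nlj]), pl]
  have q_b31 : G.pr {b, i₃, i₁} = G.pr {b} * (G.pr {i₃} * G.pr {i₁}) := by
    rw [pr_insert (by simp [nb3, nbi]), q_31]
  have q_bl1j : G.pr {b, l, i₁, j} = G.pr {b} * (1 / 2 * G.pr {i₁, j}) := by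
    rw [pr_insert (by simp [nbl, nbi, nbj]), q_l1j]
  have q_bl3j : G.pr {b, l, i₃, j} = G.pr {b} * (1 / 2 * (G.pr {i₃} * G.pr {j})) := by
    rw [pr_insert (by simp [nbl, nb3, nbj]), q_l3j]
  have q_bl31j : G.pr {b, l, i₃, i₁, j} = G.pr {b} * (1 / 2 * (G.pr {i₃} * G.pr {i₁, j})) := by
    rw [pr_insert (by simp [nbl, nb3, nbi, nbj]), pr_insert (by simp [nli, nlj, nl3]), pl,
      pr_insert (by simp [n3i, n3j])]
  have c_0 : (G.link l j).cnt ∅ = G.cnt ∅ - G.cnt {l, j} :=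
    cnt_link_eq hlj (by simp)
  have c_b1 : (G.link l j).cnt {b, i₁} = G.cnt {b, i₁} - G.cnt {b, l, i₁, j} :=
    cnt_link_eq hlj (by ext; grind)
  have c_b3 : (G.link l j).cnt {b, i₃} = G.cnt {b, i₃} - G.cnt {b, l, i₃, j} :=
    cnt_link_eq hlj (by ext; grind)
  have c_b31 : (G.link l j).cnt {b, i₃, i₁} = G.cnt {b, i₃, i₁} - G.cnt {b, l, i₃, i₁, j} :=
    cnt_link_eq hlj (by ext; grind)
  have d_0 : ((G.link l j).link i₁ b).cnt ∅ = (G.link l j).cnt ∅ - (G.link l j).cnt {b, i₁} :=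
    cnt_link_eq h1b (by ext; grind)
  have d_b3 : ((G.link l j).link i₁ b).cnt {b, i₃} = (G.link l j).cnt {b, i₃} - (G.link l j).cnt {b, i₃, i₁} :=
    cnt_link_eq h1b (by ext; grind)
  rw [cnt_link_eq h3b (B := {b, i₃}) (by simp), d_0, d_b3, c_0, c_b1, c_b3, c_b31, hpr {l, j},
    hpr {b, i₁}, hpr {b, l, i₁, j}, hpr {b, i₃}, hpr {b, l, i₃, j}, hpr {b, i₃, i₁},
    hpr {b, l, i₃, i₁, j}, q_lj, q_b1, q_bl1j, q_b3, q_bl3j, q_b31, q_bl31j]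
  ring

/-- The count after the second rewiring: `b` hangs at `j` instead of `i₁`, and `i₃` at `l` instead
of `b`. -/
lemma link_cnt_snd {b l i₃ j : V} (hGl : ∀ w, ¬ G.Adj l w) (hlj : l ≠ j) (hjb : j ≠ b)
    (hl3 : l ≠ i₃) (nlj : ¬ G.Reachable l j)
    (nbj : ¬ G.Reachable b j) (nbl : ¬ G.Reachable b l)
    (nl3 : ¬ G.Reachable l i₃) (nb3 : ¬ G.Reachable b i₃)
    (n3j : ¬ G.Reachable i₃ j) :
    (((G.link l j).link j b).link l i₃).cnt ∅ =
      (1 - G.pr {j} / 2 - G.pr {b} * G.pr {j} + G.pr {b} * G.pr {j} / 2 - G.pr {i₃} / 2 +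
        G.pr {j} * G.pr {i₃} / 2) * G.cnt ∅ := by
  have h0 := cnt_empty_pos (G := G)
  have hpr : ∀ A, G.cnt A = G.pr A * G.cnt ∅ := fun A => cnt_eq_pr_mul A
  have pl : G.pr {l} = 1 / 2 := pr_singleton_of_isolated hGl
  have q_bj : G.pr {b, j} = G.pr {b} * G.pr {j} := pr_insert (by simpa using nbj)
  have q_lj : G.pr {l, j} = 1 / 2 * G.pr {j} := by rw [pr_insert (by simpa using nlj), pl]
  have q_l3 : G.pr {l, i₃} = 1 / 2 * G.pr {i₃} := by rw [pr_insert (by simpa using nl3), pl]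
  have q_3j : G.pr {i₃, j} = G.pr {i₃} * G.pr {j} := pr_insert (by simpa using n3j)
  have q_l3j : G.pr {l, i₃, j} = 1 / 2 * (G.pr {i₃} * G.pr {j}) := by
    rw [pr_insert (by simp [nl3, nlj]), pl, q_3j]
  have q_blj : G.pr {b, l, j} = G.pr {b} * (1 / 2 * G.pr {j}) := by
    rw [pr_insert (by simp [nbl, nbj]), q_lj]
  have q_bl3j : G.pr {b, l, i₃, j} = G.pr {b} * (1 / 2 * (G.pr {i₃} * G.pr {j})) := by
    rw [pr_insert (by simp [nbl, nb3, nbj]), q_l3j]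
  have c_0 : (G.link l j).cnt ∅ = G.cnt ∅ - G.cnt {l, j} :=
    cnt_link_eq hlj (by simp)
  have c_bj : (G.link l j).cnt {b, j} = G.cnt {b, j} - G.cnt {b, l, j} :=
    cnt_link_eq hlj (by ext; grind)
  have c_l3 : (G.link l j).cnt {l, i₃} = G.cnt {l, i₃} - G.cnt {l, i₃, j} :=
    cnt_link_eq hlj (by ext; grind)
  have c_bl3j : (G.link l j).cnt {b, l, i₃, j} = G.cnt {b, l, i₃, j} - G.cnt {b, l, i₃, j} :=
    cnt_link_eq hlj (by ext; simp)
  have f_0 : ((G.link l j).link j b).cnt ∅ = (G.link l j).cnt ∅ - (G.link l j).cnt {b, j} :=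
    cnt_link_eq hjb (by ext; grind)
  have f_l3 : ((G.link l j).link j b).cnt {l, i₃} =
      (G.link l j).cnt {l, i₃} - (G.link l j).cnt {b, l, i₃, j} :=
    cnt_link_eq hjb (by ext; grind)
  rw [cnt_link_eq hl3 (B := {l, i₃}) (by simp), f_0, f_l3, c_0, c_bj, c_l3, c_bl3j, hpr {l, j},
    hpr {b, l, i₃, j}, hpr {b, j}, hpr {b, l, j}, hpr {l, i₃}, hpr {l, i₃, j}, q_lj, q_bl3j, q_bj,
    q_blj, q_l3, q_l3j]
  ring

/-- The message from `i₁` to `b`, in terms of the same probabilities. -/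
lemma link_ratio {l i₁ j : V} (hGl : ∀ w, ¬ G.Adj l w) (hlj : l ≠ j)
    (nli : ¬ G.Reachable l i₁) (nlj : ¬ G.Reachable l j) :
    (G.link l j).ratio i₁ = (G.pr {i₁} - G.pr {i₁, j} / 2) /
      (1 - G.pr {j} / 2 - G.pr {i₁} + G.pr {i₁, j} / 2) := by
  have h0 := cnt_empty_pos (G := G)
  have hpr : ∀ A, G.cnt A = G.pr A * G.cnt ∅ := fun A => cnt_eq_pr_mul A
  have pl : G.pr {l} = 1 / 2 := pr_singleton_of_isolated hGl
  have q_lj : G.pr {l, j} = 1 / 2 * G.pr {j} := by rw [pr_insert (by simpa using nlj), pl]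
  have q_l1j : G.pr {l, i₁, j} = 1 / 2 * G.pr {i₁, j} := by
    rw [pr_insert (by simp [nli, nlj]), pl]
  have c_0 : (G.link l j).cnt ∅ = G.cnt ∅ - G.cnt {l, j} :=
    cnt_link_eq hlj (by simp)
  have c_1 : (G.link l j).cnt {i₁} = G.cnt {i₁} - G.cnt {l, i₁, j} :=
    cnt_link_eq hlj (by ext; grind)
  rw [ratio_eq, c_0, c_1, hpr {l, j}, hpr {i₁}, hpr {l, i₁, j}, q_lj, q_l1j]
  rw [show G.pr {i₁} * G.cnt ∅ - 1 / 2 * G.pr {i₁, j} * G.cnt ∅ =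
    (G.pr {i₁} - G.pr {i₁, j} / 2) * G.cnt ∅ by ring,
    show G.cnt ∅ - 1 / 2 * G.pr {j} * G.cnt ∅ - (G.pr {i₁} - G.pr {i₁, j} / 2) * G.cnt ∅ =
    (1 - G.pr {j} / 2 - G.pr {i₁} + G.pr {i₁, j} / 2) * G.cnt ∅ by ring,
    mul_div_mul_right _ _ h0.ne']

/-- Take a leaf `l` at some `j` in the branch of `i₁`. Either moving `i₃` from `b` to `l`, or doing
this and also moving `b` from `i₁` to `j`, lowers the count. The set `C` remains a cover because it
contains `i₃` and `j`. The third neighbour `i₂` enters only through its message, which bounds the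
odds of `b`. -/
lemma IsMinimizer.high_degree_contra_aux {c : ℕ} (hT : T.IsMinimizer c) {C : Finset V}
    (hC : T.Cover C) (hcard : C.card ≤ c) (hL : ∀ v ∈ C, ∀ k, ∃ w, T.Adj v w ∧ w ≠ k)
    {b i₁ i₂ i₃ : V} (hb : b ∉ C) (h₁ : T.Adj i₁ b) (h₂ : T.Adj i₂ b) (h₃ : T.Adj i₃ b)
    (h₁₂ : i₁ ≠ i₂) (h₁₃ : i₁ ≠ i₃) (h₂₃ : i₂ ≠ i₃) (hclean : T.CleanBranch C i₁ b)
    (hle : T.msg i₁ b ≤ T.msg i₂ b) : False := by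
  have hac := hT.isTree.isAcyclic
  have hi₁ : i₁ ∈ C := (hC _ _ h₁).resolve_right hb
  have hi₃ : i₃ ∈ C := (hC _ _ h₃).resolve_right hb
  obtain ⟨j, l, hj, hl, hlj, hleaf, hjb, hlb, hcol⟩ :=
    exists_leaf_in_branch hac hC hL i₁ b hi₁ hclean
  have hd13 := branch_disjoint hac h₁ h₃ h₁₃
  have hd12 := branch_disjoint hac h₁ h₂ h₁₂
  have hd23 := branch_disjoint hac h₂ h₃ h₂₃
  have hbn := not_mem_branch hac h₁
  have hi₃n : i₃ ∉ T.branch i₁ b := fun h => Set.disjoint_left.1 hd13 h (self_mem_branch _ _)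
  have hbl : b ≠ l := by rintro rfl; exact hbn hlb
  have hjb' : j ≠ b := by rintro rfl; exact hbn hjb
  have hli₃ : l ≠ i₃ := by rintro rfl; exact hi₃n hlb
  have hji₃ : j ≠ i₃ := by rintro rfl; exact hi₃n hjb
  obtain ⟨G1, hG1⟩ : ∃ G1, G1 = T.cut b i₃ := ⟨_, rfl⟩
  obtain ⟨G2, hG2⟩ : ∃ G2, G2 = G1.cut i₁ b := ⟨_, rfl⟩
  obtain ⟨G, hG⟩ : ∃ G, G = G2.cut l j := ⟨_, rfl⟩
  have hG1b : G1.Adj i₁ b := by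
    rw [hG1, cut_adj]; exact ⟨h₁, fun h => h₁.ne h.1, fun h => h₁₃ h.1⟩
  have hG2l : G2.Adj l j := by
    rw [hG2, hG1, cut_adj, cut_adj]
    exact ⟨⟨hlj, fun h => hbl h.1.symm, fun h => hli₃ h.1⟩, fun h => hjb' h.2,
      fun h => hbl h.1.symm⟩
  have eG1 : G1 = G2.link i₁ b := by rw [hG2, link_cut hG1b]
  have eG2 : G2 = G.link l j := by rw [hG, link_cut hG2l]
  have hGle : G ≤ T := by
    rw [hG, hG2, hG1]
    exact (cut_le _ _).trans ((cut_le _ _).trans (cut_le _ _))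
  have hGac : G.IsAcyclic := hac.anti hGle
  have hGle1 : G ≤ T.cut i₁ b := by
    rw [hG, hG2, hG1, cut_cut_comm b i₃]
    exact (cut_le _ _).trans (cut_le _ _)
  have hGle3 : G ≤ T.cut b i₃ := by
    rw [hG, hG2, hG1]
    exact (cut_le _ _).trans (cut_le _ _)
  have hGl : ∀ w, ¬ G.Adj l w := by
    intro w hw
    have hwj := hleaf w (hGle hw)
    rw [hG, cut_adj] at hw
    exact hw.2.1 ⟨rfl, hwj⟩
  -- reachability in `G`
  have nb : ∀ x ∈ T.branch i₁ b, ¬ G.Reachable b x := fun x hx h =>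
    hbn (Reachable.trans hx (h.mono hGle1).symm)
  have n3 : ∀ x ∈ T.branch i₁ b, ¬ G.Reachable i₃ x := fun x hx h =>
    hi₃n (Reachable.trans hx (h.mono hGle1).symm)
  have nb3 : ¬ G.Reachable b i₃ := fun h =>
    isAcyclic_iff_forall_adj_isBridge.1 hac h₃.symm (h.mono hGle3)
  have nbi := nb i₁ (self_mem_branch _ _)
  have nbj := nb j hjb
  have nbl := nb l hlb
  have n3i := n3 i₁ (self_mem_branch _ _)
  have n3j := n3 j hjb
  have hli₁ : l ≠ i₁ := by rintro rfl; exact hl hi₁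
  have nl : ∀ x, l ≠ x → ¬ G.Reachable l x := fun x => not_reachable_of_isolated hGl
  have nli := nl i₁ hli₁
  have nlj := nl j hlj.ne
  have nl3 := nl i₃ hli₃
  -- first move: reconnect `i₃` to `l`
  have hA : G1.pr {l} ≤ G1.pr {b} := by
    rw [← ratio_le_ratio_iff, hG1]
    exact hT.ratio_le h₃.symm (branch_subset_of_adj hac h₁ h₁₃ hlb)
      ⟨C, hC.swap (Or.inr hi₃) hli₃, hcard⟩
  have hA' : G1.cnt {l} ≤ G1.cnt {b} := by
    rw [cnt_eq_pr_mul, cnt_eq_pr_mul (G := G1) {b}]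
    exact mul_le_mul_of_nonneg_right hA cnt_empty_pos.le
  have hA'' := link_cnt_fst hGl hlj.ne h₁.ne nli nlj nbi nbj nbl
  rw [← eG2, ← eG1] at hA''
  -- second move
  have hT1 := hT.isTree.swap h₁ hjb (self_mem_branch b i₁)
  have hadj3 : ((T.cut i₁ b).link j b).Adj b i₃ := by
    rw [link_adj hjb', cut_adj]
    exact Or.inl ⟨h₃.symm, fun h => h₁.ne h.1.symm, fun h => h₁₃ h.2.symm⟩
  have hl3 : l ∈ ((T.cut i₁ b).link j b).branch b i₃ := by
    have s1 : ((T.cut i₁ b).link j b).Adj b j := by rw [link_adj hjb']; tauto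
    have s2 : ((T.cut i₁ b).link j b).Adj j l := by
      rw [link_adj hjb', cut_adj]
      exact Or.inl ⟨hlj.symm, fun h => hbl h.2.symm, fun h => hjb' h.1⟩
    exact branch_step (branch_step (self_mem_branch _ _) s1 (fun h => hji₃ h.2)) s2
      (fun h => hjb' h.1)
  have hT2 := hT1.swap hadj3 hl3 (self_mem_branch _ _)
  have hB := hT.le _ hT2 ⟨C, (hC.swap (Or.inl hj) hjb').swap (Or.inr hi₃) hli₃, hcard⟩
  have eT2 : ((T.cut i₁ b).link j b).cut b i₃ = G2.link j b := by
    rw [link_cut_comm hjb' (fun h => hjb' h.1) (fun h => hji₃ h.1), cut_cut_comm, ← hG1, ← hG2]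
  have hT0 := link_cnt_original hGl hlj.ne h₁.ne h₃.ne.symm nli nlj nbi nbj nbl nl3 nb3 n3i n3j
  rw [← eG2, ← eG1, hG1, link_cut h₃.symm] at hT0
  have hT2' := link_cnt_snd hGl hlj.ne hjb' hli₃ nlj nbj nbl nl3 nb3 n3j
  rw [← eG2] at hT2'
  rw [eT2, hT0, hT2'] at hB
  have hB := le_of_mul_le_mul_right hB cnt_empty_pos
  -- the messages
  have m1 : T.msg i₁ b = (G.pr {i₁} - G.pr {i₁, j} / 2) /
      (1 - G.pr {j} / 2 - G.pr {i₁} + G.pr {i₁, j} / 2) := by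
    rw [← msg_cut hac h₁ h₁₃, ← hG1, msg, ← hG2, eG2, link_ratio hGl hlj.ne nli nlj]
  have hGb2 : G.Adj b i₂ := by
    rw [hG, hG2, hG1, cut_adj, cut_adj, cut_adj]
    exact ⟨⟨⟨h₂.symm, fun h => h₂₃ h.2, fun h => h₃.ne h.1.symm⟩, fun h => h₁.ne h.1.symm,
      fun h => h₁₂ h.2.symm⟩, fun h => hbl h.1, fun h => hjb' h.1.symm⟩
  have m2 : T.msg i₂ b = G.msg i₂ b := by
    refine msg_congr' fun x hx y => ?_
    have hxb : x ≠ b := by rintro rfl; exact not_mem_branch hac h₂ hx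
    have hx1 : x ∉ T.branch i₁ b := fun h => Set.disjoint_left.1 hd12 h hx
    have hx1' : x ≠ i₁ := by rintro rfl; exact hx1 (self_mem_branch _ _)
    have hx3 : x ≠ i₃ := by
      rintro rfl; exact Set.disjoint_left.1 hd23 hx (self_mem_branch _ _)
    have hxl : x ≠ l := by rintro rfl; exact hx1 hlb
    have hxj : x ≠ j := by rintro rfl; exact hx1 hjb
    rw [hG, hG2, hG1, cut_adj, cut_adj, cut_adj]
    tauto
  have hrb : G.ratio b ≤ 1 / (1 + T.msg i₂ b) := by
    rw [ratio_eq_ratio_cut_mul hGac hGb2, ← m2]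
    exact mul_le_of_le_one_left (factor_pos _ _).le (ratio_le_one _)
  have hbhalf := pr_singleton_le_half (G := G) b
  have p1h := pr_singleton_le_half (G := G) i₁
  have pjh := pr_singleton_le_half (G := G) j
  have hr0 := msg_pos (G := T) i₂ b
  have har : G.pr {b} * (1 + T.msg i₂ b) ≤ 1 - G.pr {b} := by
    rw [ratio, div_le_div_iff₀ (by linarith) (by linarith), one_mul] at hrb
    exact hrb
  obtain ⟨col, hcol'⟩ : ∃ col : V → Prop, ∀ x y, T.Adj x y → (col x ↔ ¬ col y) := by
    refine ⟨fun v => hac.coloringTwo v = 0, fun x y hxy => ?_⟩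
    have := hac.coloringTwo.valid hxy
    omega
  have hwpos : 0 < G.pr {i₁, j} :=
    lt_of_lt_of_le (mul_pos (pr_singleton_pos i₁) (pr_singleton_pos j))
      (SimpleGraph.pr_mul_le (fun x y hxy => hcol' x y (hGle hxy)) (hcol col hcol'))
  refine high_degree_aux (a := G.pr {b}) (z := G.pr {i₃}) (w1 := G.pr {i₁}) (wj := G.pr {j})
    (w := G.pr {i₁, j}) (r := T.msg i₂ b) (pr_singleton_pos b) (pr_singleton_pos i₃)
    (pr_singleton_pos i₁) p1h (pr_singleton_pos j) pjh (pr_anti (by simp))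
    (SimpleGraph.pr_mul_le (fun x y hxy => hcol' x y (hGle hxy)) (hcol col hcol'))
    (pr_singleton_le_half _) ?_ har hr0 ?_ ?_
  · rw [m1, div_le_iff₀ (by linarith)] at hle
    exact hle
  · have h0 := cnt_empty_pos (G := G)
    have h1 : 0 ≤ (G.pr {b} * (2 - G.pr {i₁} - G.pr {j}) - (1 - G.pr {j})) / 2 * G.cnt ∅ := by
      rw [← hA'']; linarith
    linarith [nonneg_of_mul_nonneg_left h1 h0]
  · exact hB

/-- In a minimizer, a vertex outside the cover has at most two neighbours, provided the branches
of two further ones are clean. -/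
lemma IsMinimizer.high_degree_contra {c : ℕ} (hT : T.IsMinimizer c) {C : Finset V}
    (hC : T.Cover C) (hcard : C.card ≤ c) (hL : ∀ v ∈ C, ∀ k, ∃ w, T.Adj v w ∧ w ≠ k)
    {b i₁ i₂ i₃ : V} (hb : b ∉ C) (h₁ : T.Adj i₁ b) (h₂ : T.Adj i₂ b) (h₃ : T.Adj i₃ b)
    (h₁₂ : i₁ ≠ i₂) (h₁₃ : i₁ ≠ i₃) (h₂₃ : i₂ ≠ i₃) (hclean₁ : T.CleanBranch C i₁ b)
    (hclean₂ : T.CleanBranch C i₂ b) : False := by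
  rcases le_total (T.msg i₁ b) (T.msg i₂ b) with h | h
  · exact hT.high_degree_contra_aux hC hcard hL hb h₁ h₂ h₃ h₁₂ h₁₃ h₂₃ hclean₁ h
  · exact hT.high_degree_contra_aux hC hcard hL hb h₂ h₁ h₃ h₁₂.symm h₂₃ h₁₃ hclean₂ h

end HighDegree

/-! ### Alternating branches, even tails and flipping the cover. -/

section Alternating

variable {V : Type*} {G H T : SimpleGraph V} {C : Finset V}

/-- The branch of `g` at `k` has centers exactly in `C`: every second vertex is in `C`, vertices of
`C` are not leaves and the other ones have at most two neighbours. -/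
inductive AltBranch (G : SimpleGraph V) (C : Finset V) : V → V → Prop
  | mk {g k : V} (hg : g ∈ C) (ex : ∃ a, G.Adj a g ∧ a ≠ k)
      (hC : ∀ a, G.Adj a g → a ≠ k → a ∉ C)
      (uniq : ∀ a, G.Adj a g → a ≠ k → ∀ g₁ g₂, G.Adj g₁ a → g₁ ≠ g → G.Adj g₂ a → g₂ ≠ g →
        g₁ = g₂)
      (ih : ∀ a, G.Adj a g → a ≠ k → ∀ g₁, G.Adj g₁ a → g₁ ≠ g → AltBranch G C g₁ a) :
      AltBranch G C g k

/-- The branch of `i` at `j` is a path with an even number of vertices, ending at `z`, every second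
of them belonging to `C`. -/
inductive EvenTail (G : SimpleGraph V) (C : Finset V) : V → V → V → Prop
  | leaf {i j k : V} (hi : i ∈ C) (hk : k ∉ C) (hki : G.Adj k i) (hkj : k ≠ j)
      (hnb : ∀ w, G.Adj i w → w = j ∨ w = k) (hleaf : ∀ w, G.Adj k w → w = i) : EvenTail G C k i j
  | step {z i j k g : V} (hi : i ∈ C) (hk : k ∉ C) (hki : G.Adj k i) (hkj : k ≠ j)
      (hnb : ∀ w, G.Adj i w → w = j ∨ w = k) (hgk : G.Adj g k) (hgi : g ≠ i)
      (hnb' : ∀ w, G.Adj k w → w = i ∨ w = g) (ih : EvenTail G C z g k) : EvenTail G C z i j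

/-- Two further neighbours of a noncover vertex `a`, along with `g`, would give three neighbours of
`a`, two of them with clean branches, which `hdeg` forbids. -/
lemma CleanBranch.altBranch [Finite V] (hG : G.IsAcyclic) (hC : G.Cover C)
    (hL : ∀ v ∈ C, ∀ k, ∃ w, G.Adj v w ∧ w ≠ k)
    (hdeg : ∀ b i₁ i₂ i₃, b ∉ C → G.Adj i₁ b → G.Adj i₂ b → G.Adj i₃ b → i₁ ≠ i₂ → i₁ ≠ i₃ →
      i₂ ≠ i₃ → G.CleanBranch C i₁ b → G.CleanBranch C i₂ b → False)
    (g k : V) (hg : g ∈ C) (h : G.CleanBranch C g k) : G.AltBranch C g k := by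
  revert hg h
  refine hG.dart_induction₂ (P := fun g k => g ∈ C → G.CleanBranch C g k → G.AltBranch C g k) ?_ g k
  intro g k ih hg h
  have hnC : ∀ a, G.Adj a g → a ≠ k → a ∉ C := fun a ha hak => h.not_mem hg ha hak
  refine AltBranch.mk hg ?_ hnC ?_ ?_
  · obtain ⟨w, hw, hwk⟩ := hL g hg k
    exact ⟨w, hw.symm, hwk⟩
  · intro a ha hak g₁ g₂ h1 h1' h2 h2'
    by_contra hne
    exact hdeg a g₁ g₂ g (hnC a ha hak) h1 h2 ha.symm hne h1' h2' ((h.sub ha hak).sub h1 h1')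
      ((h.sub ha hak).sub h2 h2')
  · intro a ha hak g₁ h1 h1'
    exact ih a ha hak g₁ h1 h1' ((hC g₁ a h1).resolve_right (hnC a ha hak))
      ((h.sub ha hak).sub h1 h1')

lemma AltBranch.congr (hG : G.IsAcyclic) {g k : V} (h : G.AltBranch C g k)
    (hGH : ∀ x ∈ G.branch g k, ∀ y, (x ≠ g ∨ y ≠ k) → (G.Adj x y ↔ H.Adj x y)) :
    H.AltBranch C g k := by
  induction h with
  | @mk g k hg ex hC uniq _ ih =>
    have h1 : ∀ a, a ≠ k → (G.Adj a g ↔ H.Adj a g) := fun a hak => by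
      rw [G.adj_comm, H.adj_comm]
      exact hGH g (self_mem_branch _ _) a (Or.inr hak)
    have h2 : ∀ a, G.Adj a g → a ≠ k → ∀ b, G.Adj b a ↔ H.Adj b a := fun a ha hak b => by
      rw [G.adj_comm, H.adj_comm]
      exact hGH a (branch_subset_of_adj hG ha hak (self_mem_branch _ _)) b (Or.inl ha.ne)
    refine AltBranch.mk hg ?_ ?_ ?_ ?_
    · obtain ⟨a, ha, hak⟩ := ex
      exact ⟨a, (h1 a hak).1 ha, hak⟩
    · exact fun a ha hak => hC a ((h1 a hak).2 ha) hak
    · intro a ha hak g₁ g₂ e1 e1' e2 e2'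
      have ha' := (h1 a hak).2 ha
      exact uniq a ha' hak g₁ g₂ ((h2 a ha' hak _).2 e1) e1' ((h2 a ha' hak _).2 e2) e2'
    · intro a ha hak g₁ e1 e1'
      have ha' := (h1 a hak).2 ha
      have e1'' := (h2 a ha' hak g₁).2 e1
      refine ih a ha' hak g₁ e1'' e1' fun x hx y _ => ?_
      have hxa := branch_subset_of_adj hG e1'' e1' hx
      exact hGH x (branch_subset_of_adj hG ha' hak hxa) y
        (Or.inl (by rintro rfl; exact not_mem_branch hG ha' hxa))

lemma EvenTail.congr (hG : G.IsAcyclic) {z i j : V} (h : G.EvenTail C z i j)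
    (hGH : ∀ x ∈ G.branch i j, ∀ y, (x ≠ i ∨ y ≠ j) → (G.Adj x y ↔ H.Adj x y)) :
    H.EvenTail C z i j := by
  induction h with
  | @leaf i j k hi hk hki hkj hnb hleaf =>
    have h1 : ∀ a, a ≠ j → (G.Adj i a ↔ H.Adj i a) := fun a ha =>
      hGH i (self_mem_branch _ _) a (Or.inr ha)
    have h2 : ∀ b, G.Adj k b ↔ H.Adj k b := fun b =>
      hGH k (branch_subset_of_adj hG hki hkj (self_mem_branch _ _)) b (Or.inl hki.ne)
    refine EvenTail.leaf hi hk ((h2 i).1 hki) hkj (fun w hw => ?_) fun w hw => hleaf w ((h2 w).2 hw)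
    by_cases hwj : w = j
    · exact Or.inl hwj
    · exact hnb w ((h1 w hwj).2 hw)
  | @step z i j k g hi hk hki hkj hnb hgk hgi hnb' _ ih =>
    have h1 : ∀ a, a ≠ j → (G.Adj i a ↔ H.Adj i a) := fun a ha =>
      hGH i (self_mem_branch _ _) a (Or.inr ha)
    have h2 : ∀ b, G.Adj k b ↔ H.Adj k b := fun b =>
      hGH k (branch_subset_of_adj hG hki hkj (self_mem_branch _ _)) b (Or.inl hki.ne)
    refine EvenTail.step hi hk ((h2 i).1 hki) hkj (fun w hw => ?_) ((h2 g).1 hgk.symm).symm hgi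
      (fun w hw => hnb' w ((h2 w).2 hw)) (ih fun x hx y _ => ?_)
    · by_cases hwj : w = j
      · exact Or.inl hwj
      · exact hnb w ((h1 w hwj).2 hw)
    · have hxa := branch_subset_of_adj hG hgk hgi hx
      exact hGH x (branch_subset_of_adj hG hki hkj hxa) y
        (Or.inl (by rintro rfl; exact not_mem_branch hG hki hxa))

lemma EvenTail.mem_branch (hG : G.IsAcyclic) {z i j : V} (h : G.EvenTail C z i j) :
    z ∈ G.branch i j := by
  induction h with
  | leaf hi hk hki hkj hnb hleaf => exact branch_subset_of_adj hG hki hkj (self_mem_branch _ _)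
  | step hi hk hki hkj hnb hgk hgi hnb' _ ih =>
    exact branch_subset_of_adj hG hki hkj (branch_subset_of_adj hG hgk hgi ih)

/-- The other alternating cover along an even tail. -/
lemma EvenTail.exists_cover (hG : G.IsAcyclic) (hC : G.Cover C) {z i j : V} (hij : G.Adj i j)
    (h : G.EvenTail C z i j) : ∃ D : Finset V, (G.cut i j).Cover D ∧ D.card ≤ C.card ∧ z ∈ D ∧
      ∀ x, x ∉ G.branch i j → (x ∈ D ↔ x ∈ C) := by
  induction h with
  | @leaf i j k hi hk hki hkj hnb hleaf =>
    refine ⟨insert k (C.erase i), fun a b hab => ?_, ?_, by simp, fun x hx => ?_⟩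
    · rw [cut_adj] at hab
      simp only [Finset.mem_insert, Finset.mem_erase]
      by_cases ha : a = i
      · subst ha
        exact Or.inr (Or.inl ((hnb b hab.1).resolve_left fun h => hab.2.1 ⟨rfl, h⟩))
      by_cases hb : b = i
      · subst hb
        exact Or.inl (Or.inl ((hnb a hab.1.symm).resolve_left fun h => hab.2.2 ⟨h, rfl⟩))
      · have := hC a b hab.1
        tauto
    · refine (Finset.card_insert_le _ _).trans ?_
      rw [Finset.card_erase_add_one hi]
    · have h1 : x ≠ i := by rintro rfl; exact hx (self_mem_branch _ _)
      have h2 : x ≠ k := by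
        rintro rfl; exact hx (branch_subset_of_adj hG hki hkj (self_mem_branch _ _))
      simp [h1, h2]
  | @step z i j k g hi hk hki hkj hnb hgk hgi hnb' _ ih =>
    obtain ⟨D, hD, hcard, hz, hout⟩ := ih hgk
    have hsub := branch_subset_of_adj hG hki hkj
    have hsub' := branch_subset_of_adj hG hgk hgi
    have hiD : i ∈ D := (hout i fun h => not_mem_branch hG hki (hsub' h)).2 hi
    refine ⟨insert k (D.erase i), fun a b hab => ?_, ?_, ?_, fun x hx => ?_⟩
    · rw [cut_adj] at hab
      -- `k` replaces `i`, and the flip is already done beyond `k`. The edge `ij` is the only one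
      -- that may become uncovered, and it is cut.
      simp only [Finset.mem_insert, Finset.mem_erase]
      by_cases ha : a = i
      · subst ha
        exact Or.inr (Or.inl ((hnb b hab.1).resolve_left fun h => hab.2.1 ⟨rfl, h⟩))
      by_cases hb : b = i
      · subst hb
        exact Or.inl (Or.inl ((hnb a hab.1.symm).resolve_left fun h => hab.2.2 ⟨h, rfl⟩))
      by_cases hak : a = k
      · exact Or.inl (Or.inl hak)
      by_cases hbk : b = k
      · exact Or.inr (Or.inl hbk)
      · have := hD a b (cut_adj.2 ⟨hab.1, fun h => hbk h.2, fun h => hak h.1⟩)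
        tauto
    · refine (Finset.card_insert_le _ _).trans ?_
      rwa [Finset.card_erase_add_one hiD]
    · refine Finset.mem_insert_of_mem (Finset.mem_erase.2 ⟨?_, hz⟩)
      rintro rfl
      exact not_mem_branch hG hki (hsub' (EvenTail.mem_branch hG ‹_›))
    · have h1 : x ≠ i := by rintro rfl; exact hx (self_mem_branch _ _)
      have h2 : x ≠ k := by
        rintro rfl; exact hx (hsub (self_mem_branch _ _))
      simp [h1, h2, hout x fun h => hx (hsub (hsub' h))]

lemma Connected.exists_adj_dist (hG : G.Connected) {r x : V} (h : x ≠ r) :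
    ∃ w, G.Adj x w ∧ G.dist r w + 1 = G.dist r x := by
  obtain ⟨p, hp⟩ := hG.exists_walk_length_eq_dist x r
  cases p with
  | nil => exact (h rfl).elim
  | @cons _ w _ hxw q =>
    refine ⟨w, hxw, ?_⟩
    rw [Walk.length_cons, dist_comm] at hp
    have h1 := dist_le q.reverse
    have h2 := hG.dist_triangle (u := r) (v := w) (w := x)
    rw [dist_eq_one_iff_adj.2 hxw.symm] at h2
    rw [Walk.length_reverse] at h1
    omega

/-- The vertices of an even tail get closer to a vertex of degree at least three. -/
lemma EvenTail.dist_lt [Fintype V] (hG : G.IsTree) {r : V} (hr : 3 ≤ (G.nb r).card) {z i j : V}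
    (h : G.EvenTail C z i j) : G.dist r j < G.dist r i := by
  have hr2 : ∀ x a b : V, (∀ w, G.Adj x w → w = a ∨ w = b) → x ≠ r := by
    rintro x a b hx rfl
    have : G.nb x ⊆ {a, b} := fun w hw => by simpa using hx w (mem_nb.1 hw)
    have := (Finset.card_le_card this).trans Finset.card_le_two
    omega
  -- Tail vertices have at most two neighbours, so none is `r` and each has a neighbour nearer to
  -- `r`. If that is not the outer one, it is the inner one.
  have key : ∀ i j k, (∀ w, G.Adj i w → w = j ∨ w = k) → G.dist r i < G.dist r k →
      G.dist r j < G.dist r i := by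
    intro i j k hnb hlt
    obtain ⟨w, hw, hw'⟩ := hG.connected.exists_adj_dist (hr2 i j k hnb)
    rcases hnb w hw with rfl | rfl <;> omega
  induction h with
  | @leaf i j k hi hk hki hkj hnb hleaf =>
    refine key i j k hnb ?_
    obtain ⟨w, hw, hw'⟩ := hG.connected.exists_adj_dist
      (hr2 k i i fun w hw => Or.inl (hleaf w hw))
    obtain rfl := hleaf w hw
    omega
  | @step z i j k g hi hk hki hkj hnb hgk hgi hnb' _ ih =>
    exact key i j k hnb (key k i g hnb' ih)

end Alternating

/-! ### The golden threshold for messages and the exclusion of even tails. -/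

section Golden

variable {V : Type*} [Fintype V] {G T : SimpleGraph V} {C : Finset V}

lemma golden_of_le {x y : ℝ} (hx : 0 < x) (hxy : x ≤ y) (hy : y ^ 2 + y < 1) : x ^ 2 + x < 1 := by
  nlinarith

/-- The map is r ↦ (1+r)/(2+r), which is increasing and fixes the positive root of x² + x = 1. It
therefore preserves the values below this root. -/
lemma golden_step {r : ℝ} (hr : 0 < r) (h : r ^ 2 + r < 1) :
    (1 / (1 + 1 / (1 + r))) ^ 2 + 1 / (1 + 1 / (1 + r)) < 1 := by
  have e : 1 / (1 + 1 / (1 + r)) = (1 + r) / (2 + r) := by field_simp; ring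
  rw [e, div_pow, div_add_div _ _ (by positivity) (by positivity), div_lt_one (by positivity)]
  nlinarith [mul_pos hr hr]

/-- A single step r ↦ 1/(1+r) fixes the same root but is decreasing, so it carries values below the
root to values above. -/
lemma golden_inv {r : ℝ} (hr : 0 < r) (h : r ^ 2 + r < 1) :
    1 < (1 / (1 + r)) ^ 2 + 1 / (1 + r) := by
  rw [div_pow, div_add_div _ _ (by positivity) (by positivity), lt_div_iff₀ (by positivity)]
  nlinarith

lemma factor_golden (hG : G.IsAcyclic) {a g : V}
    (huniq : ∀ g₁ g₂, G.Adj g₁ a → g₁ ≠ g → G.Adj g₂ a → g₂ ≠ g → g₁ = g₂)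
    (h : ∀ g₁, G.Adj g₁ a → g₁ ≠ g → G.msg g₁ a ^ 2 + G.msg g₁ a < 1) :
    (1 / (1 + G.msg a g)) ^ 2 + 1 / (1 + G.msg a g) < 1 := by
  by_cases hl : ∀ w, G.Adj a w → w = g
  · rw [msg_of_leaf hG hl]; norm_num
  · push Not at hl
    obtain ⟨g₁, h1, h2⟩ := hl
    rw [msg_of_unique hG h1 h2]
    · exact golden_step (msg_pos _ _) (h g₁ h1.symm h2)
    · intro k hk
      by_cases hkg : k = g
      · exact Or.inl hkg
      · exact Or.inr (huniq k g₁ hk.symm hkg h1.symm h2)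

/-- A message is at most any one of its factors. A factor is 1/2 if it comes from a leaf, and
otherwise the image under `golden_step` of the message of a smaller alternating branch. -/
lemma AltBranch.golden (hG : G.IsAcyclic) {g k : V} (h : G.AltBranch C g k) :
    G.msg g k ^ 2 + G.msg g k < 1 := by
  induction h with
  | @mk g k hg ex hC uniq _ ih =>
    obtain ⟨a, ha, hak⟩ := ex
    exact golden_of_le (msg_pos _ _) (msg_le_factor hG ha.symm hak)
      (factor_golden hG (uniq a ha hak) (ih a ha hak))

lemma ratio_of_leaf (hG : G.IsAcyclic) {u w : V} (hw : G.Adj u w) (h : ∀ k, G.Adj u k → k = w) :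
    G.ratio u = 1 / (1 + G.msg w u) := by
  rw [← msg_of_not_adj (G.irrefl (v := u)), msg_of_unique hG hw hw.ne.symm fun k hk => Or.inr (h k hk)]

/-- Follow a path away from `k` to a leaf. The messages running outward stay below the threshold,
and the leaf inverts the last one, landing above it. -/
lemma AltBranch.exists_of_golden (hG : G.IsAcyclic) {g k : V} (h : G.AltBranch C g k)
    (hin : ∀ a, G.Adj a g → a ≠ k → G.msg g a ^ 2 + G.msg g a < 1) :
    ∃ z ∈ G.branch g k, 1 < G.ratio z ^ 2 + G.ratio z := by
  induction h with
  | @mk g k hg ex hC uniq _ ih =>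
    obtain ⟨a, ha, hak⟩ := ex
    have hsub := branch_subset_of_adj hG ha hak
    by_cases hl : ∀ w, G.Adj a w → w = g
    · refine ⟨a, hsub (self_mem_branch _ _), ?_⟩
      rw [ratio_of_leaf hG ha hl]
      exact golden_inv (msg_pos _ _) (hin a ha hak)
    · push Not at hl
      obtain ⟨g₁, h1, h2⟩ := hl
      obtain ⟨z, hz, hz'⟩ := ih a ha hak g₁ h1.symm h2 fun b hb hba => by
        refine golden_of_le (msg_pos _ _) (msg_le_factor hG h1.symm hba.symm) ?_
        rw [msg_of_unique hG ha h2.symm fun w hw => ?_]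
        · exact golden_step (msg_pos _ _) (hin a ha hak)
        · by_cases hwg : w = g
          · exact Or.inr hwg
          · exact Or.inl (uniq a ha hak w g₁ hw.symm hwg h1.symm h2)
      exact ⟨z, hsub (branch_subset_of_adj hG h1.symm h2 hz), hz'⟩

/-- If a center has two neighbours away from `k`, its outgoing message along either is bounded by
the factor of the other, which is below the threshold; then `AltBranch.exists_of_golden` applies. If
no center branches, the whole branch is a path. -/
lemma AltBranch.evenTail_or (hG : G.IsAcyclic) {g k : V} (h : G.AltBranch C g k) :
    (∃ z, G.EvenTail C z g k) ∨ ∃ z ∈ G.branch g k, 1 < G.ratio z ^ 2 + G.ratio z := by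
  induction h with
  | @mk g k hg ex hC uniq alt ih =>
    by_cases htwo : ∃ a b, G.Adj a g ∧ a ≠ k ∧ G.Adj b g ∧ b ≠ k ∧ a ≠ b
    · refine Or.inr ((AltBranch.mk hg ex hC uniq alt).exists_of_golden hG fun a ha hak => ?_)
      obtain ⟨b, hb, hbk, hba⟩ : ∃ b, G.Adj b g ∧ b ≠ k ∧ b ≠ a := by
        obtain ⟨b, b', hb, hbk, hb', hbk', hne⟩ := htwo
        by_cases h : b = a
        · exact ⟨b', hb', hbk', fun h' => hne (h.trans h'.symm)⟩
        · exact ⟨b, hb, hbk, h⟩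
      exact golden_of_le (msg_pos _ _) (msg_le_factor hG hb.symm hba)
        (factor_golden hG (uniq b hb hbk) fun g₁ h1 h2 => (alt b hb hbk g₁ h1 h2).golden hG)
    · push Not at htwo
      obtain ⟨a, ha, hak⟩ := ex
      have hnb : ∀ w, G.Adj g w → w = k ∨ w = a := fun w hw => by
        by_cases hwk : w = k
        · exact Or.inl hwk
        · exact Or.inr (htwo w a hw.symm hwk ha hak)
      by_cases hl : ∀ w, G.Adj a w → w = g
      · exact Or.inl ⟨a, EvenTail.leaf hg (hC a ha hak) ha hak hnb hl⟩
      · push Not at hl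
        obtain ⟨g₁, h1, h2⟩ := hl
        rcases ih a ha hak g₁ h1.symm h2 with ⟨z, hz⟩ | ⟨z, hz, hz'⟩
        · refine Or.inl ⟨z, EvenTail.step hg (hC a ha hak) ha hak hnb h1.symm h2 (fun w hw => ?_) hz⟩
          by_cases hwg : w = g
          · exact Or.inl hwg
          · exact Or.inr (uniq a ha hak w g₁ hw.symm hwg h1.symm h2)
        · exact Or.inr ⟨z, branch_subset_of_adj hG ha hak
            (branch_subset_of_adj hG h1.symm h2 hz), hz'⟩

/-- Once `ij` is cut, the odds at `i` are its message and lie below the threshold, so a vertex with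
odds above it beats `i`. -/
lemma AltBranch.evenTail_or_ratio_lt (hT : T.IsAcyclic) {i j : V} (hij : T.Adj i j)
    (h : T.AltBranch C i j) : (∃ z, T.EvenTail C z i j) ∨
      ∃ z ∈ T.branch i j, (T.cut i j).ratio i < (T.cut i j).ratio z := by
  have hac := hT.cut i j
  have hcut : ∀ x ∈ T.branch i j, ∀ y, (x ≠ i ∨ y ≠ j) → (T.Adj x y ↔ (T.cut i j).Adj x y) := by
    intro x hx y hxy
    rw [cut_adj]
    have : x ≠ j := by rintro rfl; exact not_mem_branch hT hij hx
    tauto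
  have h' := h.congr hT hcut
  have hnadj : ¬ (T.cut i j).Adj i j := by rw [cut_adj]; tauto
  have hb : (T.cut i j).branch i j = T.branch i j := by
    simp only [branch, cut_of_not_adj hnadj]
  rcases h'.evenTail_or hac with ⟨z, hz⟩ | ⟨z, hz, hz'⟩
  · exact Or.inl ⟨z, hz.congr hac fun x hx y hxy => (hcut x (hb ▸ hx) y hxy).symm⟩
  · refine Or.inr ⟨z, hb ▸ hz, ?_⟩
    have h1 := h.golden hT
    rw [msg] at h1
    by_contra hle
    push Not at hle
    nlinarith [ratio_pos (G := T.cut i j) z, ratio_pos (G := T.cut i j) i]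

/-- The map relating the messages two edges apart along an even tail. -/
noncomputable def tailStep (r : ℝ) : ℝ := 1 / (1 + 1 / (1 + r))

/-- A message crossing the tail outward and one coming back from the end both undergo one `tailStep`
per center, `s + 1` in all. The first starts from the message of `j`, the second from 1, the message
of a leaf; this makes the odds at `z` and at `j` comparable. -/
lemma EvenTail.ratio_eq (hG : G.IsAcyclic) {z i j : V} (hij : G.Adj i j)
    (h : G.EvenTail C z i j) : ∃ s : ℕ, G.ratio z = tailStep^[s + 1] (G.msg j i) ∧
      1 / (1 + G.msg i j) = tailStep^[s + 1] 1 := by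
  induction h with
  | @leaf i j k hi hk hki hkj hnb hleaf =>
    refine ⟨0, ?_, ?_⟩
    · rw [ratio_of_leaf hG hki hleaf, msg_of_unique hG hij hkj.symm fun w hw => (hnb w hw).symm]
      rfl
    · rw [msg_of_unique hG hki.symm hkj hnb, msg_of_leaf hG hleaf]
      rfl
  | @step z i j k g hi hk hki hkj hnb hgk hgi hnb' _ ih =>
    obtain ⟨s, h1, h2⟩ := ih hgk
    refine ⟨s + 1, ?_, ?_⟩
    · rw [h1, Function.iterate_succ_apply _ (s + 1)]
      congr 1
      rw [msg_of_unique hG hki hgi.symm fun w hw => (hnb' w hw).symm,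
        msg_of_unique hG hij hkj.symm fun w hw => (hnb w hw).symm]
      rfl
    · rw [Function.iterate_succ_apply' _ (s + 1), ← h2,
        msg_of_unique hG hki.symm hkj hnb, msg_of_unique hG hgk.symm hgi hnb']
      rfl

lemma tailStep_pos {x : ℝ} (hx : 0 < x) : 0 < tailStep x := by
  unfold tailStep; positivity

/-- `tailStep` is increasing and concave with a positive value at 0, so x · `tailStep u` < `tailStep
(x * u)` for 0 < x < 1; this iterates. -/
lemma tailStep_iterate_lt {x : ℝ} (hx : 0 < x) (hx1 : x < 1) (s : ℕ) :
    x * tailStep^[s + 1] 1 < tailStep^[s + 1] x := by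
  have step : ∀ u v : ℝ, 0 < u → 0 < v → x * u ≤ v → x * tailStep u < tailStep v := by
    intro u v hu hv huv
    have e : ∀ r : ℝ, 0 < r → tailStep r = (1 + r) / (2 + r) := by
      intro r hr; unfold tailStep; field_simp; ring
    rw [e u hu, e v hv, mul_div_assoc', div_lt_div_iff₀ (by positivity) (by positivity)]
    nlinarith [mul_pos hu hv]
  have pos : ∀ (s : ℕ) (y : ℝ), 0 < y → 0 < tailStep^[s] y := by
    intro s
    induction s with
    | zero => exact fun y hy => hy
    | succ s ih => intro y hy; rw [Function.iterate_succ_apply']; exact tailStep_pos (ih y hy)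
  induction s with
  | zero => exact step 1 x one_pos hx (by simp)
  | succ s ih =>
    rw [Function.iterate_succ_apply', Function.iterate_succ_apply' _ (s + 1) x]
    exact step _ _ (pos _ _ one_pos) (pos _ _ hx) ih.le

/-- In a minimizer, no even tail hangs from a vertex of the cover with two further neighbours. -/
lemma IsMinimizer.not_evenTail {c : ℕ} (hT : T.IsMinimizer c) (hC : T.Cover C) (hcard : C.card ≤ c)
    {z i j v v' : V} (hij : T.Adj i j) (hj : j ∈ C) (htail : T.EvenTail C z i j)
    (hv : T.Adj j v) (hvi : v ≠ i) (hv' : T.Adj j v') (hv'i : v' ≠ i) (hvv' : v ≠ v') : False := by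
  have hac := hT.isTree.isAcyclic
  obtain ⟨D, hD, hDcard, hzD, hout⟩ := htail.exists_cover hac hC hij
  have hjD : j ∈ D := (hout j (not_mem_branch hac hij)).2 hj
  have hD' : T.Cover D := fun a b hab => by
    by_cases h1 : a = i ∧ b = j
    · exact Or.inr (h1.2 ▸ hjD)
    by_cases h2 : a = j ∧ b = i
    · exact Or.inl (h2.1 ▸ hjD)
    · exact hD a b (cut_adj.2 ⟨hab, h1, h2⟩)
  have hzb := htail.mem_branch hac
  have hzj : z ∈ T.branch j v := branch_subset_of_adj hac hij hvi.symm hzb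
  have hzv : z ≠ v := by rintro rfl; exact not_mem_branch hac hv hzj
  have hle := hT.ratio_le hv hzj ⟨D, hD'.swap (Or.inl hzD) hzv, hDcard.trans hcard⟩
  have hG := hac.cut j v
  have hij' : (T.cut j v).Adj i j := by
    rw [cut_adj]; exact ⟨hij, fun h => hij.ne h.1, fun h => hvi h.1.symm⟩
  have htail' : (T.cut j v).EvenTail C z i j := by
    refine htail.congr hac fun x hx y _ => ?_
    rw [cut_adj]
    refine ⟨fun hxy => ⟨hxy, ?_, ?_⟩, fun h => h.1⟩
    · rintro ⟨rfl, -⟩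
      exact not_mem_branch hac hij hx
    · rintro ⟨rfl, rfl⟩
      exact not_mem_branch hac hij (branch_step hx hxy fun h => hvi h.1)
  obtain ⟨s, h1, h2⟩ := htail'.ratio_eq hG hij'
  have h3 := ratio_eq_ratio_cut_mul hG hij'.symm
  rw [h2] at h3
  change _ = (T.cut j v).msg j i * _ at h3
  -- The second further neighbour `v'` makes the message of `j` less than 1. This makes `z` strictly
  -- more probable than `j`, so moving `v` to `z` would pay.
  have hlt : (T.cut j v).msg j i < 1 := by
    refine msg_lt_one (w := v') ?_ hv'i
    rw [cut_adj]; exact ⟨hv', fun h => hvv' h.2.symm, fun h => hv'.ne h.2.symm⟩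
  rw [h1, h3] at hle
  exact absurd hle (not_le.2 (tailStep_iterate_lt (msg_pos _ _) hlt s))

end Golden

/-! ### Star trees and degree counts over a cover. -/

section StarTrees

variable {V : Type*} [Fintype V] {T : SimpleGraph V} {C : Finset V}

/-- `T` is a tree with bipartition `C`, `Cᶜ` such that the vertices of `C` have degree at least two
and the other ones have degree at most two. -/
structure StarTree (T : SimpleGraph V) (C : Finset V) : Prop where
  isTree : T.IsTree
  bip : ∀ a b, T.Adj a b → (a ∈ C ↔ b ∉ C)
  two_le : ∀ v ∈ C, 2 ≤ (T.nb v).card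
  le_two : ∀ b, b ∉ C → (T.nb b).card ≤ 2

lemma IsTree.sum_card_nb (hT : T.IsTree) : ∑ v, (T.nb v).card = 2 * (Fintype.card V - 1) := by
  have h1 := hT.card_edgeFinset
  have h2 := T.sum_degrees_eq_twice_card_edges
  have h3 : ∀ v, T.degree v = (T.nb v).card := fun v => by
    rw [← card_neighborFinset_eq_degree]
    congr 1
    ext w
    simp
  simp only [h3] at h2
  omega

lemma sum_card_nb_sdiff (hC : T.Cover C) :
    ∑ v ∈ Cᶜ, (T.nb v).card = ∑ v ∈ C, (T.nb v \ C).card := by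
  have h := Finset.sum_card_bipartiteAbove_eq_sum_card_bipartiteBelow (s := Cᶜ) (t := C) T.Adj
  rw [Finset.sum_congr rfl, h, Finset.sum_congr rfl]
  · intro v _
    congr 1
    ext w
    simp [Finset.bipartiteBelow, adj_comm, and_comm]
  · intro v hv
    congr 1
    ext w
    simp only [mem_nb, Finset.bipartiteAbove, Finset.mem_filter]
    exact ⟨fun h => ⟨(hC v w h).resolve_left (Finset.mem_compl.1 hv), h⟩, fun h => h.2⟩

/-- Counting the edges of a tree at the vertices of a cover. -/
lemma IsTree.sum_card_cover (hT : T.IsTree) (hC : T.Cover C) :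
    2 * ∑ v ∈ C, (T.nb v).card =
      2 * (Fintype.card V - 1) + ∑ v ∈ C, (T.nb v ∩ C).card := by
  have h1 := hT.sum_card_nb
  rw [← Finset.sum_add_sum_compl C, sum_card_nb_sdiff hC] at h1
  have h2 : ∑ v ∈ C, (T.nb v).card =
      ∑ v ∈ C, (T.nb v \ C).card + ∑ v ∈ C, (T.nb v ∩ C).card := by
    rw [← Finset.sum_add_distrib]
    exact Finset.sum_congr rfl fun v _ => (Finset.card_sdiff_add_card_inter _ _).symm
  omega

/-- The degrees over `C` sum to at most 2|C| ≤ 2c ≤ n - 1, while a cover must account for n - 1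
edges, those inside it being counted twice. Equality holds throughout. -/
lemma IsTree.starTree_of_degree_le_two (hT : T.IsTree) (hC : T.Cover C) {c : ℕ} (hcard : C.card ≤ c)
    (hn : 2 * c + 1 ≤ Fintype.card V) (hdeg : ∀ v, (T.nb v).card ≤ 2) :
    C.card = c ∧ T.StarTree C := by
  have h := hT.sum_card_cover hC
  have h1 : ∑ v ∈ C, (T.nb v).card ≤ ∑ v ∈ C, 2 := Finset.sum_le_sum fun v _ => hdeg v
  have h1' : ∑ v ∈ C, 2 = C.card * 2 := by simp
  have h2 : ∑ v ∈ C, (T.nb v ∩ C).card = 0 := by omega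
  have h3 : ∑ v ∈ C, (T.nb v).card = ∑ v ∈ C, 2 := by omega
  refine ⟨by omega, hT, fun a b hab => ?_, fun v hv => ?_, fun b _ => hdeg b⟩
  · have := hC a b hab
    refine ⟨fun ha hb => ?_, fun hb => this.resolve_right hb⟩
    have h4 := Finset.sum_eq_zero_iff.1 h2 a ha
    rw [Finset.card_eq_zero] at h4
    exact Finset.notMem_empty b (h4 ▸ Finset.mem_inter.2 ⟨mem_nb.2 hab, hb⟩)
  · exact ((Finset.sum_eq_sum_iff_of_le fun v _ => hdeg v).1 h3 v hv).ge

lemma StarTree.cover (h : T.StarTree C) : T.Cover C := fun a b hab => by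
  have := h.bip a b hab
  tauto

/-- The degrees of the centers of a star tree sum up to the number of edges. -/
lemma StarTree.sum_card (h : T.StarTree C) : ∑ v ∈ C, (T.nb v).card = Fintype.card V - 1 := by
  have h1 := h.isTree.sum_card_cover h.cover
  have h2 : ∑ v ∈ C, (T.nb v ∩ C).card = 0 := by
    refine Finset.sum_eq_zero fun v hv => ?_
    rw [Finset.card_eq_zero, Finset.eq_empty_iff_forall_notMem]
    intro w hw
    rw [Finset.mem_inter, mem_nb] at hw
    exact (h.bip v w hw.1).1 hv hw.2
  omega

end StarTrees

/-! ### Every minimizer is a star tree. -/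

section MinimizersAreStarTrees

variable {V : Type*} [Fintype V] {T : SimpleGraph V}

/-- A cover whose vertices are, among all covers of bounded size, as close to `r` as possible. -/
lemma IsTree.exists_closest_cover (hT : T.IsTree) {c : ℕ} (h : ∃ C, T.Cover C ∧ C.card ≤ c)
    {r : V} (hr : 3 ≤ (T.nb r).card) : ∃ C, T.Cover C ∧ C.card ≤ c ∧
      (∀ v ∈ C, ∀ k, ∃ w, T.Adj v w ∧ w ≠ k) ∧
      ∀ z i j, T.EvenTail C z i j → T.Adj i j → j ∈ C →
        ∃ v v', T.Adj j v ∧ v ≠ i ∧ T.Adj j v' ∧ v' ≠ i ∧ v ≠ v' := by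
  obtain ⟨C, hC, hmin⟩ := Finset.exists_min_image
    (Finset.univ.filter fun C => T.Cover C ∧ C.card ≤ c) (fun C => ∑ v ∈ C, (T.dist r v + 1))
    (by obtain ⟨C, hC⟩ := h; exact ⟨C, by simpa using hC⟩)
  simp only [Finset.mem_filter, Finset.mem_univ, true_and] at hC hmin
  have hr2 : ∀ x a b : V, (∀ w, T.Adj x w → w = a ∨ w = b) → x ≠ r := by
    rintro x a b hx rfl
    have : T.nb x ⊆ {a, b} := fun w hw => by simpa using hx w (mem_nb.1 hw)
    have := (Finset.card_le_card this).trans Finset.card_le_two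
    omega
  -- If exchanging `v` for `w` leaves a cover, `w` is not nearer to `r`. This is used for a leaf and
  -- its neighbour, and for a `j` with a tail at `i` and at most one other neighbour.
  have swap : ∀ v ∈ C, ∀ w, T.Cover (insert w (C.erase v)) → T.dist r v ≤ T.dist r w := by
    intro v hv w hw
    have h1 := hmin _ ⟨hw, (Finset.card_insert_le _ _).trans
      ((Finset.card_erase_add_one hv).le.trans hC.2)⟩
    rw [← Finset.add_sum_erase C _ hv] at h1
    by_cases hwC : w ∈ C.erase v
    · rw [Finset.insert_eq_of_mem hwC] at h1
      omega
    · rw [Finset.sum_insert hwC] at h1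
      omega
  refine ⟨C, hC.1, hC.2, fun v hv k => ?_, fun z i j htail hij hj => ?_⟩
  · by_contra hcon
    push Not at hcon
    obtain ⟨w, hw, hd⟩ := hT.connected.exists_adj_dist
      (hr2 v k k fun w hw => Or.inl (hcon w hw))
    have := swap v hv w fun a b hab => by
      have := hC.1 a b hab
      simp only [Finset.mem_insert, Finset.mem_erase]
      by_cases ha : a = v
      · subst ha; exact Or.inr (Or.inl ((hcon b hab).trans (hcon w hw).symm))
      by_cases hb : b = v
      · subst hb; exact Or.inl (Or.inl ((hcon a hab.symm).trans (hcon w hw).symm))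
      tauto
    omega
  · by_contra hcon
    push Not at hcon
    have hlt := htail.dist_lt hT hr
    have hi : i ∈ C := by cases htail <;> assumption
    have h2 : ∃ v, ∀ w, T.Adj j w → w = i ∨ w = v := by
      by_cases h : ∃ v, T.Adj j v ∧ v ≠ i
      · obtain ⟨v, hv, hvi⟩ := h
        refine ⟨v, fun w hw => ?_⟩
        by_cases hwi : w = i
        · exact Or.inl hwi
        · exact Or.inr (hcon w v hw hwi hv hvi)
      · push Not at h
        exact ⟨i, fun w hw => Or.inl (h w hw)⟩
    obtain ⟨v, hv⟩ := h2
    obtain ⟨w, hw, hd⟩ := hT.connected.exists_adj_dist (hr2 j i v hv)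
    have hwi : w ≠ i := by rintro rfl; omega
    have := swap j hj w fun a b hab => by
      have := hC.1 a b hab
      have hv' : ∀ b, T.Adj j b → b = i ∨ b = w := fun b hb => by
        rcases hv b hb with h | h
        · exact Or.inl h
        · exact Or.inr (h.trans ((hv w hw).resolve_left hwi).symm)
      simp only [Finset.mem_insert, Finset.mem_erase]
      by_cases ha : a = j
      · subst ha
        rcases hv' b hab with rfl | rfl
        · exact Or.inr (Or.inr ⟨hij.ne, hi⟩)
        · exact Or.inr (Or.inl rfl)
      by_cases hb : b = j
      · subst hb
        rcases hv' a hab.symm with rfl | rfl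
        · exact Or.inl (Or.inr ⟨hij.ne, hi⟩)
        · exact Or.inl (Or.inl rfl)
      tauto
    omega

/-- Every minimizer is a star tree. -/
theorem IsMinimizer.exists_starTree {c : ℕ} (hT : T.IsMinimizer c)
    (hn : 2 * c + 1 ≤ Fintype.card V) : ∃ C, C.card = c ∧ T.StarTree C := by
  by_cases hdeg : ∀ v, (T.nb v).card ≤ 2
  · obtain ⟨C, hC, hcard⟩ := hT.cover
    exact ⟨C, hT.isTree.starTree_of_degree_le_two hC hcard hn hdeg⟩
  push Not at hdeg
  obtain ⟨r, hr⟩ := hdeg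
  obtain ⟨C, hC, hcard, hL, htail⟩ := hT.isTree.exists_closest_cover hT.cover hr
  have hac := hT.isTree.isAcyclic
  have hbad : ∀ b i₁ i₂ i₃, b ∉ C → T.Adj i₁ b → T.Adj i₂ b → T.Adj i₃ b → i₁ ≠ i₂ → i₁ ≠ i₃ →
      i₂ ≠ i₃ → T.CleanBranch C i₁ b → T.CleanBranch C i₂ b → False :=
    fun b i₁ i₂ i₃ hb h1 h2 h3 h12 h13 h23 c1 c2 =>
      hT.high_degree_contra hC hcard hL hb h1 h2 h3 h12 h13 h23 c1 c2
  -- An edge `uk` inside the cover, taken outermost, has an alternating branch at `k`. If that is an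
  -- even tail, the choice of `C` gives `u` two further neighbours, against `not_evenTail`.
  -- Otherwise `u`, being in `C`, may be attached to the better vertex `z`.
  have hclean : ∀ u v, T.CleanBranch C u v := by
    intro u v
    refine hac.dart_induction (P := fun u v => T.CleanBranch C u v) (fun u v ih => ?_) u v
    refine CleanBranch.mk (fun k hk hkv hCC => ?_) ih
    rcases ((ih k hk hkv).altBranch hac hC hL hbad k u hCC.2).evenTail_or_ratio_lt hac hk with
      ⟨z, hz⟩ | ⟨z, hz, hlt⟩
    · obtain ⟨v, v', hv, hvk, hv', hv'k, hvv'⟩ := htail z k u hz hk hCC.1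
      exact hT.not_evenTail hC hcard hk hCC.1 hz hv hvk hv' hv'k hvv'
    · refine absurd hlt (not_lt.2 (hT.ratio_le hk hz ⟨C, hC.swap (Or.inr hCC.1) ?_, hcard⟩))
      rintro rfl
      exact not_mem_branch hac hk hz
  have hstar : T.StarTree C := by
    refine ⟨hT.isTree, fun a b hab => ⟨fun ha hb => ?_, fun hb => (hC a b hab).resolve_right hb⟩,
      fun v hv => ?_, fun b hb => ?_⟩
    · exact (hclean a a).not_mem ha hab.symm hab.ne.symm hb
    · obtain ⟨w, hw, -⟩ := hL v hv v
      obtain ⟨w', hw', hne⟩ := hL v hv w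
      exact Finset.one_lt_card.2 ⟨w, mem_nb.2 hw, w', mem_nb.2 hw', hne.symm⟩
    · by_contra hlt
      obtain ⟨i₁, h1, i₂, h2, i₃, h3, h12, h13, h23⟩ := Finset.two_lt_card.1 (not_le.1 hlt)
      rw [mem_nb] at h1 h2 h3
      exact hbad b i₁ i₂ i₃ hb h1.symm h2.symm h3.symm h12 h13 h23 (hclean _ _) (hclean _ _)
  -- A spare place in the cover could be given to a leaf `l`, which then may be attached anywhere;
  -- some vertex is better than its neighbour `j`. The even-tail alternative would put `l` nearer to
  -- `r` than `j`.
  refine ⟨C, le_antisymm hcard (not_lt.1 fun hlt => ?_), hstar⟩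
  obtain ⟨i, hi⟩ : C.Nonempty := by
    obtain ⟨w, hw⟩ : (T.nb r).Nonempty := Finset.card_pos.1 (by omega)
    rcases hC r w (mem_nb.1 hw) with h | h
    · exact ⟨r, h⟩
    · exact ⟨w, h⟩
  obtain ⟨j, l, hj, hl, hlj, hleaf, -⟩ := exists_leaf_in_branch hac hC hL i i hi (hclean i i)
  rcases ((hclean j l).altBranch hac hC hL hbad j l hj).evenTail_or_ratio_lt hac hlj.symm with
    ⟨z, hz⟩ | ⟨z, hz, hlt'⟩
  · have h1 := hz.dist_lt hT.isTree hr
    have hlr : l ≠ r := by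
      rintro rfl
      have : T.nb l ⊆ {j} := fun w hw => by simpa using hleaf w (mem_nb.1 hw)
      have := Finset.card_le_card this
      rw [Finset.card_singleton] at this
      omega
    obtain ⟨w, hw, hd⟩ := hT.isTree.connected.exists_adj_dist hlr
    obtain rfl := hleaf w hw
    omega
  · refine absurd hlt' (not_lt.2 (hT.ratio_le hlj.symm hz ⟨insert l C, (hC.mono
      (Finset.subset_insert _ _)).swap (Or.inr (Finset.mem_insert_self _ _)) ?_,
      (Finset.card_insert_le _ _).trans hlt⟩))
    rintro rfl
    exact not_mem_branch hac hlj.symm hz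

end MinimizersAreStarTrees

/-! ### The degrees of the centers of a minimizer. -/

section Balance

/-- `r` is to bound every factor at a center when all centers have degree at least `d`. The third
inequality makes this bound reproduce itself under the recursion. The last one says that `d + 1`
factors at most `r` have a smaller product than `d` factors at least 1/2. -/
lemma exists_balance_bound {d : ℕ} (hd : 2 ≤ d) : ∃ r : ℝ, 1 / 2 ≤ r ∧ r < 1 ∧
    1 + r ^ (d - 1) ≤ r * (2 + r ^ (d - 1)) ∧ r ^ (d + 1) < (1 / 2) ^ d := by
  obtain rfl | rfl | rfl | h5 : d = 2 ∨ d = 3 ∨ d = 4 ∨ 5 ≤ d := by omega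
  · exact ⟨5 / 8, by norm_num, by norm_num, by norm_num, by norm_num⟩
  · exact ⟨29 / 50, by norm_num, by norm_num, by norm_num, by norm_num⟩
  · exact ⟨11 / 20, by norm_num, by norm_num, by norm_num, by norm_num⟩
  have hd0 : (0 : ℝ) < d + 1 := by positivity
  -- With r = (1+e)/2 the last inequality becomes (1+e)^(d+1) < 2. Bernoulli gives (1-e)^(d+1) ≥ 1/2
  -- for this `e`, and (1+e)(1-e) < 1.
  set e : ℝ := 1 / (2 * (d + 1)) with he
  have he0 : 0 < e := by positivity
  have hde : ((d + 1 : ℕ) : ℝ) * e = 1 / 2 := by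
    rw [he]; push_cast; field_simp
  have he1 : e ≤ 1 / 12 := by
    rw [he]
    refine one_div_le_one_div_of_le (by norm_num) ?_
    have : (5 : ℝ) ≤ d := by exact_mod_cast h5
    linarith
  have hpow : (1 + e) ^ (d + 1) < 2 := by
    have h1 : 1 / 2 ≤ (1 - e) ^ (d + 1) := by
      have := one_add_mul_le_pow (a := -e) (by linarith) (d + 1)
      rw [mul_neg, hde] at this
      calc (1 : ℝ) / 2 = 1 + -(1 / 2) := by norm_num
        _ ≤ _ := by rw [sub_eq_add_neg]; exact this
    have h2 : (1 + e) ^ (d + 1) * (1 - e) ^ (d + 1) < 1 := by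
      rw [← mul_pow]
      refine pow_lt_one₀ ?_ ?_ (by omega) <;> nlinarith
    have h3 : 0 < (1 + e) ^ (d + 1) := by positivity
    nlinarith
  -- This suffices for the recursion inequality. It rests on 4(d+1) ≤ 2^d, which fails at d = 4;
  -- hence the explicit values for small `d`.
  have hy : ((1 + e) / 2) ^ (d - 1) ≤ 2 * e := by
    have h1 : (1 + e) ^ (d - 1) ≤ 2 :=
      (pow_le_pow_right₀ (by linarith) (by omega)).trans hpow.le
    have h2 : 4 * (d + 1) ≤ 2 ^ d := by
      induction d, h5 using Nat.le_induction with
      | base => norm_num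
      | succ k hk ih => clear * - hk; induction k, hk using Nat.le_induction with
        | base => norm_num
        | succ k hk ih => rw [pow_succ]; omega
    have h3 : (2 : ℝ) ^ d = 2 * 2 ^ (d - 1) := by
      rw [← pow_succ']; congr 1; omega
    have h4 : (4 : ℝ) * (d + 1) ≤ 2 * 2 ^ (d - 1) := by
      rw [← h3]; exact_mod_cast h2
    rw [div_pow, div_le_iff₀ (by positivity)]
    have h5 : e * (2 * (d + 1)) = 1 := by rw [he]; field_simp
    nlinarith
  refine ⟨(1 + e) / 2, by linarith, by linarith, ?_, ?_⟩
  · have h0 : 0 < ((1 + e) / 2) ^ (d - 1) := by positivity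
    nlinarith
  · rw [div_pow, one_div, inv_pow, div_lt_iff₀ (by positivity), pow_succ 2, ← mul_assoc,
      inv_mul_cancel₀ (by positivity), one_mul]
    exact hpow

variable {V : Type*} [Fintype V] {T : SimpleGraph V} {C : Finset V}

lemma prod_factor_le {r : ℝ} (hr : r < 1) {s : Finset V} {u : V} {d : ℕ} (hs : d ≤ s.card)
    (h : ∀ k ∈ s, 1 / (1 + T.msg k u) ≤ r) (hr0 : 0 ≤ r) :
    ∏ k ∈ s, 1 / (1 + T.msg k u) ≤ r ^ d := by
  refine (Finset.prod_le_prod (fun _ _ => (factor_pos _ _).le) h).trans ?_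
  rw [Finset.prod_const]
  exact pow_le_pow_of_le_one hr0 hr.le hs

lemma half_pow_le_prod_factor (s : Finset V) (u : V) :
    (1 / 2) ^ s.card ≤ ∏ k ∈ s, 1 / (1 + T.msg k u) := by
  rw [← Finset.prod_const]
  exact Finset.prod_le_prod (fun _ _ => by norm_num) fun _ _ => half_le_factor _ _

lemma StarTree.not_mem_of_adj (h : T.StarTree C) {a b : V} (hab : T.Adj a b) (ha : a ∈ C) :
    b ∉ C := (h.bip a b hab).1 ha

lemma StarTree.mem_of_adj (h : T.StarTree C) {a b : V} (hab : T.Adj a b) (ha : a ∉ C) :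
    b ∈ C := (h.bip b a hab.symm).2 ha

lemma StarTree.eq_or_eq (h : T.StarTree C) {b u v : V} (hb : b ∉ C) (hu : T.Adj b u)
    (hv : T.Adj b v) (huv : u ≠ v) (w : V) (hw : T.Adj b w) : w = u ∨ w = v := by
  by_contra hcon
  push Not at hcon
  have := h.le_two b hb
  have h3 : 2 < (T.nb b).card := Finset.two_lt_card.2 ⟨u, mem_nb.2 hu, v, mem_nb.2 hv, w,
    mem_nb.2 hw, huv, hcon.1.symm, hcon.2.symm⟩
  omega

/-- Both bounds are proved together: `d - 1` factors at most `r` give the bound on the message x,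
and two edges further the factor (1+x)/(2+x) is at most `r` by `hrd`. -/
lemma StarTree.msg_bounds (h : T.StarTree C) {d : ℕ} (hd : ∀ v ∈ C, d ≤ (T.nb v).card)
    {r : ℝ} (hr : 1 / 2 ≤ r) (hr1 : r < 1) (hrd : 1 + r ^ (d - 1) ≤ r * (2 + r ^ (d - 1)))
    (g k : V) (hg : g ∈ C) : T.msg g k ≤ r ^ (d - 1) ∧
      ∀ a, T.Adj a g → a ≠ k → 1 / (1 + T.msg a g) ≤ r := by
  have hac := h.isTree.isAcyclic
  revert hg
  refine hac.dart_induction₂ (P := fun g k => g ∈ C → T.msg g k ≤ r ^ (d - 1) ∧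
    ∀ a, T.Adj a g → a ≠ k → 1 / (1 + T.msg a g) ≤ r) (fun g k ih hg => ?_) g k
  have key : ∀ a, T.Adj a g → a ≠ k → 1 / (1 + T.msg a g) ≤ r := by
    intro a ha hak
    have haC := h.not_mem_of_adj ha.symm hg
    by_cases hl : ∀ w, T.Adj a w → w = g
    · rw [msg_of_leaf hac hl]
      linarith
    · push Not at hl
      obtain ⟨g', h1, h2⟩ := hl
      rw [msg_of_unique hac h1 h2 (h.eq_or_eq haC ha h1 h2.symm)]
      have hx := (ih a ha hak g' h1.symm h2 (h.mem_of_adj h1 haC)).1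
      have hx0 := msg_pos (G := T) g' a
      have e : 1 / (1 + 1 / (1 + T.msg g' a)) = (1 + T.msg g' a) / (2 + T.msg g' a) := by
        field_simp; ring
      rw [e, div_le_iff₀ (by positivity)]
      nlinarith
  refine ⟨?_, key⟩
  rw [msg_eq_prod hac]
  refine prod_factor_le hr1 ?_ (fun a ha => ?_) (by linarith)
  · have := Finset.pred_card_le_card_erase (s := T.nb g) (a := k)
    have := hd g hg
    omega
  · rw [Finset.mem_erase, mem_nb] at ha
    exact key a ha.2.symm ha.1

/-- The degrees of two centers of a minimizer differ by at most one. -/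
theorem IsMinimizer.balanced {c : ℕ} (hT : T.IsMinimizer c) (hC : T.StarTree C)
    (hcard : C.card ≤ c) {i j : V} (hi : i ∈ C) (hj : j ∈ C) :
    (T.nb i).card ≤ (T.nb j).card + 1 := by
  have hac := hC.isTree.isAcyclic
  obtain ⟨j₀, hj₀, hmin⟩ := Finset.exists_min_image C (fun v => (T.nb v).card) ⟨j, hj⟩
  refine le_trans ?_ (Nat.add_le_add_right (hmin j hj) 1)
  by_contra hlt
  push Not at hlt
  have hij : i ≠ j₀ := by rintro rfl; omega
  obtain ⟨r, hr, hr1, hrd, hrlt⟩ := exists_balance_bound (hC.two_le j₀ hj₀)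
  -- `b` is a neighbour of `i` off the path to `j₀`, so its branch can be moved from `i` to `j₀`.
  obtain ⟨k, hk, hjk⟩ := hC.isTree.exists_adj_mem_branch hij
  obtain ⟨b, hb, hbk⟩ := Finset.exists_mem_ne (s := T.nb i) (by omega) k
  rw [mem_nb] at hb
  have hjb : j₀ ∈ T.branch i b := branch_subset_of_adj hac hk hbk.symm hjk
  have hle := hT.ratio_le hb hjb ⟨C, hC.cover.swap (Or.inl hj₀) ?_, hcard⟩
  swap
  · rintro rfl
    exact not_mem_branch hac hb hjb
  change _ ≤ T.msg i b at hle
  -- The degree of `i` exceeds that of `j₀` by at least 2, so this many factors remain without `b`.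
  have h1 : T.msg i b ≤ r ^ ((T.nb j₀).card + 1) := by
    rw [msg_eq_prod hac]
    refine prod_factor_le hr1 ?_ (fun a ha => ?_) (by linarith)
    · rw [Finset.card_erase_of_mem (mem_nb.2 hb)]
      omega
    · rw [Finset.mem_erase, mem_nb] at ha
      exact (hC.msg_bounds hmin hr hr1 hrd i b hi).2 a ha.2.symm ha.1
  have h2 : (1 / 2 : ℝ) ^ (T.nb j₀).card ≤ (T.cut i b).ratio j₀ := by
    rw [ratio_eq_prod (hac.cut i b)]
    have : (T.cut i b).nb j₀ = T.nb j₀ := by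
      ext w
      rw [mem_nb, mem_nb, cut_adj]
      refine ⟨fun h => h.1, fun h => ⟨h, fun h' => hij h'.1.symm, ?_⟩⟩
      rintro ⟨rfl, -⟩
      exact hC.not_mem_of_adj hb hi hj₀
    rw [this]
    exact half_pow_le_prod_factor _ _
  linarith

end Balance

/-! ### Exchanging a branch with a leaf. -/

section Exchange

variable {V : Type*} [Fintype V] {G T : SimpleGraph V} {C : Finset V}

lemma cnt_link_link {i x j l : V} (hix : i ≠ x) (hjl : j ≠ l) (hl : ∀ w, ¬ G.Adj l w)
    (hlx : l ≠ x) (hli : l ≠ i) (hxi : ¬ G.Reachable x i) (hxj : ¬ G.Reachable x j) :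
    ((G.link i x).link j l).cnt ∅ = (1 - G.pr {i} * G.pr {x} - G.pr {j} / 2 +
      G.pr {x} * G.pr {i, j} / 2) * G.cnt ∅ := by
  have nl : ∀ x, l ≠ x → ¬ G.Reachable l x := fun x => not_reachable_of_isolated hl
  have p1 : G.pr {i, x} = G.pr {i} * G.pr {x} :=
    pr_insert (by simpa using fun h => hxi (Reachable.symm h))
  have p2 : G.pr {j, l} = G.pr {j} * G.pr {l} :=
    pr_insert (by simpa using fun h => nl j hjl.symm (Reachable.symm h))
  have p3 : G.pr {l, x, i, j} = G.pr {l} * (G.pr {x} * G.pr {i, j}) := by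
    rw [pr_insert, pr_insert]
    · simpa using ⟨hxi, hxj⟩
    · simpa using ⟨nl x hlx, nl i hli, nl j hjl.symm⟩
  rw [cnt_link hjl, cnt_link hix, cnt_link hix]
  simp only [insert_empty_eq]
  have e : (insert i (insert x {j, l}) : Finset V) = {l, x, i, j} := by
    ext a; simp only [Finset.mem_insert, Finset.mem_singleton]; tauto
  rw [e, cnt_eq_pr_mul {i, x}, cnt_eq_pr_mul {j, l}, cnt_eq_pr_mul {l, x, i, j}, p1, p2, p3,
    pr_singleton_of_isolated hl]
  ring

/-- Exchanging the branch of `x` at `i` with a leaf `l` at `j` shows that, once both are removed,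
the vertex `j` is at least as probable as `i` in a minimizer. -/
lemma IsMinimizer.ratio_le_of_exchange {c : ℕ} (hT : T.IsMinimizer c) (hC : T.Cover C)
    (hcard : C.card ≤ c) {i x j l : V} (hi : i ∈ C) (hj : j ∈ C) (hij : i ≠ j) (hix : T.Adj i x)
    (hxn : ∃ w, T.Adj x w ∧ w ≠ i) (hjx : j ∈ T.branch i x) (hjl : T.Adj j l)
    (hleaf : ∀ w, T.Adj l w → w = j) (hlx : l ≠ x) (hli : l ≠ i) :
    ((T.cut i x).cut j l).ratio i ≤ ((T.cut i x).cut j l).ratio j := by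
  have hac := hT.isTree.isAcyclic
  set G := (T.cut i x).cut j l with hG
  have hjx' : j ≠ x := by rintro rfl; exact not_mem_branch hac hix hjx
  have hGl : ∀ w, ¬ G.Adj l w := by
    intro w hw
    rw [hG, cut_adj, cut_adj] at hw
    exact hw.2.2 ⟨rfl, hleaf w hw.1.1⟩
  have hGle : G ≤ T.cut i x := cut_le _ _
  have hxj : ¬ G.Reachable x j := fun h => isAcyclic_iff_forall_adj_isBridge.1 hac hix
    (Reachable.trans hjx (h.mono hGle).symm)
  have hxi : ¬ G.Reachable x i := fun h => isAcyclic_iff_forall_adj_isBridge.1 hac hix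
    (h.mono hGle).symm
  have hjl' : (T.cut i x).Adj j l := by
    rw [cut_adj]; exact ⟨hjl, fun h => hlx h.2, fun h => hjx' h.1⟩
  have eT : T = (G.link i x).link j l := by
    rw [hG, ← link_cut_comm hix.ne (fun h => hij h.1) (fun h => hli h.1.symm), link_cut hix,
      link_cut hjl]
  have hT1 := hT.isTree.swap hix hjx (self_mem_branch x i)
  have hjl1 : ((T.cut i x).link j x).Adj j l := le_link _ _ hjl'
  have hi1 : i ∈ ((T.cut i x).link j x).branch j l := by
    refine mem_branch_of_leaf hT1 hjl1 (fun w hw => ?_) hli.symm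
    rcases (link_adj hjx').1 hw with h | h | h
    · exact hleaf w (cut_adj.1 h).1
    · exact (hjl.ne h.1.symm).elim
    · exact (hlx h.1).elim
  have hT2 := hT1.swap hjl1 hi1 (self_mem_branch l j)
  have hle := hT.le _ hT2 ⟨C, (hC.swap (Or.inl hj) hjx').swap (Or.inl hi) hli.symm, hcard⟩
  rw [link_cut_comm hjx' (fun h => hlx h.2.symm) (fun h => hjl.ne h.1), ← hG,
    cnt_link_link hjx' hli.symm hGl hlx hjl.ne.symm hxj hxi, eT,
    cnt_link_link hix.ne hjl.ne hGl hlx hli hxi hxj, Finset.pair_comm j i] at hle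
  have hle := le_of_mul_le_mul_right hle cnt_empty_pos
  -- The two counts differ by a multiple of (P(i) - P(j))(1/2 - P(x)), the correlation term being
  -- symmetric. A further neighbour of `x` makes the second factor positive.
  have hx2 : G.pr {x} < 1 / 2 := by
    obtain ⟨w, hw, hwi⟩ := hxn
    refine pr_singleton_lt_half (w := w) ?_
    rw [hG, cut_adj, cut_adj]
    exact ⟨⟨hw, fun h => hix.ne h.1.symm, fun h => hwi h.2⟩, fun h => hjx' h.1.symm,
      fun h => hlx h.1.symm⟩
  rw [ratio_le_ratio_iff]
  by_contra hlt
  push Not at hlt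
  nlinarith

end Exchange

/-! ### Caterpillar branches and the number of nonleaf neighbours of a center. -/

section Chains

variable {V : Type*} [Fintype V] {G T : SimpleGraph V} {C : Finset V}

/-- The branch of `g` at `m` is a caterpillar: a path of centers ending at `j`, every second vertex
of it having `N` leaves. -/
inductive LeafChain (G : SimpleGraph V) (N : ℕ) (j : V) : V → V → Prop
  | last {m : V} (hm : G.Adj j m)
      (leaves : ∀ w, G.Adj j w → w ≠ m → ∀ x, G.Adj w x → x = j)
      (card : (G.nb j).card = N + 1) : LeafChain G N j j m
  | step {g m m' g' : V} (hm : G.Adj g m) (hm' : G.Adj g m') (hne : m' ≠ m) (hg' : G.Adj m' g')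
      (hgg' : g' ≠ g) (huniq : ∀ w, G.Adj m' w → w = g ∨ w = g')
      (leaves : ∀ w, G.Adj g w → w ≠ m → w ≠ m' → ∀ x, G.Adj w x → x = g)
      (card : (G.nb g).card = N + 2) (ih : LeafChain G N j g' m') : LeafChain G N j g m

lemma msg_of_leaves (hG : G.IsAcyclic) {g m : V} {N : ℕ} (hm : G.Adj g m)
    (leaves : ∀ w, G.Adj g w → w ≠ m → ∀ x, G.Adj w x → x = g)
    (card : (G.nb g).card = N + 1) : G.msg g m = (1 / 2) ^ N := by
  have h : ((G.nb g).erase m).card = N := by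
    rw [Finset.card_erase_of_mem (mem_nb.2 hm)]; omega
  rw [msg_eq_prod hG, ← h, ← Finset.prod_const]
  refine Finset.prod_congr rfl fun k hk => ?_
  rw [Finset.mem_erase, mem_nb] at hk
  rw [msg_of_leaf hG (leaves k hk.2 hk.1)]
  norm_num

lemma msg_of_leaves_of_ne (hG : G.IsAcyclic) {g m m' : V} {N : ℕ} (hm : G.Adj g m)
    (hm' : G.Adj g m') (hne : m' ≠ m)
    (leaves : ∀ w, G.Adj g w → w ≠ m → w ≠ m' → ∀ x, G.Adj w x → x = g)
    (card : (G.nb g).card = N + 2) : G.msg g m = (1 / 2) ^ N * (1 / (1 + G.msg m' g)) := by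
  have hmem : m' ∈ (G.nb g).erase m := Finset.mem_erase.2 ⟨hne, mem_nb.2 hm'⟩
  have h : (((G.nb g).erase m).erase m').card = N := by
    rw [Finset.card_erase_of_mem hmem, Finset.card_erase_of_mem (mem_nb.2 hm)]; omega
  rw [msg_eq_prod hG, ← Finset.mul_prod_erase _ _ hmem, mul_comm, ← h, ← Finset.prod_const]
  congr 1
  refine Finset.prod_congr rfl fun k hk => ?_
  rw [Finset.mem_erase, Finset.mem_erase, mem_nb] at hk
  rw [msg_of_leaf hG (leaves k hk.2.2 hk.2.1 hk.1)]
  norm_num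

/-- The analogue of `EvenTail.ratio_eq`: the leaves at each center scale every `tailStep` by 2^(-N).
The message entering from `p` passes all `s + 1` centers, while the returning one starts at the last
center as 2^(-N) and passes `s` more. -/
lemma LeafChain.ratio_eq (hG : G.IsAcyclic) {N : ℕ} {j g m p : V} (h : G.LeafChain N j g m)
    (hp : G.Adj m p) (hpg : p ≠ g) (huniq : ∀ w, G.Adj m w → w = g ∨ w = p) :
    ∃ s : ℕ, G.ratio j = (fun r => (1 / 2) ^ N * tailStep r)^[s + 1] (G.msg p m) ∧
      G.msg g m = (fun r => (1 / 2) ^ N * tailStep r)^[s] ((1 / 2) ^ N) := by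
  induction h generalizing p with
  | @last m hm leaves card =>
    have h1 := msg_of_leaves hG hm leaves card
    refine ⟨0, ?_, h1⟩
    rw [ratio_eq_ratio_cut_mul hG hm, ← msg, h1, msg_of_unique hG hp hpg huniq]
    rfl
  | @step g m m' g' hm hm' hne hg' hgg' huniq' leaves card _ ih =>
    obtain ⟨s, h1, h2⟩ := ih hm'.symm hgg'.symm fun w hw => (huniq' w hw).symm
    refine ⟨s + 1, ?_, ?_⟩
    · rw [h1, msg_of_leaves_of_ne hG hm' hm hne.symm (fun w hw h h' => leaves w hw h' h) card,
        msg_of_unique hG hp hpg huniq, Function.iterate_succ_apply _ (s + 1)]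
      rfl
    · rw [msg_of_leaves_of_ne hG hm hm' hne leaves card, msg_of_unique hG hg' hgg' huniq', h2,
        Function.iterate_succ_apply']
      rfl

lemma tailStep_eq {r : ℝ} (hr : 0 < r) : tailStep r = (1 + r) / (2 + r) := by
  unfold tailStep; field_simp; ring

/-- `tailStep x` increases while `tailStep x / x` decreases. Hence, from `a` and `u`, the iterates
keep their order and their quotient stays at most `u / a`; a final step is strict. -/
lemma scaled_tailStep_lt {a u : ℝ} (ha : 0 < a) (hau : a < u) (s : ℕ) :
    (fun r => a * tailStep r)^[s + 1] u < u * tailStep ((fun r => a * tailStep r)^[s] a) := by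
  have mono : ∀ x y : ℝ, 0 < x → x < y → tailStep x < tailStep y ∧
      x * tailStep y < y * tailStep x := by
    intro x y hx hxy
    have hy := hx.trans hxy
    rw [tailStep_eq hx, tailStep_eq hy, mul_div_assoc', mul_div_assoc',
      div_lt_div_iff₀ (by positivity) (by positivity),
      div_lt_div_iff₀ (by positivity) (by positivity)]
    constructor <;> nlinarith [mul_pos hx hy]
  suffices H : 0 < (fun r => a * tailStep r)^[s] a ∧
      (fun r => a * tailStep r)^[s] a < (fun r => a * tailStep r)^[s] u ∧
      a * (fun r => a * tailStep r)^[s] u ≤ u * (fun r => a * tailStep r)^[s] a by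
    obtain ⟨h0, h1, h2⟩ := H
    rw [Function.iterate_succ_apply']
    set x := (fun r => a * tailStep r)^[s] a
    set y := (fun r => a * tailStep r)^[s] u
    obtain ⟨-, h3⟩ := mono x y h0 h1
    have hx := tailStep_pos h0
    have h4 : a * (x * tailStep y) < a * (y * tailStep x) := mul_lt_mul_of_pos_left h3 ha
    have h5 : a * y * tailStep x ≤ u * x * tailStep x := mul_le_mul_of_nonneg_right h2 hx.le
    have h6 : x * (a * tailStep y) < x * (u * tailStep x) := by linarith
    exact lt_of_mul_lt_mul_left h6 h0.le
  induction s with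
  | zero => exact ⟨ha, hau, by simp [mul_comm]⟩
  | succ s ih =>
    obtain ⟨h0, h1, h2⟩ := ih
    rw [Function.iterate_succ_apply', Function.iterate_succ_apply']
    set x := (fun r => a * tailStep r)^[s] a
    set y := (fun r => a * tailStep r)^[s] u
    obtain ⟨h3, h4⟩ := mono x y h0 h1
    have hx := tailStep_pos h0
    refine ⟨mul_pos ha hx, mul_lt_mul_of_pos_left h3 ha, ?_⟩
    have h5 : a * y * tailStep x ≤ u * x * tailStep x := mul_le_mul_of_nonneg_right h2 hx.le
    have h6 : a * (x * tailStep y) ≤ a * (y * tailStep x) := mul_le_mul_of_nonneg_left h4.le ha.le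
    have h7 : x * (a * tailStep y) ≤ x * (u * tailStep x) := by linarith
    have h8 := le_of_mul_le_mul_left h7 h0
    nlinarith

/-- The branch of `g` at `m` is a caterpillar of centers of degree `N + 2`, and `l` is a leaf
at its last center `j`. -/
def IsChainEnd (T : SimpleGraph V) (N : ℕ) (g m j l : V) : Prop :=
  T.Adj j l ∧ (∀ w, T.Adj l w → w = j) ∧ j ∈ T.branch g m ∧ l ∈ T.branch g m ∧
    ∀ G : SimpleGraph V, (∀ x ∈ T.branch g m, ∀ y, G.Adj x y ↔ (T.cut j l).Adj x y) →
      G.LeafChain N j g m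

/-- Once the branch of `x` and the leaf `l` are removed, `hu` says that `i` sends the chain a
message larger than 2^(-N). By `scaled_tailStep_lt` this makes `i` strictly more probable than `j`,
contrary to the exchange inequality. -/
lemma IsMinimizer.not_isChainEnd {c : ℕ} (hT : T.IsMinimizer c) (hC : T.StarTree C)
    (hcard : C.card ≤ c) {N : ℕ} {i m g x j l : V} (hi : i ∈ C) (hj : j ∈ C) (hmi : T.Adj m i)
    (hgm : T.Adj g m) (hgi : g ≠ i) (hxi : T.Adj x i) (hxm : x ≠ m)
    (hxn : ∃ w, T.Adj x w ∧ w ≠ i) (hend : T.IsChainEnd N g m j l)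
    (hu : (1 / 2) ^ N < ∏ k ∈ ((T.nb i).erase x).erase m, 1 / (1 + T.msg k i)) : False := by
  obtain ⟨hjl, hleaf, hjg, hlg, hchain⟩ := hend
  have hac := hT.isTree.isAcyclic
  have hm := hC.not_mem_of_adj hmi.symm hi
  have hsub : T.branch g m ⊆ T.branch m i := branch_subset_of_adj hac hgm hgi
  have hsub' : T.branch m i ⊆ T.branch i x := branch_subset_of_adj hac hmi hxm.symm
  have hin : i ∉ T.branch m i := not_mem_branch hac hmi
  have hxn' : x ∉ T.branch m i := fun h =>
    Set.disjoint_left.1 (branch_disjoint hac hmi hxi hxm.symm) h (self_mem_branch _ _)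
  have hij : i ≠ j := by rintro rfl; exact hin (hsub hjg)
  have hlx : l ≠ x := by rintro rfl; exact hxn' (hsub hlg)
  have hli : l ≠ i := by rintro rfl; exact hin (hsub hlg)
  have hjx : j ≠ x := by rintro rfl; exact hxn' (hsub hjg)
  have hlm : l ≠ m := by rintro rfl; exact not_mem_branch hac hgm hlg
  have hjm : j ≠ m := by rintro rfl; exact hm hj
  have hle := hT.ratio_le_of_exchange hC.cover hcard hi hj hij hxi.symm hxn (hsub' (hsub hjg)) hjl
    hleaf hlx hli
  set G := (T.cut i x).cut j l with hG
  have hGac : G.IsAcyclic := (hac.cut i x).cut j l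
  have hGadj : ∀ a b, G.Adj a b ↔ (T.Adj a b ∧ ¬(a = i ∧ b = x) ∧ ¬(a = x ∧ b = i)) ∧
      ¬(a = j ∧ b = l) ∧ ¬(a = l ∧ b = j) := fun a b => by rw [hG, cut_adj, cut_adj]
  have hGmi : G.Adj m i := (hGadj m i).2 ⟨⟨hmi, fun h => hmi.ne h.1, fun h => hxm h.1.symm⟩,
    fun h => hjm h.1.symm, fun h => hlm h.1.symm⟩
  have hGgm : G.Adj g m := (hGadj g m).2 ⟨⟨hgm, fun h => hgi h.1, fun h => hmi.ne h.2⟩,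
    fun h => hlm h.2.symm, fun h => hjm h.2.symm⟩
  have huniqT := hC.eq_or_eq hm hgm.symm hmi hgi
  have huniq : ∀ w, G.Adj m w → w = g ∨ w = i := fun w hw => huniqT w ((hGadj m w).1 hw).1.1
  have hlc : G.LeafChain N j g m := by
    refine hchain G fun a ha b => ?_
    have h1 : a ≠ i := by rintro rfl; exact hin (hsub ha)
    have h2 : a ≠ x := by rintro rfl; exact hxn' (hsub ha)
    rw [hGadj, cut_adj]
    tauto
  obtain ⟨s, h1, h2⟩ := hlc.ratio_eq hGac hGmi hgi.symm huniq
  have h3 := ratio_eq_ratio_cut_mul hGac hGmi.symm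
  rw [← msg, msg_of_unique hGac hGgm.symm hgi fun w hw => (huniq w hw).symm, h2] at h3
  have h4 : G.msg i m = ∏ k ∈ ((T.nb i).erase x).erase m, 1 / (1 + T.msg k i) := by
    rw [msg_eq_prod hGac]
    refine Finset.prod_congr ?_ fun k hk => ?_
    · ext w
      simp only [Finset.mem_erase, mem_nb, hGadj]
      have := hxi.ne
      tauto
    · rw [Finset.mem_erase, Finset.mem_erase, mem_nb] at hk
      have hkm := branch_disjoint hac hk.2.2.symm hmi hk.1
      have hkx := branch_disjoint hac hk.2.2.symm hxi hk.2.1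
      suffices h : T.msg k i = G.msg k i by rw [h]
      refine msg_congr' fun a ha b => ?_
      have e1 : a ≠ i := by rintro rfl; exact not_mem_branch hac hk.2.2.symm ha
      have e2 : a ≠ x := by rintro rfl; exact Set.disjoint_left.1 hkx ha (self_mem_branch _ _)
      have e3 : a ≠ j := by rintro rfl; exact Set.disjoint_left.1 hkm ha (hsub hjg)
      have e4 : a ≠ l := by rintro rfl; exact Set.disjoint_left.1 hkm ha (hsub hlg)
      rw [hGadj]
      tauto
  rw [← h4] at hu
  have h5 := scaled_tailStep_lt (by positivity) hu s
  rw [← h1] at h5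
  exact absurd hle (not_le.2 (h3 ▸ h5))

/-- A vertex is a nonleaf neighbour of `i`. -/
def Inner (T : SimpleGraph V) (i m : V) : Prop := T.Adj m i ∧ ∃ w, T.Adj m w ∧ w ≠ i

/-- Apart from `x` and `m` at most `N - 1` factors remain at `i`, each at least 1/2. -/
lemma IsMinimizer.not_isChainEnd_of_card_le {c : ℕ} (hT : T.IsMinimizer c) (hC : T.StarTree C)
    (hcard : C.card ≤ c) {N : ℕ} {i m g x j l : V} (hi : i ∈ C) (hj : j ∈ C) (hm : T.Adj m i)
    (hgm : T.Adj g m) (hgi : g ≠ i) (hx : T.Inner i x) (hxm : x ≠ m)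
    (hend : T.IsChainEnd N g m j l) (hle : (T.nb i).card ≤ N + 1) : False := by
  have hmem : m ∈ (T.nb i).erase x := Finset.mem_erase.2 ⟨hxm.symm, mem_nb.2 hm.symm⟩
  have h1 := Finset.card_erase_of_mem hmem
  have h2 := Finset.card_erase_of_mem (mem_nb.2 hx.1.symm)
  have h3 := Finset.card_pos.2 ⟨m, hmem⟩
  refine hT.not_isChainEnd hC hcard hi hj hm hgm hgi hx.1 hxm hx.2 hend
    (lt_of_lt_of_le ?_ (half_pow_le_prod_factor _ _))
  exact pow_lt_pow_right_of_lt_one₀ (by norm_num) (by norm_num) (by omega)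

/-- Now up to `N` factors remain, but the one of the nonleaf `y` is strictly larger than 1/2. -/
lemma IsMinimizer.not_isChainEnd_of_inner {c : ℕ} (hT : T.IsMinimizer c) (hC : T.StarTree C)
    (hcard : C.card ≤ c) {N : ℕ} {i m g x y j l : V} (hi : i ∈ C) (hj : j ∈ C) (hm : T.Adj m i)
    (hgm : T.Adj g m) (hgi : g ≠ i) (hx : T.Inner i x) (hxm : x ≠ m)
    (hend : T.IsChainEnd N g m j l) (hle : (T.nb i).card ≤ N + 2) (hy : T.Inner i y) (hyx : y ≠ x)
    (hym : y ≠ m) : False := by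
  have hmem : m ∈ (T.nb i).erase x := Finset.mem_erase.2 ⟨hxm.symm, mem_nb.2 hm.symm⟩
  have hy' : y ∈ ((T.nb i).erase x).erase m :=
    Finset.mem_erase.2 ⟨hym, Finset.mem_erase.2 ⟨hyx, mem_nb.2 hy.1.symm⟩⟩
  have h1 := Finset.card_erase_of_mem hmem
  have h2 := Finset.card_erase_of_mem (mem_nb.2 hx.1.symm)
  have h3 := Finset.card_erase_add_one hy'
  refine hT.not_isChainEnd hC hcard hi hj hm hgm hgi hx.1 hxm hx.2 hend ?_
  obtain ⟨w, hw, hwi⟩ := hy.2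
  calc (1 / 2 : ℝ) ^ N ≤ (1 / 2) ^ ((((T.nb i).erase x).erase m).erase y).card * (1 / 2) := by
        rw [← pow_succ, h3]
        exact pow_le_pow_of_le_one (by norm_num) (by norm_num) (by omega)
    _ ≤ (∏ k ∈ (((T.nb i).erase x).erase m).erase y, 1 / (1 + T.msg k i)) * (1 / 2) :=
        mul_le_mul_of_nonneg_right (half_pow_le_prod_factor _ _) (by norm_num)
    _ < (∏ k ∈ (((T.nb i).erase x).erase m).erase y, 1 / (1 + T.msg k i)) *
        (1 / (1 + T.msg y i)) := by
        refine mul_lt_mul_of_pos_left (half_lt_factor hw hwi)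
          (Finset.prod_pos fun _ _ => factor_pos _ _)
    _ = _ := Finset.prod_erase_mul _ _ hy'

/-- In a minimizer, every branch all of whose centers have maximal degree is a caterpillar. -/
lemma IsMinimizer.exists_isChainEnd {c : ℕ} (hT : T.IsMinimizer c) (hC : T.StarTree C)
    (hcard : C.card ≤ c) {N : ℕ} (g m : V) (hg : g ∈ C) (hgm : T.Adj m g)
    (hm : ∃ w, T.Adj m w ∧ w ≠ g)
    (hN : ∀ v ∈ C, v ∈ T.branch g m → (T.nb v).card = N + 2) :
    ∃ j ∈ C, ∃ l, T.IsChainEnd N g m j l := by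
  have hac := hT.isTree.isAcyclic
  revert hg hgm hm hN
  refine hac.dart_induction₂ (P := fun g m => g ∈ C → T.Adj m g → (∃ w, T.Adj m w ∧ w ≠ g) →
    (∀ v ∈ C, v ∈ T.branch g m → (T.nb v).card = N + 2) → ∃ j ∈ C, ∃ l, T.IsChainEnd N g m j l)
    (fun g m ih hg hgm hm hN => ?_) g m
  have hgN := hN g hg (self_mem_branch _ _)
  have hmem : ∀ w, T.Adj g w → w ≠ m → w ∈ T.branch g m := fun w hw hwm =>
    branch_step (self_mem_branch _ _) hw fun h => hwm h.2
  by_cases hin : ∃ m', T.Inner g m' ∧ m' ≠ m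
  · obtain ⟨m', ⟨hm'g, g', hg', hgg'⟩, hm'm⟩ := hin
    have hsub1 : T.branch m' g ⊆ T.branch g m := branch_subset_of_adj hac hm'g hm'm
    have hsub : T.branch g' m' ⊆ T.branch m' g := branch_subset_of_adj hac hg'.symm hgg'
    have hm'C := hC.not_mem_of_adj hm'g.symm hg
    obtain ⟨j, hj, l, hend⟩ := ih m' hm'g hm'm g' hg'.symm hgg' (hC.mem_of_adj hg' hm'C)
      hg' ⟨g, hm'g, hgg'.symm⟩ fun v hv hvb => hN v hv (hsub1 (hsub hvb))
    -- A nonleaf `w` besides `m` and `m'` could be exchanged with the end of the chain found behind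
    -- `m'`; `m` serves as the additional nonleaf neighbour.
    have hleaves : ∀ w, T.Adj g w → w ≠ m → w ≠ m' → ∀ x, T.Adj w x → x = g := by
      intro w hw hwm hwm' x hx
      by_contra hxg
      exact hT.not_isChainEnd_of_inner hC hcard hg hj hm'g hg'.symm hgg' ⟨hw.symm, x, hx, hxg⟩
        hwm' hend hgN.le ⟨hgm, hm⟩ hwm.symm hm'm.symm
    refine ⟨j, hj, l, ?_⟩
    obtain ⟨hjl, hleaf, hjg, hlg, hchain⟩ := hend
    refine ⟨hjl, hleaf, hsub1 (hsub hjg), hsub1 (hsub hlg), fun G hG => ?_⟩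
    have hgn := not_mem_branch hac hm'g
    have hgj : g ≠ j := by rintro rfl; exact hgn (hsub hjg)
    have hgl : g ≠ l := by rintro rfl; exact hgn (hsub hlg)
    have hm'j : m' ≠ j := by rintro rfl; exact hm'C hj
    have hm'l : m' ≠ l := by rintro rfl; exact not_mem_branch hac hg'.symm hlg
    have hGg : ∀ y, G.Adj g y ↔ T.Adj g y := fun y => by
      rw [hG g (self_mem_branch _ _), cut_adj]; tauto
    have hGm' : ∀ y, G.Adj m' y ↔ T.Adj m' y := fun y => by
      rw [hG m' (hsub1 (self_mem_branch _ _)), cut_adj]; tauto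
    refine LeafChain.step ((hGg m).2 hgm.symm) ((hGg m').2 hm'g.symm) hm'm ((hGm' g').2 hg') hgg'
      (fun w hw => hC.eq_or_eq hm'C hm'g hg' hgg'.symm w ((hGm' w).1 hw))
      (fun w hw hwm hwm' x hx => ?_) ?_ (hchain G fun x hx y => hG x (hsub1 (hsub hx)) y)
    · have hw' := (hGg w).1 hw
      exact hleaves w hw' hwm hwm' x (cut_adj.1 ((hG w (hmem w hw' hwm) x).1 hx)).1
    · rw [← hgN]
      congr 1
      ext w
      rw [mem_nb, mem_nb, hGg]
  · push Not at hin
    obtain ⟨l, hl, hlm⟩ := Finset.exists_mem_ne (s := T.nb g) (by omega) m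
    rw [mem_nb] at hl
    have hleaves : ∀ w, T.Adj g w → w ≠ m → ∀ x, T.Adj w x → x = g := by
      intro w hw hwm x hx
      by_contra hxg
      exact hwm (hin w ⟨hw.symm, x, hx, hxg⟩)
    refine ⟨g, hg, l, hl, hleaves l hl hlm, self_mem_branch _ _, hmem l hl hlm, fun G hG => ?_⟩
    have hGg : ∀ y, G.Adj g y ↔ T.Adj g y ∧ y ≠ l := fun y => by
      rw [hG g (self_mem_branch _ _), cut_adj]
      have := hl.ne
      tauto
    refine LeafChain.last ((hGg m).2 ⟨hgm.symm, hlm.symm⟩) (fun w hw hwm x hx => ?_) ?_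
    · have hw' := ((hGg w).1 hw).1
      exact hleaves w hw' hwm x (cut_adj.1 ((hG w (hmem w hw' hwm) x).1 hx)).1
    · have : G.nb g = (T.nb g).erase l := by
        ext w
        rw [mem_nb, Finset.mem_erase, mem_nb, hGg, and_comm]
      rw [this, Finset.card_erase_of_mem (mem_nb.2 hl)]
      omega

/-- Otherwise the branch behind `m` has centers of degree `N + 2` only, so it is a caterpillar, and
`x` could be exchanged with its end. -/
lemma IsMinimizer.exists_light {c : ℕ} (hT : T.IsMinimizer c) (hC : T.StarTree C)
    (hcard : C.card ≤ c) {N : ℕ} {i m x : V} (hi : i ∈ C) (hm : T.Inner i m) (hx : T.Inner i x)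
    (hxm : x ≠ m) (h : (T.nb i).card ≤ N + 1 ∨ (T.nb i).card ≤ N + 2 ∧ ∃ y, T.Inner i y ∧
      y ≠ x ∧ y ≠ m) : ∃ v ∈ C, v ∈ T.branch m i ∧ (T.nb v).card ≠ N + 2 := by
  by_contra hcon
  push Not at hcon
  obtain ⟨hmi, g, hg, hgi⟩ := hm
  have hmC := hC.not_mem_of_adj hmi.symm hi
  obtain ⟨j, hj, l, hend⟩ := hT.exists_isChainEnd hC hcard (N := N) g m (hC.mem_of_adj hg hmC) hg
    ⟨i, hmi, hgi.symm⟩ fun v hv hvb =>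
      hcon v hv (branch_subset_of_adj hT.isTree.isAcyclic hg.symm hgi hvb)
  rcases h with h | ⟨h, y, hy, hyx, hym⟩
  · exact hT.not_isChainEnd_of_card_le hC hcard hi hj hmi hg.symm hgi hx hxm hend h
  · exact hT.not_isChainEnd_of_inner hC hcard hi hj hmi hg.symm hgi hx hxm hend h hy hyx hym

/-- In a minimizer with at most two light centers, every center has at most two nonleaf
neighbours. -/
theorem IsMinimizer.inner_eq_or_eq {c : ℕ} (hT : T.IsMinimizer c) (hC : T.StarTree C)
    (hcard : C.card ≤ c) {N : ℕ} (hN : ∀ v ∈ C, (T.nb v).card ≤ N + 2)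
    (hlight : (C.filter fun v => (T.nb v).card ≠ N + 2).card ≤ 2) {i m x y : V} (hi : i ∈ C)
    (hm : T.Inner i m) (hx : T.Inner i x) (hy : T.Inner i y) (hmx : m ≠ x) :
    y = m ∨ y = x := by
  by_contra hcon
  push Not at hcon
  obtain ⟨hym, hyx⟩ := hcon
  have hac := hT.isTree.isAcyclic
  obtain ⟨a, ha, ham, ha'⟩ := hT.exists_light hC hcard hi hm hx hmx.symm
    (Or.inr ⟨hN i hi, y, hy, hyx, hym⟩)
  obtain ⟨b, hb, hbx, hb'⟩ := hT.exists_light hC hcard hi hx hm hmx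
    (Or.inr ⟨hN i hi, y, hy, hym, hyx⟩)
  obtain ⟨d, hd, hdy, hd'⟩ := hT.exists_light hC hcard hi hy hm hym.symm
    (Or.inr ⟨hN i hi, x, hx, hmx.symm, hyx.symm⟩)
  -- The branches at three nonleaf neighbours are disjoint, and each contains a light center.
  have : 2 < (C.filter fun v => (T.nb v).card ≠ N + 2).card :=
    Finset.two_lt_card.2 ⟨a, by simp [ha, ha'], b, by simp [hb, hb'], d, by simp [hd, hd'],
      (branch_disjoint hac hm.1 hx.1 hmx).ne_of_mem ham hbx,
      (branch_disjoint hac hm.1 hy.1 hym.symm).ne_of_mem ham hdy,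
      (branch_disjoint hac hx.1 hy.1 hyx.symm).ne_of_mem hbx hdy⟩
  omega

/-- In a minimizer with at most two light centers, every light center has at most one nonleaf
neighbour. -/
theorem IsMinimizer.inner_eq {c : ℕ} (hT : T.IsMinimizer c) (hC : T.StarTree C)
    (hcard : C.card ≤ c) {N : ℕ}
    (hlight : (C.filter fun v => (T.nb v).card ≠ N + 2).card ≤ 2) {i m x : V} (hi : i ∈ C)
    (hi' : (T.nb i).card ≤ N + 1) (hm : T.Inner i m) (hx : T.Inner i x) : x = m := by
  by_contra hxm
  have hac := hT.isTree.isAcyclic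
  obtain ⟨a, ha, ham, ha'⟩ := hT.exists_light hC hcard hi hm hx hxm (Or.inl hi')
  obtain ⟨b, hb, hbx, hb'⟩ := hT.exists_light hC hcard hi hx hm (Ne.symm hxm) (Or.inl hi')
  -- Here `i` itself is the third light center.
  have : 2 < (C.filter fun v => (T.nb v).card ≠ N + 2).card :=
    Finset.two_lt_card.2 ⟨a, by simp [ha, ha'], b, by simp [hb, hb'], i, by simp [hi]; omega,
      (branch_disjoint hac hm.1 hx.1 (Ne.symm hxm)).ne_of_mem ham hbx,
      fun h => not_mem_branch hac hm.1 (h ▸ ham), fun h => not_mem_branch hac hx.1 (h ▸ hbx)⟩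
  omega

end Chains

/-! ### Trees of stars and star trees coincide. -/

section TreesOfStars

lemma ncard_neighborSet_induce {V : Type*} {G : SimpleGraph V} (S : Set V) (v : S) :
    ((G.induce S).neighborSet v).ncard = (G.neighborSet v ∩ S).ncard := by
  rw [← Set.ncard_image_of_injective _ Subtype.val_injective]
  congr 1
  ext w
  simp only [Set.mem_image, mem_neighborSet, comap_adj, Function.Embedding.subtype_apply,
    Set.mem_inter_iff]
  constructor
  · rintro ⟨x, hx, rfl⟩
    exact ⟨hx, x.2⟩
  · rintro ⟨hw, hwS⟩
    exact ⟨⟨w, hwS⟩, hw, rfl⟩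

variable {V : Type*} [Fintype V] {G T : SimpleGraph V} {C : Finset V}

/-- A tree of stars is bipartite, with centers of degree at least two in one class and vertices of
degree at most two in the other one. -/
lemma IsTreeOfStarsOn.exists_bipartition {S : Set V} (h : G.IsTreeOfStarsOn S) : ∃ C : Set V,
    C ⊆ S ∧ (∀ a ∈ S, ∀ b ∈ S, G.Adj a b → (a ∈ C ↔ b ∉ C)) ∧
    (∀ v ∈ C, 2 ≤ (G.neighborSet v ∩ S).ncard) ∧
    ∀ b ∈ S, b ∉ C → (G.neighborSet b ∩ S).ncard ≤ 2 := by
  induction h with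
  | single x =>
    refine ⟨∅, by simp, ?_, by simp, ?_⟩
    · rintro a rfl b rfl hab
      exact (G.irrefl hab).elim
    · rintro b rfl -
      exact (Set.ncard_le_ncard Set.inter_subset_right).trans (by simp)
  | @join k hk S v w tos leaf disj new adj_new not_adj ih =>
    choose C hCS hbip htwo hle using ih
    have hleaf : ∀ i, (G.neighborSet (v i) ∩ S i).ncard ≤ 1 := fun i => by
      have := leaf i
      rwa [IsLeafVertex, ncard_neighborSet_induce] at this
    -- Centers have degree at least two, so the joined leaves lie in the other class and gain one
    -- neighbour each; `w` becomes a new center.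
    have hvC : ∀ i, (v i : V) ∉ C i := fun i h => by
      have := htwo i _ h
      have := hleaf i
      omega
    have hmem : ∀ i, ∀ x ∈ S i, (x ∈ insert w (⋃ i, C i) ↔ x ∈ C i) := by
      intro i x hx
      simp only [Set.mem_insert_iff, Set.mem_iUnion]
      constructor
      · rintro (rfl | ⟨j, hj⟩)
        · exact (new i hx).elim
        · by_cases hij : i = j
          · exact hij ▸ hj
          · exact (Set.disjoint_left.1 (disj i j hij) hx (hCS j hj)).elim
      · exact fun h => Or.inr ⟨i, h⟩
    have hw : w ∈ insert w (⋃ i, C i) := Set.mem_insert _ _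
    have hinj : Function.Injective fun i => (v i : V) := by
      intro i j hij
      by_contra hne
      exact Set.disjoint_left.1 (disj i j hne) (v i).2 (by
        have : (v i : V) = v j := hij
        rw [this]; exact (v j).2)
    refine ⟨insert w (⋃ i, C i), Set.insert_subset_insert (Set.iUnion_mono hCS), ?_, ?_, ?_⟩
    · have key : ∀ i, ∀ x ∈ S i, G.Adj w x → x ∉ insert w (⋃ i, C i) := by
        intro i x hx hwx
        rw [hmem i x hx, (adj_new i x hx).1 hwx]
        exact hvC i
      intro a ha b hb hab
      rcases ha with rfl | ha <;> rcases hb with rfl | hb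
      · exact (G.irrefl hab).elim
      · obtain ⟨i, hi⟩ := Set.mem_iUnion.1 hb
        have := key i b hi hab
        tauto
      · obtain ⟨i, hi⟩ := Set.mem_iUnion.1 ha
        have := key i a hi hab.symm
        tauto
      · obtain ⟨i, hi⟩ := Set.mem_iUnion.1 ha
        obtain ⟨j, hj⟩ := Set.mem_iUnion.1 hb
        by_cases hij : i = j
        · subst hij
          rw [hmem i a hi, hmem i b hj]
          exact hbip i a hi b hj hab
        · exact (not_adj i j hij a hi b hj hab).elim
    · rintro x (rfl | hx)
      · have : Set.range (fun i => (v i : V)) ⊆ G.neighborSet x ∩ insert x (⋃ i, S i) := by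
          rintro _ ⟨i, rfl⟩
          exact ⟨(adj_new i _ (v i).2).2 rfl, Or.inr (Set.mem_iUnion.2 ⟨i, (v i).2⟩)⟩
        refine le_trans ?_ (Set.ncard_le_ncard this)
        rw [← Set.image_univ, Set.ncard_image_of_injective _ hinj, Set.ncard_univ]
        simpa using hk
      · obtain ⟨i, hi⟩ := Set.mem_iUnion.1 hx
        exact (htwo i x hi).trans (Set.ncard_le_ncard (Set.inter_subset_inter_right _
          ((Set.subset_iUnion S i).trans (Set.subset_insert _ _))))
    · rintro b (rfl | hb) hbC
      · exact (hbC hw).elim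
      · obtain ⟨i, hi⟩ := Set.mem_iUnion.1 hb
        rw [hmem i b hi] at hbC
        have hsub : G.neighborSet b ∩ insert w (⋃ i, S i) ⊆
            (G.neighborSet b ∩ S i) ∪ {x | x = w ∧ G.Adj w b} := by
          rintro x ⟨hxb, rfl | hx⟩
          · exact Or.inr ⟨rfl, hxb.symm⟩
          · obtain ⟨j, hj⟩ := Set.mem_iUnion.1 hx
            by_cases hij : i = j
            · exact Or.inl ⟨hxb, hij ▸ hj⟩
            · exact (not_adj i j hij b hi x hj hxb).elim
        by_cases hbv : b = v i
        · refine (Set.ncard_le_ncard hsub).trans ((Set.ncard_union_le _ _).trans ?_)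
          have h1 := hleaf i
          rw [← hbv] at h1
          have h2 : ({x | x = w ∧ G.Adj w b} : Set V).ncard ≤ 1 :=
            (Set.ncard_le_ncard (t := {w}) (fun x hx => hx.1)).trans (by simp)
          omega
        · refine (Set.ncard_le_ncard (hsub.trans ?_)).trans (hle i b hi hbC)
          rintro x (hx | ⟨-, hx⟩)
          · exact hx
          · exact (hbv ((adj_new i b hi).1 hx)).elim

lemma IsTreeOfStars.exists_starTree (hT : T.IsTree) (h : T.IsTreeOfStars) :
    ∃ C, T.StarTree C := by
  obtain ⟨C, -, hbip, htwo, hle⟩ := IsTreeOfStarsOn.exists_bipartition h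
  simp only [Set.inter_univ, ← card_nb] at htwo hle
  refine ⟨C.toFinset, hT, fun a b hab => ?_, fun v hv => htwo v (by simpa using hv),
    fun b hb => hle b (Set.mem_univ _) (by simpa using hb)⟩
  simpa using hbip a (Set.mem_univ _) b (Set.mem_univ _) hab

/-- The pieces may be smaller than full branches: to build a branch rooted at a noncenter `b`, the
piece at `b` has to be `{b}` alone. -/
lemma StarTree.isTreeOfStarsOn_join (h : T.StarTree C) {i : V} (hi : i ∈ C) {S : V → Set V}
    (hS : ∀ a, T.Adj i a → a ∈ S a ∧ S a ⊆ T.branch a i ∧ T.IsTreeOfStarsOn (S a)) :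
    T.IsTreeOfStarsOn (insert i (⋃ a ∈ T.nb i, S a)) := by
  have hac := h.isTree.isAcyclic
  let e := (T.nb i).equivFin.symm
  have he : ∀ t, T.Adj i (e t) := fun t => mem_nb.1 (e t).2
  have hne : ∀ s t, s ≠ t → ((e s : V) ≠ e t) := fun s t hst h => hst (e.injective (Subtype.ext h))
  have hU : (⋃ a ∈ T.nb i, S a) = ⋃ t, S (e t) := by
    ext x
    simp only [Set.mem_iUnion]
    constructor
    · rintro ⟨a, ha, hx⟩
      exact ⟨e.symm ⟨a, ha⟩, by simpa using hx⟩
    · rintro ⟨t, hx⟩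
      exact ⟨e t, (e t).2, hx⟩
  have hin : ∀ t, i ∉ S (e t) := fun t hit =>
    not_mem_branch hac (he t).symm ((hS _ (he t)).2.1 hit)
  have hdisj : ∀ s t, s ≠ t → Disjoint (T.branch (e s) i) (T.branch (e t) i) := fun s t hst =>
    branch_disjoint hac (he s).symm (he t).symm (hne s t hst)
  rw [hU]
  refine IsTreeOfStarsOn.join (h.two_le i hi) (fun t => S (e t))
    (fun t => ⟨e t, (hS _ (he t)).1⟩) i (fun t => (hS _ (he t)).2.2) (fun t => ?_)
    (fun s t hst => (hdisj s t hst).mono (hS _ (he s)).2.1 (hS _ (he t)).2.1) hin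
    (fun t x hx => ⟨fun hix => ?_, ?_⟩) (fun s t hst x hx y hy hxy => ?_)
  · rw [IsLeafVertex, ncard_neighborSet_induce]
    have h1 : T.neighborSet (e t) ∩ S (e t) ⊆ ((T.nb (e t)).erase i : Finset V) := by
      rintro x ⟨hx, hxS⟩
      rw [Finset.mem_coe, Finset.mem_erase, mem_nb]
      exact ⟨fun hxi => hin t (hxi ▸ hxS), hx⟩
    refine (Set.ncard_le_ncard h1).trans ?_
    rw [Set.ncard_coe_finset, Finset.card_erase_of_mem (mem_nb.2 (he t).symm)]
    have := h.le_two _ (h.not_mem_of_adj (he t) hi)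
    omega
  · by_contra hne'
    exact Set.disjoint_left.1 (branch_disjoint hac hix.symm (he t).symm hne')
      (self_mem_branch _ _) ((hS _ (he t)).2.1 hx)
  · rintro rfl
    exact he t
  · have hy' := (hS _ (he t)).2.1 hy
    have hyi : y ≠ i := by rintro rfl; exact not_mem_branch hac (he t).symm hy'
    exact Set.disjoint_left.1 (hdisj s t hst)
      (branch_step ((hS _ (he s)).2.1 hx) hxy fun h => hyi h.2) hy'

/-- A noncenter `b` has at most one neighbour `i` besides `m`. The branch is then the star at `i`
joining `{b}` to the branches of the other neighbours of `i`. -/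
lemma StarTree.isTreeOfStarsOn_branch (h : T.StarTree C) (b m : V) (hb : b ∉ C)
    (hbm : T.Adj b m) : T.IsTreeOfStarsOn (T.branch b m) := by
  have hac := h.isTree.isAcyclic
  revert hb hbm
  refine hac.dart_induction₂ (P := fun b m => b ∉ C → T.Adj b m →
    T.IsTreeOfStarsOn (T.branch b m)) (fun b m ih hb hbm => ?_) b m
  by_cases hl : ∀ w, T.Adj b w → w = m
  · have : T.branch b m = {b} := by
      refine Set.Subset.antisymm (branch_induction rfl ?_)
        (Set.singleton_subset_iff.2 (self_mem_branch _ _))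
      rintro a rfl - w hw
      rw [cut_adj] at hw
      exact (hw.2.1 ⟨rfl, hl w hw.1⟩).elim
    rw [this]
    exact IsTreeOfStarsOn.single b
  push Not at hl
  obtain ⟨i, hbi, him⟩ := hl
  have hi := h.mem_of_adj hbi hb
  have huniq := h.eq_or_eq hb hbm hbi him.symm
  have hsub := branch_subset_of_adj hac hbi.symm him
  have hin : i ∈ T.branch b m := hsub (self_mem_branch _ _)
  have key := h.isTreeOfStarsOn_join hi (S := fun a => if a = b then {b} else T.branch a i)
    fun a ha => by
      by_cases hab : a = b
      · subst hab
        simp only [if_true]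
        exact ⟨rfl, Set.singleton_subset_iff.2 (self_mem_branch _ _), IsTreeOfStarsOn.single a⟩
      · simp only [hab, if_false]
        exact ⟨self_mem_branch _ _, subset_rfl,
          ih i hbi.symm him a ha.symm hab (h.not_mem_of_adj ha hi) ha.symm⟩
  convert key using 1
  refine Set.Subset.antisymm (branch_induction ?_ ?_) ?_
  · exact Or.inr (Set.mem_biUnion (mem_nb.2 hbi.symm) (by simp))
  · intro x hx _ y hxy
    rw [cut_adj] at hxy
    rcases hx with rfl | hx
    · refine Or.inr (Set.mem_biUnion (mem_nb.2 hxy.1) ?_)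
      by_cases hyb : y = b
      · simp [hyb]
      · simp only [hyb, if_false]; exact self_mem_branch _ _
    · simp only [Set.mem_iUnion] at hx
      obtain ⟨a, ha, hx⟩ := hx
      by_cases hab : a = b
      · subst hab
        simp only [if_true, Set.mem_singleton_iff] at hx
        subst hx
        exact Or.inl ((huniq y hxy.1).resolve_left fun h => hxy.2.1 ⟨rfl, h⟩)
      · simp only [hab, if_false] at hx
        by_cases hxa : x = a ∧ y = i
        · exact Or.inl hxa.2
        · refine Or.inr (Set.mem_biUnion ha ?_)
          simp only [hab, if_false]
          exact branch_step hx hxy.1 hxa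
  · rintro x (rfl | hx)
    · exact hin
    · simp only [Set.mem_iUnion] at hx
      obtain ⟨a, ha, hx⟩ := hx
      by_cases hab : a = b
      · subst hab
        simp only [if_true, Set.mem_singleton_iff] at hx
        rw [hx]; exact self_mem_branch _ _
      · simp only [hab, if_false] at hx
        exact hsub (branch_subset_of_adj hac (mem_nb.1 ha).symm hab hx)

/-- A star tree is a tree of stars. -/
theorem StarTree.isTreeOfStars (h : T.StarTree C) : T.IsTreeOfStars := by
  have hac := h.isTree.isAcyclic
  have := h.isTree.connected.nonempty
  by_cases hC : ∃ i, i ∈ C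
  · obtain ⟨i, hi⟩ := hC
    have key := h.isTreeOfStarsOn_join hi (S := fun a => T.branch a i) fun a ha =>
      ⟨self_mem_branch _ _, subset_rfl,
        h.isTreeOfStarsOn_branch a i (h.not_mem_of_adj ha hi) ha.symm⟩
    rw [IsTreeOfStars]
    convert key using 1
    refine (Set.eq_univ_of_forall fun x => ?_).symm
    by_cases hx : i = x
    · exact Or.inl hx.symm
    · obtain ⟨a, ha, hxa⟩ := h.isTree.exists_adj_mem_branch hx
      exact Or.inr (Set.mem_biUnion (mem_nb.2 ha.symm) hxa)
  · push Not at hC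
    obtain ⟨x⟩ := this
    have : (Set.univ : Set V) = {x} := by
      refine (Set.eq_univ_of_forall fun y => ?_).symm
      refine mem_of_reachable (S := {x}) (u := x) rfl ?_ (h.isTree.connected.preconnected x y)
      rintro a rfl b hab
      exact (hC a ((h.bip a b hab).2 (hC b))).elim
    rw [IsTreeOfStars, this]
    exact IsTreeOfStarsOn.single x

end TreesOfStars

/-! ### Centers and the stability number of a star tree. -/

section Centers

variable {V : Type*} [Fintype V] {G T : SimpleGraph V} {C : Finset V}

lemma StarTree.even_dist (h : T.StarTree C) (u v : V) : Even (T.dist u v) ↔ (u ∈ C ↔ v ∈ C) := by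
  have key : ∀ (u v : V) (p : T.Walk u v), Even p.length ↔ (u ∈ C ↔ v ∈ C) := by
    intro u v p
    induction p with
    | nil => simp
    | cons hab _ ih =>
      rw [Walk.length_cons, Nat.even_add_one, ih]
      have := h.bip _ _ hab
      tauto
  obtain ⟨p, hp⟩ := h.isTree.connected.exists_walk_length_eq_dist u v
  rw [← hp]
  exact key u v p

lemma IsTree.exists_isLeafVertex (hT : T.IsTree) : ∃ l, T.IsLeafVertex l := by
  by_contra hcon
  push Not at hcon
  have h1 := hT.sum_card_nb
  have h2 : ∑ v : V, 2 ≤ ∑ v, (T.nb v).card := Finset.sum_le_sum fun v _ => by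
    have := hcon v
    rw [IsLeafVertex, ← card_nb] at this
    omega
  have := hT.connected.nonempty
  have := Fintype.card_pos (α := V)
  simp only [Finset.sum_const, Finset.card_univ, smul_eq_mul] at h2
  omega

/-- All leaves lie outside `C` and at least one exists, so odd distance to the leaves singles out
the class `C`. -/
lemma StarTree.isCenter_iff (h : T.StarTree C) {v : V} : T.IsCenter v ↔ v ∈ C := by
  have hleaf : ∀ l, T.IsLeafVertex l → l ∉ C := fun l hl hlC => by
    have := h.two_le l hlC
    rw [IsLeafVertex, ← card_nb] at hl
    omega
  constructor
  · intro hv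
    obtain ⟨l, hl⟩ := h.isTree.exists_isLeafVertex
    have h1 := hv l hl
    rw [← Nat.not_even_iff_odd, h.even_dist] at h1
    have := hleaf l hl
    tauto
  · intro hv l hl
    rw [← Nat.not_even_iff_odd, h.even_dist]
    have := hleaf l hl
    tauto

lemma StarTree.dist_eq_two_iff (h : T.StarTree C) {u v : V} (hu : u ∈ C) (hv : v ∈ C) :
    T.dist u v = 2 ↔ u ≠ v ∧ ∃ b, T.Adj u b ∧ T.Adj v b := by
  constructor
  · intro hd
    have huv : u ≠ v := by rintro rfl; simp at hd
    obtain ⟨b, hb, hd'⟩ := h.isTree.connected.exists_adj_dist huv.symm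
    exact ⟨huv, b, dist_eq_one_iff_adj.1 (by omega), hb⟩
  · rintro ⟨huv, b, hub, hvb⟩
    have h1 := dist_le (Walk.cons hub (Walk.cons hvb.symm Walk.nil))
    simp only [Walk.length_cons, Walk.length_nil] at h1
    have h2 := (h.even_dist u v).2 (by tauto)
    have h3 := h.isTree.connected.pos_dist_of_ne huv
    obtain ⟨r, hr⟩ := h2
    omega

/-- The stability number of a star tree is the number of its vertices that are not centers. -/
lemma StarTree.indepNum_add_card (h : T.StarTree C) : T.indepNum + C.card = Fintype.card V := by
  have h1 : Cᶜ.card ≤ T.indepNum := by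
    refine IsIndepSet.card_le_indepNum fun a ha b hb _ hab => ?_
    have := h.bip a b hab
    simp only [Finset.coe_compl, Set.mem_compl_iff, Finset.mem_coe] at ha hb
    tauto
  obtain ⟨s, hs⟩ := T.exists_isNIndepSet_indepNum
  -- Double counting: a center in `s` has at least two neighbours, all outside `C` and `s`, and each
  -- of these has at most two neighbours.
  have h2 : (s ∩ C).card ≤ (Cᶜ \ s).card := by
    have := Finset.card_mul_le_card_mul (s := s ∩ C) (t := Cᶜ \ s) T.Adj (m := 2) (n := 2) ?_ ?_
    · omega
    · intro a ha
      rw [Finset.mem_inter] at ha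
      convert h.two_le a ha.2 using 2
      ext w
      simp only [Finset.bipartiteAbove, Finset.mem_filter, Finset.mem_sdiff, Finset.mem_compl,
        mem_nb]
      refine ⟨fun hw => hw.2, fun hw => ⟨⟨h.not_mem_of_adj hw ha.2, fun hws => ?_⟩, hw⟩⟩
      exact hs.isIndepSet ha.1 hws hw.ne hw
    · intro b hb
      rw [Finset.mem_sdiff, Finset.mem_compl] at hb
      refine (Finset.card_le_card fun w hw => ?_).trans (h.le_two b hb.1)
      rw [Finset.mem_bipartiteBelow] at hw
      exact mem_nb.2 hw.2.symm
  have h3 : (s ∩ C).card + (s \ C).card = s.card := by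
    rw [add_comm]; exact Finset.card_sdiff_add_card_inter _ _
  have h4 : (Cᶜ \ s).card + (s \ C).card = Cᶜ.card := by
    rw [← Finset.card_sdiff_add_card_inter Cᶜ s]
    congr 2
    ext w; simp [and_comm]
  have h5 := Finset.card_compl C
  have h6 := Finset.card_le_univ C
  have h7 := hs.card_eq
  omega

lemma exists_cover_of_indepNum {c : ℕ} (h : T.indepNum + c = Fintype.card V) :
    ∃ C, T.Cover C ∧ C.card = c := by
  obtain ⟨s, hs⟩ := T.exists_isNIndepSet_indepNum
  refine ⟨sᶜ, fun a b hab => ?_, ?_⟩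
  · by_contra hcon
    simp only [Finset.mem_compl, not_or, not_not] at hcon
    exact hs.isIndepSet hcon.1 hcon.2 hab.ne hab
  · rw [Finset.card_compl, hs.card_eq]
    omega

end Centers

/-! ### Recognizing a path. -/

section Paths

variable {W : Type*} {K : SimpleGraph W}

/-- A finite connected graph with maximal degree at most two and a vertex of degree at most one is
a path. -/
theorem exists_iso_pathGraph [Finite W] (hK : K.Connected)
    (hdeg : ∀ u a b c, K.Adj u a → K.Adj u b → K.Adj u c → a ≠ b → c = a ∨ c = b) {v₀ : W}
    (h₀ : ∀ a b, K.Adj v₀ a → K.Adj v₀ b → a = b) : ∃ k, Nonempty (K ≃g pathGraph k) := by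
  have := Fintype.ofFinite W
  have hpred : ∀ {x d}, K.dist v₀ x = d + 1 → ∃ w, K.Adj x w ∧ K.dist v₀ w = d := by
    intro x d hx
    obtain ⟨w, hw, hd⟩ := hK.exists_adj_dist (r := v₀) (x := x) (by rintro rfl; simp at hx)
    exact ⟨w, hw, by omega⟩
  -- Vertices at the same distance from the end `v₀` have a common predecessor by induction, and it
  -- has room for only one successor.
  have hinj : ∀ d, ∀ x y, K.dist v₀ x = d → K.dist v₀ y = d → x = y := by
    intro d
    induction d using Nat.strong_induction_on with
    | _ d ih =>
      intro x y hx hy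
      obtain rfl | ⟨d, rfl⟩ : d = 0 ∨ ∃ e, d = e + 1 := by
        cases d with
        | zero => exact Or.inl rfl
        | succ e => exact Or.inr ⟨e, rfl⟩
      · rw [hK.dist_eq_zero_iff] at hx hy
        rw [← hx, hy]
      · obtain ⟨p, hp, hpd⟩ := hpred hx
        obtain ⟨p', hp', hpd'⟩ := hpred hy
        obtain rfl := ih d (by omega) p p' hpd hpd'
        obtain rfl | ⟨d, rfl⟩ : d = 0 ∨ ∃ e, d = e + 1 := by
          cases d with
          | zero => exact Or.inl rfl
          | succ e => exact Or.inr ⟨e, rfl⟩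
        · rw [hK.dist_eq_zero_iff] at hpd
          subst hpd
          exact h₀ x y hp.symm hp'.symm
        · obtain ⟨q, hq, hqd⟩ := hpred hpd
          have hqx : q ≠ x := by rintro rfl; omega
          have hqy : y ≠ q := by rintro rfl; omega
          exact ((hdeg p q x y hq hp.symm hp'.symm hqx).resolve_left hqy).symm
  -- The distances fill an initial segment, so they stay below the number of vertices and number the
  -- path.
  have hdown : ∀ d x, K.dist v₀ x = d → ∀ e ≤ d, ∃ y, K.dist v₀ y = e := by
    intro d
    induction d with
    | zero => exact fun x hx e he => ⟨x, by omega⟩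
    | succ d ih =>
      intro x hx e he
      by_cases hed : e = d + 1
      · exact ⟨x, by omega⟩
      · obtain ⟨w, -, hw⟩ := hpred hx
        exact ih w hw e (by omega)
  have hlt : ∀ x, K.dist v₀ x < Fintype.card W := by
    intro x
    choose f hf using hdown _ x rfl
    have hfi : Function.Injective fun e : Fin (K.dist v₀ x + 1) => f e (by omega) := by
      intro e e' hee
      have h1 := hf e (by omega)
      have h2 := hf e' (by omega)
      simp only at hee
      rw [hee, h2] at h1
      exact Fin.ext h1.symm
    have := Fintype.card_le_of_injective _ hfi
    rw [Fintype.card_fin] at this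
    omega
  let φ : W → Fin (Fintype.card W) := fun x => ⟨K.dist v₀ x, hlt x⟩
  have hφ : Function.Bijective φ := by
    rw [Fintype.bijective_iff_injective_and_card]
    exact ⟨fun x y hxy => hinj _ x y rfl (Fin.mk.inj_iff.1 hxy).symm, by simp⟩
  refine ⟨_, ⟨⟨Equiv.ofBijective φ hφ, ?_⟩⟩⟩
  have hadj : ∀ x y, K.dist v₀ x + 1 = K.dist v₀ y → K.Adj x y := by
    intro x y hxy
    obtain ⟨w, hw, hwd⟩ := hpred hxy.symm
    rw [hinj _ x w rfl hwd]
    exact hw.symm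
  intro x y
  simp only [Equiv.ofBijective_apply, pathGraph_adj, φ]
  constructor
  · rintro (h | h)
    · exact hadj x y h
    · exact (hadj y x h).symm
  · intro hxy
    have h1 := hK.dist_triangle (u := v₀) (v := x) (w := y)
    have h2 := hK.dist_triangle (u := v₀) (v := y) (w := x)
    rw [dist_eq_one_iff_adj.2 hxy] at h1
    rw [dist_eq_one_iff_adj.2 hxy.symm] at h2
    have h3 : K.dist v₀ x ≠ K.dist v₀ y := fun h => hxy.ne (hinj _ x y rfl h.symm)
    omega

end Paths

/-! ### The center-tree as a path. -/

section CenterTree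

variable {V : Type*} [Fintype V] {T : SimpleGraph V} {C : Finset V}

lemma StarTree.centerTree_adj (h : T.StarTree C) {u v : {v // T.IsCenter v}} :
    T.centerTree.Adj u v ↔ u ≠ v ∧ ∃ b, T.Adj (u : V) b ∧ T.Adj (v : V) b := by
  rw [← Subtype.coe_ne_coe]
  exact h.dist_eq_two_iff (h.isCenter_iff.1 u.2) (h.isCenter_iff.1 v.2)

lemma StarTree.centerTree_preconnected (h : T.StarTree C) : T.centerTree.Preconnected := by
  intro u v
  have hc : ∀ {x}, x ∈ C → T.IsCenter x := h.isCenter_iff.2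
  have hu := h.isCenter_iff.1 u.2
  have step : ∀ {x y b : V} (hx : x ∈ C) (hy : y ∈ C), T.Adj b x → T.Adj b y →
      T.centerTree.Reachable u ⟨x, hc hx⟩ → T.centerTree.Reachable u ⟨y, hc hy⟩ := by
    intro x y b hx hy hbx hby hr
    by_cases hxy : x = y
    · subst hxy; exact hr
    · exact hr.trans (Adj.reachable (h.centerTree_adj.2
        ⟨fun h => hxy (congrArg Subtype.val h), b, hbx.symm, hby.symm⟩))
  -- Invariant along a walk in the tree: a center is reachable in the center-tree; at a noncenter
  -- all adjacent centers are.
  have key : (v : V) ∈ {x : V | (∀ hx : x ∈ C, T.centerTree.Reachable u ⟨x, hc hx⟩) ∧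
      (x ∉ C → ∀ y (hy : y ∈ C), T.Adj x y → T.centerTree.Reachable u ⟨y, hc hy⟩)} := by
    refine mem_of_reachable (u := (u : V)) ⟨fun _ => Reachable.refl _, fun h => (h hu).elim⟩ ?_
      (h.isTree.connected.preconnected _ _)
    rintro a ⟨ha1, ha2⟩ b hab
    refine ⟨fun hb => ?_, fun hb y hy hby => ?_⟩
    · exact ha2 (h.not_mem_of_adj hab.symm hb) b hb hab
    · have ha := h.mem_of_adj hab.symm hb
      exact step ha hy hab.symm hby (ha1 ha)
  exact key.1 (h.isCenter_iff.1 v.2)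

/-- Moving on through nonleaf neighbours, never back, ends at a center whose only possible nonleaf
neighbour is the one it was entered by. -/
lemma StarTree.exists_end (h : T.StarTree C) (hC : C.Nonempty) :
    ∃ v ∈ C, ∃ p, ∀ x, T.Inner v x → x = p := by
  have hac := h.isTree.isAcyclic
  have key : ∀ g m : V, g ∈ C → ∃ v ∈ C, ∃ p, ∀ x, T.Inner v x → x = p := by
    intro g m
    refine hac.dart_induction₂ (P := fun g m => g ∈ C → ∃ v ∈ C, ∃ p, ∀ x, T.Inner v x → x = p)
      (fun g m ih hg => ?_) g m
    by_cases hin : ∃ m', T.Inner g m' ∧ m' ≠ m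
    · obtain ⟨m', ⟨hm', g', hg', hgg'⟩, hne⟩ := hin
      exact ih m' hm' hne g' hg'.symm hgg' (h.mem_of_adj hg' (h.not_mem_of_adj hm'.symm hg))
    · push Not at hin
      exact ⟨g, hg, m, hin⟩
  obtain ⟨g, hg⟩ := hC
  exact key g g hg

lemma StarTree.eq_of_common (h : T.StarTree C) {u a b m : V} (hu : u ∈ C) (hum : T.Adj u m)
    (hua : u ≠ a) (hub : u ≠ b) (ham : T.Adj a m) (hbm : T.Adj b m) : a = b :=
  (((h.eq_or_eq (h.not_mem_of_adj hum hu) hum.symm ham.symm hua) b hbm.symm).resolve_left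
    hub.symm).symm

/-- The center-tree of a star tree is a path if all its centers have at most two nonleaf
neighbours. -/
theorem StarTree.exists_iso (h : T.StarTree C)
    (hin : ∀ i ∈ C, ∀ m x y, T.Inner i m → T.Inner i x → T.Inner i y → m ≠ x → y = m ∨ y = x) :
    ∃ k, Nonempty (T.centerTree ≃g pathGraph k) := by
  by_cases hC : C.Nonempty
  · obtain ⟨v, hv, p, hp⟩ := h.exists_end hC
    have hinner : ∀ {u a : {v // T.IsCenter v}} {b : V}, u ≠ a → T.Adj (u : V) b → T.Adj (a : V) b →
        T.Inner u b := fun hua h1 h2 => ⟨h1.symm, _, h2.symm, fun h => hua (Subtype.ext h.symm)⟩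
    have hne : ∀ {u a : {v // T.IsCenter v}}, u ≠ a → (u : V) ≠ a :=
      fun hua h => hua (Subtype.ext h)
    have : Nonempty {v // T.IsCenter v} := ⟨⟨v, h.isCenter_iff.2 hv⟩⟩
    refine exists_iso_pathGraph (Connected.mk h.centerTree_preconnected) ?_
      (v₀ := ⟨v, h.isCenter_iff.2 hv⟩) ?_
    · intro u a b c ha hb hc hab
      rw [h.centerTree_adj] at ha hb hc
      obtain ⟨hua, x, hux, hax⟩ := ha
      obtain ⟨hub, y, huy, hby⟩ := hb
      obtain ⟨huc, z, huz, hcz⟩ := hc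
      have hu := h.isCenter_iff.1 u.2
      have hxy : x ≠ y := by
        rintro rfl
        exact hab (Subtype.ext (h.eq_of_common hu hux (hne hua) (hne hub) hax hby))
      rcases hin u hu x y z (hinner hua hux hax) (hinner hub huy hby) (hinner huc huz hcz) hxy with
        rfl | rfl
      · exact Or.inl (Subtype.ext (h.eq_of_common hu hux (hne huc) (hne hua) hcz hax))
      · exact Or.inr (Subtype.ext (h.eq_of_common hu huy (hne huc) (hne hub) hcz hby))
    · intro a b ha hb
      rw [h.centerTree_adj] at ha hb
      obtain ⟨hua, x, hux, hax⟩ := ha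
      obtain ⟨hub, y, huy, hby⟩ := hb
      have hx := hp x (hinner hua hux hax)
      have hy := hp y (hinner hub huy hby)
      subst hx hy
      exact Subtype.ext (h.eq_of_common hv hux (hne hua) (hne hub) hax hby)
  · rw [Finset.not_nonempty_iff_eq_empty] at hC
    have : IsEmpty {v // T.IsCenter v} := ⟨fun v => by
      have := h.isCenter_iff.1 v.2
      simp [hC] at this⟩
    exact ⟨0, ⟨⟨Equiv.equivOfIsEmpty _ _, fun {a} => isEmptyElim a⟩⟩⟩

end CenterTree

/-! ### Degrees and number of light centers from `n` and `α`. -/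

section Parameters

variable {V : Type*} [Fintype V] {T : SimpleGraph V} {C : Finset V}

/-- In a balanced star tree, every center has degree `heavyDegree` or one less, and `numLight`
counts the centers of the second kind. -/
theorem StarTree.light_centers (h : T.StarTree C) (hC : C.Nonempty)
    (hbal : ∀ u ∈ C, ∀ v ∈ C, (T.nb u).card ≤ (T.nb v).card + 1) {α : ℕ}
    (hα : α + C.card = Fintype.card V) :
    (∀ v ∈ C, (T.nb v).card = heavyDegree (Fintype.card V) α ∨
      (T.nb v).card + 1 = heavyDegree (Fintype.card V) α) ∧
    (C.filter fun v => (T.nb v).card ≠ heavyDegree (Fintype.card V) α).card =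
      numLight (Fintype.card V) α ∧ numLight (Fintype.card V) α < C.card := by
  set n := Fintype.card V with hn
  obtain ⟨u, hu, hmax⟩ := Finset.exists_max_image C (fun v => (T.nb v).card) hC
  set M := (T.nb u).card with hM
  have hM2 : 2 ≤ M := h.two_le u hu
  have hdeg : ∀ v ∈ C, (T.nb v).card = M ∨ (T.nb v).card + 1 = M := fun v hv => by
    have := hmax v hv
    have := hbal u hu v hv
    omega
  set L := (C.filter fun v => (T.nb v).card ≠ M).card with hL
  have hsum := h.sum_card
  rw [← hn] at hsum
  have hcount : (n - 1) + L = C.card * M := by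
    rw [← hsum, hL, Finset.card_filter, ← Finset.sum_add_distrib, ← smul_eq_mul,
      ← Finset.sum_const]
    refine Finset.sum_congr rfl fun v hv => ?_
    rcases hdeg v hv with h1 | h1
    · simp [h1]
    · rw [if_pos (by omega)]; omega
  have hLC : L < C.card := by
    refine Finset.card_lt_card (Finset.filter_ssubset.2 ⟨u, hu, ?_⟩)
    simp [hM]
  have hc0 := Finset.card_pos.2 hC
  -- Here (n-1)/|C| = M - L/|C| with 0 ≤ L < |C|, so the ceiling is `M`.
  have hD : heavyDegree n α = M := by
    have e1 : (n : ℚ) - α = C.card := by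
      rw [← hα]; push_cast; ring
    have hn1 : 1 ≤ n := by omega
    have e2 : (n : ℚ) - 1 = C.card * M - L := by
      have : ((n - 1 : ℕ) : ℚ) + L = C.card * M := by exact_mod_cast hcount
      rw [Nat.cast_sub hn1] at this
      push_cast at this
      linarith
    have hc : (0 : ℚ) < C.card := by exact_mod_cast hc0
    have hl : (L : ℚ) < C.card := by exact_mod_cast hLC
    have hl0 : (0 : ℚ) ≤ L := by positivity
    rw [heavyDegree, e1, e2, Nat.ceil_eq_iff (by omega), Nat.cast_sub (by omega), lt_div_iff₀ hc,
      div_le_iff₀ hc]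
    constructor <;> push_cast <;> nlinarith
  have hnL : numLight n α = L := by
    have e : n - α = C.card := by omega
    rw [numLight, numHeavy, e]
    obtain ⟨K, hK⟩ : ∃ K, M = K + 1 := ⟨M - 1, by omega⟩
    rw [hK, Nat.mul_add, Nat.mul_one] at hcount
    -- Without light centers the remainder is 0, the case in which `numHeavy` takes its default
    -- value.
    by_cases hL0 : L = 0
    · have e2 : n - 1 = C.card * (K + 1) := by rw [Nat.mul_add]; omega
      rw [if_neg (by rw [e2]; simp)]
      omega
    · have e2 : (n - 1) % C.card = C.card - L := by
        have : n - 1 = (C.card - L) + C.card * K := by omega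
        rw [this, Nat.add_mul_mod_self_left, Nat.mod_eq_of_lt (by omega)]
      rw [e2, if_pos (by omega)]
      omega
  rw [hD, hnL]
  exact ⟨hdeg, rfl, hLC⟩

end Parameters

/-! ### The number of stable sets from the center-tree and the degrees. -/

section Counting

variable {V : Type*} [Fintype V] {T : SimpleGraph V} {C : Finset V}

/-- Counting the stable sets of a star tree by their sets of centers. -/
lemma StarTree.card_stab (h : T.StarTree C) : T.stab.card =
    ∑ A ∈ C.powerset, 2 ^ (Cᶜ.filter fun b => ∀ a ∈ A, ¬ T.Adj a b).card := by
  rw [Finset.card_eq_sum_card_fiberwise (f := fun s => s ∩ C) (t := C.powerset)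
    fun s _ => Finset.mem_coe.2 (Finset.mem_powerset.2 Finset.inter_subset_right)]
  refine Finset.sum_congr rfl fun A hA => ?_
  rw [Finset.mem_powerset] at hA
  rw [← Finset.card_powerset]
  refine Finset.card_bij' (fun s _ => s \ C) (fun B _ => A ∪ B) ?_ ?_ ?_ ?_
  · intro s hs
    rw [Finset.mem_filter, mem_stab] at hs
    rw [Finset.mem_powerset]
    intro b hb
    rw [Finset.mem_sdiff] at hb
    rw [Finset.mem_filter, Finset.mem_compl]
    refine ⟨hb.2, fun a ha => ?_⟩
    rw [← hs.2, Finset.mem_inter] at ha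
    exact hs.1 a ha.1 b hb.1
  · intro B hB
    rw [Finset.mem_powerset] at hB
    have hB' : ∀ b ∈ B, b ∉ C ∧ ∀ a ∈ A, ¬ T.Adj a b := fun b hb => by
      simpa using hB hb
    rw [Finset.mem_filter, mem_stab]
    refine ⟨fun a ha b hb hab => ?_, ?_⟩
    · rw [Finset.mem_union] at ha hb
      have hbip := h.bip a b hab
      rcases ha with ha | ha <;> rcases hb with hb | hb
      · exact hbip.1 (hA ha) (hA hb)
      · exact (hB' b hb).2 a ha hab
      · exact (hB' a ha).2 b hb hab.symm
      · exact (hB' a ha).1 (hbip.2 (hB' b hb).1)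
    · ext x
      rw [Finset.mem_inter, Finset.mem_union]
      constructor
      · rintro ⟨hx | hx, hxC⟩
        · exact hx
        · exact ((hB' x hx).1 hxC).elim
      · exact fun hx => ⟨Or.inl hx, hA hx⟩
  · intro s hs
    rw [Finset.mem_filter] at hs
    rw [← hs.2, Finset.union_comm]
    exact Finset.sdiff_union_inter s C
  · intro B hB
    rw [Finset.mem_powerset] at hB
    ext x
    rw [Finset.mem_sdiff, Finset.mem_union]
    constructor
    · rintro ⟨hx | hx, hxC⟩
      · exact (hxC (hA hx)).elim
      · exact hx
    · intro hx
      have := hB hx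
      rw [Finset.mem_filter, Finset.mem_compl] at this
      exact ⟨Or.inr hx, this.1⟩

/-- Counting the neighbours of a set of centers. -/
lemma StarTree.card_neighbors (h : T.StarTree C) {A : Finset V} (hA : A ⊆ C) :
    2 * (Cᶜ.filter fun b => ∃ a ∈ A, T.Adj a b).card +
      ((A ×ˢ A).filter fun p => p.1 ≠ p.2 ∧ ∃ b, T.Adj p.1 b ∧ T.Adj p.2 b).card =
      2 * ∑ a ∈ A, (T.nb a).card := by
  have hac := h.isTree.isAcyclic
  have e1 : ∑ a ∈ A, (T.nb a).card = ∑ b ∈ Cᶜ, (A.filter fun a => T.Adj a b).card := by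
    have := Finset.sum_card_bipartiteAbove_eq_sum_card_bipartiteBelow (s := A) (t := Cᶜ) T.Adj
    refine Eq.trans (Finset.sum_congr rfl fun a ha => ?_) this
    congr 1
    ext b
    simp only [mem_nb, Finset.bipartiteAbove, Finset.mem_filter, Finset.mem_compl]
    exact ⟨fun hb => ⟨h.not_mem_of_adj hb (hA ha), hb⟩, fun hb => hb.2⟩
  have e2 : ((A ×ˢ A).filter fun p => p.1 ≠ p.2 ∧ ∃ b, T.Adj p.1 b ∧ T.Adj p.2 b) =
      Cᶜ.biUnion fun b => (A.filter fun a => T.Adj a b).offDiag := by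
    ext ⟨u, v⟩
    simp only [Finset.mem_filter, Finset.mem_product, Finset.mem_biUnion, Finset.mem_offDiag,
      Finset.mem_compl]
    constructor
    · rintro ⟨⟨hu, hv⟩, huv, b, hub, hvb⟩
      exact ⟨b, h.not_mem_of_adj hub (hA hu), ⟨hu, hub⟩, ⟨hv, hvb⟩, huv⟩
    · rintro ⟨b, -, ⟨hu, hub⟩, ⟨hv, hvb⟩, huv⟩
      exact ⟨⟨hu, hv⟩, huv, b, hub, hvb⟩
  rw [e2, Finset.card_biUnion, e1, Finset.card_filter, Finset.mul_sum, Finset.mul_sum,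
    ← Finset.sum_add_distrib]
  · refine Finset.sum_congr rfl fun b hb => ?_
    rw [Finset.mem_compl] at hb
    have hle : (A.filter fun a => T.Adj a b).card ≤ 2 :=
      (Finset.card_le_card fun a ha => mem_nb.2 (Finset.mem_filter.1 ha).2.symm).trans
        (h.le_two b hb)
    have hpos : (∃ a ∈ A, T.Adj a b) ↔ 0 < (A.filter fun a => T.Adj a b).card := by
      rw [Finset.card_pos, Finset.filter_nonempty_iff]
    rw [Finset.offDiag_card]
    simp only [hpos]
    -- A noncenter with k ≤ 2 neighbours in `A` contributes 2·[k > 0] + k(k-1), which equals 2k.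
    generalize (A.filter fun a => T.Adj a b).card = k at hle
    interval_cases k <;> simp
  -- Two centers have at most one common neighbour, so no ordered pair is counted twice.
  · intro b _ b' _ hbb'
    rw [Function.onFun, Finset.disjoint_left]
    rintro ⟨u, v⟩ h1 h2
    simp only [Finset.mem_offDiag, Finset.mem_filter] at h1 h2
    obtain ⟨⟨-, hub⟩, ⟨-, hvb⟩, huv⟩ := h1
    obtain ⟨⟨-, hub'⟩, ⟨-, hvb'⟩, -⟩ := h2
    exact Set.disjoint_left.1 (branch_disjoint hac hub.symm hub'.symm hbb')
      (branch_step (self_mem_branch _ _) hvb.symm fun h => huv h.2.symm)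
      (branch_step (self_mem_branch _ _) hvb'.symm fun h => huv h.2.symm)

/-- The number of stable sets of a star tree is determined by its center-tree and the degrees of
its centers. -/
theorem StarTree.fibonacciNumber_eq {T' : SimpleGraph V} {C' : Finset V} (h : T.StarTree C)
    (h' : T'.StarTree C') (f : T.centerTree ≃g T'.centerTree)
    (hf : ∀ v, (T'.nb (f v)).card = (T.nb v).card) : T.fibonacciNumber = T'.fibonacciNumber := by
  have hc : ∀ {x}, T.IsCenter x ↔ x ∈ C := h.isCenter_iff
  have hc' : ∀ {x}, T'.IsCenter x ↔ x ∈ C' := h'.isCenter_iff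
  -- The bijection of centers extends to all vertices; on noncenters its values are irrelevant.
  set e : Equiv.Perm V := f.toEquiv.extendSubtype with he
  have heC : ∀ v, v ∈ C ↔ e v ∈ C' := fun v => by
    refine ⟨fun hv => hc'.1 (f.toEquiv.extendSubtype_mem v (hc.2 hv)), fun hv => ?_⟩
    by_contra hvC
    exact f.toEquiv.extendSubtype_not_mem v (fun h => hvC (hc.1 h)) (hc'.2 hv)
  have hev : ∀ v (hv : v ∈ C), e v = f ⟨v, hc.2 hv⟩ := fun v hv =>
    f.toEquiv.extendSubtype_apply_of_mem v (hc.2 hv)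
  have hdeg : ∀ v ∈ C, (T'.nb (e v)).card = (T.nb v).card := fun v hv => by
    rw [hev v hv, hf]
  have hadj : ∀ u ∈ C, ∀ v ∈ C, (u ≠ v ∧ ∃ b, T.Adj u b ∧ T.Adj v b) ↔
      (e u ≠ e v ∧ ∃ b, T'.Adj (e u) b ∧ T'.Adj (e v) b) := by
    intro u hu v hv
    have h1 := h.centerTree_adj (u := ⟨u, hc.2 hu⟩) (v := ⟨v, hc.2 hv⟩)
    have h2 := h'.centerTree_adj (u := f ⟨u, hc.2 hu⟩) (v := f ⟨v, hc.2 hv⟩)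
    rw [← Subtype.coe_ne_coe] at h1 h2
    rw [hev u hu, hev v hv, ← h2, ← h1]
    exact f.map_adj_iff.symm
  have hsub : ∀ A : Finset V, A ⊆ C ↔ A.map e.toEmbedding ⊆ C' := fun A => by
    constructor
    · intro hA x hx
      obtain ⟨a, ha, rfl⟩ := Finset.mem_map.1 hx
      exact (heC a).1 (hA ha)
    · intro hA a ha
      exact (heC a).2 (hA (Finset.mem_map_of_mem _ ha))
  have hcard : Cᶜ.card = C'ᶜ.card := by
    refine Finset.card_equiv e fun v => ?_
    rw [Finset.mem_compl, Finset.mem_compl, heC]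
  have hcompl : ∀ (T : SimpleGraph V) (C A : Finset V),
      (Cᶜ.filter fun b => ∀ a ∈ A, ¬ T.Adj a b).card +
        (Cᶜ.filter fun b => ∃ a ∈ A, T.Adj a b).card = Cᶜ.card := by
    intro T C A
    rw [add_comm, ← Finset.card_filter_add_card_filter_not (s := Cᶜ)
      (p := fun b => ∃ a ∈ A, T.Adj a b)]
    congr 2
    ext b
    simp
  rw [fibonacciNumber_eq_card_stab, fibonacciNumber_eq_card_stab, h.card_stab, h'.card_stab]
  refine Finset.sum_equiv (Equiv.finsetCongr e) (fun A => ?_) fun A hA => ?_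
  · rw [Finset.mem_powerset, Finset.mem_powerset, Equiv.finsetCongr_apply]
    exact hsub A
  · rw [Finset.mem_powerset] at hA
    rw [Equiv.finsetCongr_apply]
    have h1 := h.card_neighbors hA
    have h2 := h'.card_neighbors ((hsub A).1 hA)
    have h3 : ∑ a ∈ A.map e.toEmbedding, (T'.nb a).card = ∑ a ∈ A, (T.nb a).card := by
      rw [Finset.sum_map]
      exact Finset.sum_congr rfl fun a ha => hdeg a (hA ha)
    have h4 : ((A ×ˢ A).filter fun p => p.1 ≠ p.2 ∧ ∃ b, T.Adj p.1 b ∧ T.Adj p.2 b).card =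
        ((A.map e.toEmbedding ×ˢ A.map e.toEmbedding).filter fun p => p.1 ≠ p.2 ∧
          ∃ b, T'.Adj p.1 b ∧ T'.Adj p.2 b).card := by
      refine Finset.card_equiv (e.prodCongr e) ?_
      rintro ⟨u, v⟩
      simp only [Finset.mem_filter, Finset.mem_product, Equiv.prodCongr_apply, Prod.map_fst,
        Prod.map_snd, Finset.mem_map_equiv, Equiv.symm_apply_apply]
      constructor
      · rintro ⟨⟨hu, hv⟩, huv⟩
        exact ⟨⟨hu, hv⟩, (hadj u (hA hu) v (hA hv)).1 huv⟩
      · rintro ⟨⟨hu, hv⟩, huv⟩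
        exact ⟨⟨hu, hv⟩, (hadj u (hA hu) v (hA hv)).2 huv⟩
    have h5 := hcompl T C A
    have h6 := hcompl T' C' (A.map e.toEmbedding)
    congr 1
    omega

end Counting

/-! ### Orienting the path so that the light centers are in standard position. -/

section NormalForm

/-- The reversal of a path. -/
def pathGraphRev (k : ℕ) : pathGraph k ≃g pathGraph k where
  toEquiv := Fin.revPerm
  map_rel_iff' := by
    intro a b
    simp only [Fin.revPerm_apply, pathGraph_adj, Fin.val_rev]
    omega

/-- A set of endpoints is empty, one end or both; a reversal moves a single end to position 0. -/
lemma exists_pathGraph_iso {k : ℕ} (L : Finset (Fin k))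
    (hL : ∀ t ∈ L, (t : ℕ) = 0 ∨ (t : ℕ) + 1 = k) (hk : L.card < k) :
    ∃ f : pathGraph k ≃g pathGraph k, ∀ t, t ∈ L ↔
      ((f t : ℕ) = 0 ∧ 1 ≤ L.card) ∨ ((f t : ℕ) + 1 = k ∧ 2 ≤ L.card) := by
  obtain ⟨m, rfl⟩ : ∃ m, k = m + 1 := ⟨k - 1, by omega⟩
  have h0 : ∀ t : Fin (m + 1), (t : ℕ) = 0 ↔ t = 0 := fun t => by
    rw [Fin.ext_iff]; rfl
  have h1 : ∀ t : Fin (m + 1), (t : ℕ) + 1 = m + 1 ↔ t = Fin.last m := fun t => by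
    rw [Fin.ext_iff, Fin.val_last]; omega
  simp only [h0, h1] at hL ⊢
  -- With one vertex the two ends coincide, but `hk` then leaves `L` empty.
  by_cases hm : m = 0
  · subst hm
    have : L = ∅ := by rw [← Finset.card_eq_zero]; omega
    subst this
    exact ⟨Iso.refl, by simp⟩
  have hne : (0 : Fin (m + 1)) ≠ Fin.last m := by
    rw [Ne, Fin.ext_iff, Fin.val_last]; exact fun h => hm h.symm
  by_cases hz : 0 ∈ L <;> by_cases hl : Fin.last m ∈ L
  · have : L = {0, Fin.last m} := by
      ext t
      simp only [Finset.mem_insert, Finset.mem_singleton]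
      exact ⟨hL t, by rintro (rfl | rfl) <;> assumption⟩
    refine ⟨Iso.refl, fun t => ?_⟩
    rw [this, Finset.card_pair hne]
    simp
  · have : L = {0} := by
      ext t
      rw [Finset.mem_singleton]
      refine ⟨fun ht => (hL t ht).resolve_right ?_, by rintro rfl; exact hz⟩
      rintro rfl; exact hl ht
    refine ⟨Iso.refl, fun t => ?_⟩
    rw [this, Finset.card_singleton]
    simp
  · have : L = {Fin.last m} := by
      ext t
      rw [Finset.mem_singleton]
      refine ⟨fun ht => (hL t ht).resolve_left ?_, by rintro rfl; exact hl⟩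
      rintro rfl; exact hz ht
    refine ⟨pathGraphRev _, fun t => ?_⟩
    rw [this, Finset.card_singleton]
    have : (pathGraphRev (m + 1)) t = Fin.rev t := rfl
    rw [this, ← Fin.rev_last, Fin.rev_inj]
    simp
  · have : L = ∅ := by
      rw [Finset.eq_empty_iff_forall_notMem]
      intro t ht
      rcases hL t ht with rfl | rfl
      · exact hz ht
      · exact hl ht
    subst this
    exact ⟨Iso.refl, by simp⟩

variable {V : Type*} [Fintype V] {T : SimpleGraph V} {C : Finset V}

lemma StarTree.card_pathGraph (h : T.StarTree C) {k : ℕ} (f : T.centerTree ≃g pathGraph k) :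
    C.card = k := by
  have h1 : Fintype.card {v // T.IsCenter v} = k := by
    rw [Fintype.card_congr f.toEquiv, Fintype.card_fin]
  rw [← h1, Fintype.card_subtype]
  congr 1
  ext v
  simp [h.isCenter_iff]

/-- If the light centers are endpoints of the center-path, then the path can be oriented in such a
way that the positions of the light centers depend on their number only. -/
lemma StarTree.exists_normal_iso (h : T.StarTree C) {D l k : ℕ}
    (hl : (C.filter fun v => (T.nb v).card + 1 = D).card = l) (hlC : l < C.card)
    (f : T.centerTree ≃g pathGraph k)
    (hf : ∀ v : {v // T.IsCenter v}, (T.nb (v : V)).card + 1 = D → (f v : ℕ) = 0 ∨ (f v : ℕ) + 1 = k) :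
    ∃ f' : T.centerTree ≃g pathGraph k, ∀ v : {v // T.IsCenter v},
      (T.nb (v : V)).card + 1 = D ↔
      ((f' v : ℕ) = 0 ∧ 1 ≤ l) ∨ ((f' v : ℕ) + 1 = k ∧ 2 ≤ l) := by
  have hk := h.card_pathGraph f
  set L : Finset (Fin k) := Finset.univ.filter fun t => (T.nb (f.symm t : V)).card + 1 = D with hL
  have hLl : L.card = l := by
    rw [← hl, ← Finset.card_image_of_injective L
      (Subtype.val_injective.comp f.symm.injective : Function.Injective fun t => (f.symm t : V))]
    congr 1
    ext v
    simp only [hL, Finset.mem_image, Finset.mem_filter, Finset.mem_univ, true_and]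
    constructor
    · rintro ⟨t, ht, rfl⟩
      exact ⟨h.isCenter_iff.1 (f.symm t).2, ht⟩
    · rintro ⟨hv, hvD⟩
      exact ⟨f ⟨v, h.isCenter_iff.2 hv⟩, by simpa using hvD, by simp⟩
  have hmem : ∀ v, f v ∈ L ↔ (T.nb (v : V)).card + 1 = D := fun v => by
    simp [hL]
  obtain ⟨g, hg⟩ := exists_pathGraph_iso L (fun t ht => by
    have := hf (f.symm t) (by simpa [hL] using ht)
    simpa using this) (by omega)
  refine ⟨f.trans g, fun v => ?_⟩
  rw [← hmem, hg, hLl]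
  rfl

/-- Star trees of the same order and the same number of centers, which satisfy the conditions of
the characterization, have the same number of stable sets. -/
lemma StarTree.fibonacciNumber_eq_of_light_end {T' : SimpleGraph V} {C' : Finset V}
    (h : T.StarTree C) (h' : T'.StarTree C') (hcard : C.card = C'.card)
    (hbal : ∀ u ∈ C, ∀ v ∈ C, (T.nb u).card ≤ (T.nb v).card + 1)
    (hbal' : ∀ u ∈ C', ∀ v ∈ C', (T'.nb u).card ≤ (T'.nb v).card + 1)
    {α k k' : ℕ} (hα : α + C.card = Fintype.card V)
    (f : T.centerTree ≃g pathGraph k) (f' : T'.centerTree ≃g pathGraph k')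
    (hf : ∀ v : {v // T.IsCenter v}, (T.nb (v : V)).card + 1 = heavyDegree (Fintype.card V) α →
      (f v : ℕ) = 0 ∨ (f v : ℕ) + 1 = k)
    (hf' : ∀ v : {v // T'.IsCenter v}, (T'.nb (v : V)).card + 1 = heavyDegree (Fintype.card V) α →
      (f' v : ℕ) = 0 ∨ (f' v : ℕ) + 1 = k') : T.fibonacciNumber = T'.fibonacciNumber := by
  obtain rfl : k = k' := by
    rw [← h.card_pathGraph f, ← h'.card_pathGraph f', hcard]
  by_cases hC : C.Nonempty
  · have hC' : C'.Nonempty := by rw [← Finset.card_pos, ← hcard]; exact Finset.card_pos.2 hC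
    obtain ⟨hdeg, hl, hlC⟩ := h.light_centers hC hbal hα
    obtain ⟨hdeg', hl', hlC'⟩ := h'.light_centers hC' hbal' (hcard ▸ hα)
    have key : ∀ {T : SimpleGraph V} {C : Finset V} {D : ℕ},
        (∀ v ∈ C, (T.nb v).card = D ∨ (T.nb v).card + 1 = D) →
        (C.filter fun v => (T.nb v).card + 1 = D) = C.filter fun v => (T.nb v).card ≠ D := by
      intro T C D hD
      refine Finset.filter_congr fun v hv => ?_
      have := hD v hv
      omega
    rw [← key hdeg] at hl
    rw [← key hdeg'] at hl'
    obtain ⟨g, hg⟩ := h.exists_normal_iso hl hlC f hf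
    obtain ⟨g', hg'⟩ := h'.exists_normal_iso hl' hlC' f' hf'
    refine h.fibonacciNumber_eq h' (g.trans g'.symm) fun v => ?_
    have h1 := hdeg v (h.isCenter_iff.1 v.2)
    have h2 := hdeg' _ (h'.isCenter_iff.1 ((g.trans g'.symm) v).2)
    have h3 := hg v
    have h4 := hg' ((g.trans g'.symm) v)
    have h5 : g' ((g.trans g'.symm) v) = g v := by simp
    rw [h5, ← h3] at h4
    omega
  · have hC' : ¬ C'.Nonempty := by rwa [← Finset.card_pos, ← hcard, Finset.card_pos]
    rw [Finset.not_nonempty_iff_eq_empty] at hC hC'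
    have e1 : IsEmpty {v // T.IsCenter v} := ⟨fun v => by
      have := h.isCenter_iff.1 v.2
      simp [hC] at this⟩
    exact h.fibonacciNumber_eq h' (f.trans f'.symm) fun v => isEmptyElim v

end NormalForm

/-! ### Assembling the characterization. -/

section Characterization

variable {V : Type*} [Fintype V] {T : SimpleGraph V} {C : Finset V}

/-- In a minimizer with at most two light centers the center-tree is a path, the light centers
being at its ends. -/
lemma IsMinimizer.exists_iso (hT : T.IsMinimizer C.card) (hC : T.StarTree C)
    {α : ℕ} (hα : α + C.card = Fintype.card V) (hlight : numLight (Fintype.card V) α ≤ 2) :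
    ∃ (k : ℕ) (f : T.centerTree ≃g pathGraph k), ∀ v : {v // T.IsCenter v},
      (T.nb (v : V)).card + 1 = heavyDegree (Fintype.card V) α →
        (f v : ℕ) = 0 ∨ (f v : ℕ) + 1 = k := by
  by_cases hne : C.Nonempty
  swap
  · obtain ⟨k, ⟨f⟩⟩ := hC.exists_iso fun i hi => (hne ⟨i, hi⟩).elim
    exact ⟨k, f, fun v => (hne ⟨v, hC.isCenter_iff.1 v.2⟩).elim⟩
  obtain ⟨hdeg, hl, -⟩ := hC.light_centers hne
    (fun u hu v hv => hT.balanced hC le_rfl hu hv) hα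
  set D := heavyDegree (Fintype.card V) α
  obtain ⟨i, hi⟩ := hne
  obtain ⟨N, hN⟩ : ∃ N, D = N + 2 := by
    have h1 := hC.two_le i hi
    have h2 := hdeg i hi
    exact ⟨D - 2, by omega⟩
  rw [hN] at hl hdeg
  rw [← hl] at hlight
  obtain ⟨k, ⟨f⟩⟩ := hC.exists_iso fun i hi m x y hm hx hy hmx =>
    hT.inner_eq_or_eq hC le_rfl (fun v hv => by have := hdeg v hv; omega) hlight hi hm hx hy hmx
  refine ⟨k, f, fun v hv => ?_⟩
  -- A light center inside the path has two neighbouring centers, reached through nonleaf neighbours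
  -- `m` and `x`. `inner_eq` identifies these, and a noncenter cannot have three neighbours.
  by_contra hcon
  push Not at hcon
  have hvC := hC.isCenter_iff.1 v.2
  have hvk := (f v).2
  have hin : ∀ t : Fin k, (pathGraph k).Adj (f v) t → T.centerTree.Adj v (f.symm t) := by
    intro t ht
    rw [← f.map_adj_iff]
    simpa using ht
  have ha := hin ⟨(f v : ℕ) + 1, by omega⟩ (pathGraph_adj.2 (Or.inl rfl))
  have hb := hin ⟨(f v : ℕ) - 1, by omega⟩ (pathGraph_adj.2 (Or.inr (by simp; omega)))
  have hab : f.symm ⟨(f v : ℕ) + 1, by omega⟩ ≠ f.symm ⟨(f v : ℕ) - 1, by omega⟩ := by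
    intro h
    have := Fin.mk.inj_iff.1 (f.symm.injective h)
    omega
  generalize f.symm ⟨(f v : ℕ) + 1, by omega⟩ = a at ha hab
  generalize f.symm ⟨(f v : ℕ) - 1, by omega⟩ = b at hb hab
  rw [hC.centerTree_adj] at ha hb
  obtain ⟨hva, m, hvm, ham⟩ := ha
  obtain ⟨hvb, x, hvx, hbx⟩ := hb
  have h1 : ∀ {u w : {v // T.IsCenter v}}, u ≠ w → (u : V) ≠ w := fun h h' => h (Subtype.ext h')
  obtain rfl := hT.inner_eq hC le_rfl hlight hvC (by omega) ⟨hvm.symm, _, ham.symm, (h1 hva).symm⟩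
    ⟨hvx.symm, _, hbx.symm, (h1 hvb).symm⟩
  exact hab (Subtype.ext (hC.eq_of_common hvC hvm (h1 hva) (h1 hvb) ham hbx))

lemma exists_isMinimizer {c : ℕ} (hT : T.IsTree) (h : ∃ C, T.Cover C ∧ C.card ≤ c) :
    ∃ T' : SimpleGraph V, T'.IsMinimizer c := by
  obtain ⟨T', hT', hmin⟩ := Finset.exists_min_image
    (Finset.univ.filter fun T' : SimpleGraph V => T'.IsTree ∧ ∃ C, T'.Cover C ∧ C.card ≤ c)
    (fun T' => T'.cnt ∅) ⟨T, by simpa using ⟨hT, h⟩⟩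
  simp only [Finset.mem_filter, Finset.mem_univ, true_and] at hT' hmin
  exact ⟨T', hT'.1, hT'.2, fun T'' h1 h2 => hmin T'' ⟨h1, h2⟩⟩

lemma isLightCenter_iff (v : {v // T.IsCenter v}) :
    T.IsLightCenter v ↔ (T.nb (v : V)).card + 1 = heavyDegree (Fintype.card V) T.indepNum := by
  rw [IsLightCenter, card_nb, Nat.card_eq_fintype_card]
  exact and_iff_right v.2

/-- The characterization of extremal trees with at most two light centers. -/
theorem IsTree.isExtremalTree_iff (hT : T.IsTree) {α : ℕ} (hα : T.indepNum = α)
    (hlarge : Fintype.card V < 2 * α) (hlight : numLight (Fintype.card V) α ≤ 2) :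
    T.IsExtremalTree ↔ T.IsBalancedTreeOfStars ∧ ∃ (k : ℕ) (f : T.centerTree ≃g pathGraph k),
      ∀ v : {v : V // T.IsCenter v}, T.IsLightCenter (v : V) →
        (f v : ℕ) = 0 ∨ (f v : ℕ) + 1 = k := by
  have hαn : α ≤ Fintype.card V := by
    obtain ⟨s, hs⟩ := T.exists_isNIndepSet_indepNum
    rw [← hα, ← hs.card_eq]
    exact Finset.card_le_univ s
  obtain ⟨c, hc⟩ : ∃ c, α + c = Fintype.card V := ⟨_, Nat.add_sub_cancel' hαn⟩
  have hcover : ∀ H : SimpleGraph V, H.indepNum = α → ∃ C, H.Cover C ∧ C.card ≤ c := by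
    intro H hH
    obtain ⟨C, hC, hCc⟩ := exists_cover_of_indepNum (T := H) (c := c) (by rw [hH, hc])
    exact ⟨C, hC, hCc.le⟩
  obtain ⟨T', hT'⟩ := exists_isMinimizer hT (hcover T hα)
  -- The cover of the minimizer has exactly `c` vertices, so `T'` has stability number `α` and
  -- competes in the definition of extremality.
  obtain ⟨C', rfl, hC'⟩ := hT'.exists_starTree (by omega)
  have hα' : T'.indepNum = α := by
    have := hC'.indepNum_add_card
    omega
  constructor
  · intro hext
    have hmin : T.IsMinimizer C'.card := by
      refine ⟨hT, hcover T hα, fun H hH hHC => le_trans ?_ (hT'.le H hH hHC)⟩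
      rw [cnt_empty, cnt_empty, Nat.cast_le]
      exact hext.2 T' hC'.isTree (by rw [hα, hα'])
    obtain ⟨C, hCc, hC⟩ := hmin.exists_starTree (by omega)
    rw [← hCc] at hmin hc
    refine ⟨⟨hC.isTreeOfStars, fun u v hu hv => ?_⟩, ?_⟩
    · rw [← card_nb, ← card_nb]
      exact hmin.balanced hC le_rfl (hC.isCenter_iff.1 hu) (hC.isCenter_iff.1 hv)
    · obtain ⟨k, f, hf⟩ := hmin.exists_iso hC hc hlight
      refine ⟨k, f, fun v hv => hf v ?_⟩
      rw [isLightCenter_iff, hα] at hv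
      exact hv
  · rintro ⟨⟨htos, hbal⟩, k, f, hf⟩
    obtain ⟨C, hC⟩ := htos.exists_starTree hT
    have hCc : C.card = C'.card := by
      have := hC.indepNum_add_card
      omega
    obtain ⟨k', f', hf'⟩ := hT'.exists_iso hC' hc hlight
    -- `T` and the minimizer both satisfy the three conditions, so their counts agree and `T`
    -- attains the minimum.
    have heq := hC.fibonacciNumber_eq_of_light_end hC' hCc (fun u hu v hv => by
        have := hbal u v (hC.isCenter_iff.2 hu) (hC.isCenter_iff.2 hv)
        rwa [← card_nb, ← card_nb] at this)
      (fun u hu v hv => hT'.balanced hC' le_rfl hu hv) (hCc ▸ hc) f f'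
      (fun v hv => hf v (by rw [isLightCenter_iff, hα]; exact hv)) hf'
    refine ⟨hT, fun H hH hHα => ?_⟩
    have := hT'.le H hH (hcover H (hHα.trans hα))
    rw [cnt_empty, cnt_empty, Nat.cast_le] at this
    rw [heq]
    exact this

end Characterization

end SimpleGraph

theorem theorem3 {V : Type*} [Finite V] (T : SimpleGraph V) (hT : T.IsTree) (n α : ℕ)
    (hn : Nat.card V = n) (hα : T.indepNum = α) (hlarge : n < 2 * α)
    (hlight : SimpleGraph.numLight n α ≤ 2) :
    T.IsExtremalTree ↔
      T.IsBalancedTreeOfStars ∧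
        ∃ (k : ℕ) (φ : T.centerTree ≃g SimpleGraph.pathGraph k),
          ∀ c : {v : V // T.IsCenter v}, T.IsLightCenter (c : V) →
            (φ c : ℕ) = 0 ∨ (φ c : ℕ) + 1 = k := by
  have := Fintype.ofFinite V
  rw [Nat.card_eq_fintype_card] at hn
  subst hn
  exact hT.isExtremalTree_iff hα hlarge hlight
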